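/- **Fredholm determinants with Dirac terms.** Let $K(r,s;r',s')=K^{\mathrm{reg}}(r,s;r',s')-\mathbb 1_{r'>r}\,\delta\big((s'+h(r'))-(s+h(r))\big)$ with a function $K^{\mathrm{reg}}$ and a shift function $h$. For distinct $r_1,\dots,r_m$ and real $a_1,\dots,a_m$ let $$D_K(r;a)=\sum_{k\ge 0}\frac{(-1)^k}{k!}\sum_{i_1,\dots,i_k=1}^m\int_{\mathbb R^k}\det\big(\mathbb 1_{x_p\ge a_{i_p}}K(r_{i_p},x_p;r_{i_q},x_q)\mathbb 1_{x_q\ge a_{i_q}}\big)_{p,q=1}^k\,dx .$$ The determinant is expanded over permutations $\sigma$ and subsets $S$ of rows from which the Dirac term is taken; the Dirac factors $\delta\big((x_{\sigma(p)}+h(r_{i_{\sigma(p)}}))-(x_p+h(r_{i_p}))\big)$, $p\in S$, are integrated out (unit mass also at an end point of the domain), which leaves the Lebesgue integral over the common values of $x+h$ on the chains $p\to\sigma(p)$, $p\in S$. A process $X$ *has kernel $K$* if $\mathbb P(X(r_1)<a_1,\dots,X(r_m)<a_m)=D_K(r;a)$ (a convergent series) for all $m$, all distinct times $r_1,\dots,r_m$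 and all real $a_j$. Let $r_{ji}=r_j-r_i$, $s_{21}=s_2-s_1$, let $I_1(x)=\frac1{2\pi i}\oint_{|t|=1} t^{-2}e^{\frac x2(t+1/t)}dt$ be the modified Bessel function, let $\Gamma$ be the line $\mathrm{Re}\,x=-1$ directed upwards and $\Gamma_0$ the counterclockwise circle $|x|=1/2$. The process $X_{A_2\to N}(r)$, $r\ge0$, has the kernel $$\frac{1}{(2\pi i)^2}\int_{\Gamma}dx_1\oint_{\Gamma_0}dx_2\,\frac{x_1\exp\left(\frac{x_1^2-x_2^2}2+\frac{r_i}{x_1}+s_1x_1-\frac{r_j}{x_2}-s_2x_2\right)}{x_2(x_1-x_2)}-\mathbb 1_{r_j>r_i}\left[\mathbb 1_{s_2>s_1}\sqrt{\tfrac{r_{ji}}{s_{21}}}\,I_1\big(2\sqrt{s_{21}r_{ji}}\big)+\delta(s_{21})\right];$$ for $\tau>0$ the process $X^{(\tau)}_{A_1\to N}(r)$, $r\in\mathbb R$, has the kernel $$\tau\int_\Gamma\frac{dx}{2\pi i}\exp\left[\tau^2\frac{x^2-x^{-2}}2+\tau\big(s_1x-s_2x^{-1}-r_{ji}(x+x^{-1})\big)\right]-\mathbb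 1_{r_j>r_i}\left[\delta(s_{21}+r_{ji})+\mathbb 1_{s_{21}+r_{ji}>0}\frac{\tau I_1\big(2\tau\sqrt{r_{ji}(r_{ji}+s_{21})}\big)}{\sqrt{1+s_{21}/r_{ji}}}\right];$$ and the process $X_1(r)$, $r\in\mathbb R$, has the kernel $\frac{1}{\sqrt{2\pi}}e^{-\frac12(s_1+r_i-r_j)^2}-\mathbb 1_{r_j>r_i}\delta(s_{21}+r_{ji})$. **Proposition.** Let $N$ be a standard normal random variable, not depending on $r$. In the sense of finite-dimensional distributions, 1. $X_{A_2\to N}(\epsilon r)\to N$ as $\epsilon\to0^+$, $r\ge0$; 2. $X^{(\tau)}_{A_1\to N}(r)\to X_1(r)$ as $\tau\to0^+$, $r\in\mathbb R$, and for each $r$ the variable $X_1(r)$ is standard normal; 3. $X_1(\epsilon r)\to N$ as $\epsilon\to0^+$, $r\in\mathbb R$. This means weak convergence of the laws of the values at any finitely many distinct times, for all processes with these kernels. Moreover, independently of the existence of such processes, for the three kernels all integrals in the series $D_K(r;a)$ and the series itself converge absolutely (for distinct times, nonnegative in the case of $X_{A_2\to N}$), for all distinct admissible $r_1,\dots,r_m$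 and all real $a_1,\dots,a_m$ the determinants $D_K$ in 1 and 3 (with times $\epsilon r_j$) converge to $\mathbb P(N<\min_j a_j)$ (equal to $1$ if $m=0$), those in 2 converge to the determinant of $X_1$, and the one-point determinant of $X_1$ is $\mathbb P(N<a)$. -/

import Mathlib

open MeasureTheory ProbabilityTheory Filter Topology
open scoped NNReal

noncomputable section

/-- An extended kernel with a Dirac part. The data `reg`, `shift` encode the generalized kernel
`K(r, s; r', s') = reg r s r' s' - 1_{r' > r} δ((s' + shift r') - (s + shift r))`,
where `r, r'` are times and `s, s'` are space variables. -/
structure DeltaKernel where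
  reg : ℝ → ℝ → ℝ → ℝ → ℂ
  shift : ℝ → ℝ

/-- Classes of `{0, …, k-1}` after identifying `p` with `σ p` for every `p ∈ S`. -/
def LinkClass {k : ℕ} (σ : Equiv.Perm (Fin k)) (S : Finset (Fin k)) : Type :=
  Quot (fun p q : Fin k => p ∈ S ∧ q = σ p)

def LinkClass.mk {k : ℕ} (σ : Equiv.Perm (Fin k)) (S : Finset (Fin k)) (p : Fin k) :
    LinkClass σ S := Quot.mk _ p

instance {k : ℕ} (σ : Equiv.Perm (Fin k)) (S : Finset (Fin k)) : Finite (LinkClass σ S) :=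
  Finite.of_surjective (LinkClass.mk σ S) Quot.mk_surjective

instance {k : ℕ} (σ : Equiv.Perm (Fin k)) (S : Finset (Fin k)) : Fintype (LinkClass σ S) :=
  Fintype.ofFinite _

namespace DeltaKernel

variable {m : ℕ} (K : DeltaKernel) (r a : Fin m → ℝ) {k : ℕ} (i : Fin k → Fin m)
  (σ : Equiv.Perm (Fin k)) (S : Finset (Fin k))

/-- In the product `∏_p K(r_{i p}, x_p; r_{i (σ p)}, x_{σ p})` the Dirac part may be taken from the
factors `p ∈ S` only if all the indicators `1_{r_{i (σ p)} > r_{i p}}`, `p ∈ S`, are equal to 1. -/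
def Admissible : Prop := ∀ p ∈ S, r (i p) < r (i (σ p))

/-- The space variables on the support `{x_{σ p} + shift = x_p + shift, p ∈ S}` of the Dirac
factors, parametrized by the common values `u` of `x + shift` on the classes of linked indices. -/
def point (u : LinkClass σ S → ℝ) (p : Fin k) : ℝ :=
  u (LinkClass.mk σ S p) - K.shift (r (i p))

/-- The projectors `1_{x_p ≥ a_{i p}}` times the factors `p ∉ S`, which contribute `reg`.
(Each projector occurs twice in the determinant, once in its row and once in its column, and is
idempotent.) -/
def integrand (u : LinkClass σ S → ℝ) : ℂ :=
  (∏ p, if a (i p) ≤ K.point r i σ S u p then (1 : ℂ) else 0) *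
    ∏ p ∈ Sᶜ, K.reg (r (i p)) (K.point r i σ S u p) (r (i (σ p))) (K.point r i σ S u (σ p))

open Classical in
/-- The integral over `x ∈ ℝ^k` of `∏_p` of the factors of the permutation `σ`, with
`-1_{r' > r} δ` taken from the factors `p ∈ S` and `reg` from the others. The Dirac factors are
integrated out: the links `p → σ p`, `p ∈ S`, form disjoint paths, and the product of the Dirac
factors is Lebesgue measure in the common values of `x + shift` on these paths. -/
def permTerm : ℂ :=
  if Admissible r i σ S then
    (-1) ^ S.card * ∫ u : LinkClass σ S → ℝ, K.integrand r a i σ S u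
  else 0

/-- The `k`-th term of the Fredholm series of `det(1 - P_a K P_a)` on `{1, …, m} × ℝ`,
`(-1)^k / k! * ∑_{i_1, …, i_k} ∫_{ℝ^k} det (1_{x_p ≥ a_{i_p}} K(r_{i_p}, x_p; r_{i_q}, x_q)
1_{x_q ≥ a_{i_q}})_{p, q} dx`, the determinant being expanded over permutations and each entry
being split into its regular part and its Dirac part. -/
def fredholmTerm (k : ℕ) : ℂ :=
  (-1) ^ k / (k.factorial : ℂ) *
    ∑ i : Fin k → Fin m, ∑ σ : Equiv.Perm (Fin k), ∑ S : Finset (Fin k),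
      ((Equiv.Perm.sign σ : ℤ) : ℂ) * K.permTerm r a i σ S

/-- The Fredholm determinant `det(1 - P_a K P_a)` as the sum of its Fredholm series. -/
def fredholmDet : ℂ := ∑' k, K.fredholmTerm r a k

/-- The Fredholm series is well defined: all the integrals in it converge absolutely, and so does
the series. -/
def FredholmConverges : Prop :=
  (∀ (k : ℕ) (i : Fin k → Fin m) (σ : Equiv.Perm (Fin k)) (S : Finset (Fin k)),
    Admissible r i σ S → Integrable (K.integrand r a i σ S)) ∧
  Summable (K.fredholmTerm r a)

end DeltaKernel

/-- The modified Bessel function of the first kind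
`I_n(x) = (2πi)⁻¹ ∮ t^(-n-1) exp((x/2)(t + 1/t)) dt`. -/
def besselI (n : ℤ) (x : ℝ) : ℂ :=
  (2 * Real.pi * Complex.I)⁻¹ *
    ∮ t in C(0, 1), t ^ (-n - 1) * Complex.exp ((x / 2 : ℂ) * (t + t⁻¹))

/-- `∫ f(x) dx` along the upward vertical line `Re x = -1`, which leaves the origin on its right. -/
def vertIntegral (f : ℂ → ℂ) : ℂ := ∫ y : ℝ, f (-1 + y * Complex.I) * Complex.I

/-- The kernel of the transitional process from Airy₂ to normal (step initial condition). The circle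
`|x₂| = 1/2` lies on the right of the line `Re x₁ = -1`. -/
def stepKernel : DeltaKernel where
  reg r₁ s₁ r₂ s₂ :=
    ((2 * Real.pi * Complex.I) ^ 2)⁻¹ * vertIntegral (fun x₁ => ∮ x₂ in C(0, 1 / 2),
      x₁ * Complex.exp ((x₁ ^ 2 - x₂ ^ 2) / 2 + r₁ / x₁ + s₁ * x₁ - r₂ / x₂ - s₂ * x₂) /
        (x₂ * (x₁ - x₂)))
    - if r₁ < r₂ ∧ s₁ < s₂ then
        (Real.sqrt ((r₂ - r₁) / (s₂ - s₁)) : ℂ) *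
          besselI 1 (2 * Real.sqrt ((s₂ - s₁) * (r₂ - r₁)))
      else 0
  shift _ := 0

/-- The kernel of the transitional process from Airy₁ to normal (alternating initial condition) with
parameter `τ > 0`. -/
def altKernel (τ : ℝ) : DeltaKernel where
  reg r₁ s₁ r₂ s₂ :=
    τ * (2 * Real.pi * Complex.I)⁻¹ * vertIntegral (fun x =>
      Complex.exp (τ ^ 2 * ((x ^ 2 - (x ^ 2)⁻¹) / 2) +
        τ * (s₁ * x - s₂ * x⁻¹ - (r₂ - r₁) * (x + x⁻¹))))
    - if r₁ < r₂ ∧ 0 < s₂ - s₁ + (r₂ - r₁) then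
        τ * besselI 1 (2 * τ * Real.sqrt ((r₂ - r₁) * (r₂ - r₁ + (s₂ - s₁)))) /
          (Real.sqrt (1 + (s₂ - s₁) / (r₂ - r₁)) : ℂ)
      else 0
  shift r := r

/-- The kernel of the process `X₁`. -/
def xOneKernel : DeltaKernel where
  reg r₁ s₁ r₂ _ := ((Real.exp (-(s₁ + r₁ - r₂) ^ 2 / 2) / Real.sqrt (2 * Real.pi) : ℝ) : ℂ)
  shift r := r

/-- The real process `X`, indexed by times in `T` (`time : T → ℝ` is the inclusion), has the finite
dimensional distributions given by the Fredholm determinants of `K`: for distinct times,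
`P(X(r_1) < a_1, …, X(r_m) < a_m) = det(1 - P_a K P_a)`. -/
structure IsFredholmProcess {T Ω : Type*} [MeasurableSpace Ω] (K : DeltaKernel) (time : T → ℝ)
    (X : T → Ω → ℝ) (P : Measure Ω) : Prop where
  aemeasurable : ∀ t, AEMeasurable (X t) P
  hasSum : ∀ (m : ℕ) (r : Fin m → T), Function.Injective r → ∀ a : Fin m → ℝ,
    HasSum (K.fredholmTerm (fun j => time (r j)) a)
      ((P.real {ω | ∀ j, X (r j) ω < a j} : ℝ) : ℂ)

/-- Convergence of processes in the sense of finite dimensional distributions. -/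
def TendstoFDD {T ι Ω' : Type*} {Ω : ι → Type*} [∀ n, MeasurableSpace (Ω n)] [MeasurableSpace Ω']
    (X : (n : ι) → T → Ω n → ℝ) (l : Filter ι) (Y : T → Ω' → ℝ)
    (P : (n : ι) → Measure (Ω n)) [∀ n, IsProbabilityMeasure (P n)]
    (P' : Measure Ω') [IsProbabilityMeasure P'] : Prop :=
  ∀ (m : ℕ) (r : Fin m → T), Function.Injective r →
    TendstoInDistribution (fun n ω j => X n (r j) ω) l (fun ω j => Y (r j) ω) P P'

end

/-! The proof is dominated convergence in the Fredholm series, in the variables u = x + h(r). In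
these variables the Dirac factors only say that u is constant along the chains p → σ p, p ∈ S, and
the regular parts converge pointwise. The Bessel terms are bounded by a multiple of the time
difference (times τ² in the alternating case), so they vanish. The contour integrals tend to a
Gaussian density: at time zero the circle of the step kernel encloses only a simple pole at the
origin, and after the substitution z = τx the alternating exponent is z²/2 + pz up to terms that
vanish with τ.

The difficulty is a bound uniform in the parameter, because the Bessel terms do not decay along u =
v. The kernel is therefore conjugated by weights exp(c_j u) with c_j increasing in the time r_j;
`exists_expBound` shows that the conjugated regular part decays in both variables. An admissible
chain runs forward in time, so every link of a chain costs at most a constant. The weights telescope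
around σ, and each chain keeps a factor exp(-κu) (`Admissible.sum_weight_le`). A chain has at most m
points, so n = |Sᶜ| satisfies k ≤ nm (`Admissible.card_le`). Permutations that agree on S have the
same chains and together form a determinant of size n. Hadamard's inequality and an average over
cosets bound the k-th term by a sum of expressions n^(n/2) D^k / n!, which is summable because D^k ≤
(D^m)^n (`ExpBound.norm_fredholmTerm_le`). This yields absolute convergence and
`tendsto_fredholmDet`.

In 1 and 3 the limit kernel has a regular part φ(u) that depends on the row variable only. Two or
more regular rows then cancel by antisymmetry. With exactly one regular row, the only admissible
permutation is the cycle that lists the chosen times in increasing order. The series becomes the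
inclusion-exclusion expansion of ∫ φ ∏_j (1 - 1_{x ≥ a_j}) (`fredholmDet_rankOne`).

Finally, convergence of joint distribution functions at every point gives convergence on half-open
boxes, hence weak convergence (`tendsto_probabilityMeasure_of_orthant`). -/

noncomputable section

/-! ### Hadamard's inequality and the size of n^(n/2) / n! -/

open scoped ComplexOrder in
/-- Hadamard's inequality for a complex matrix with entries bounded by `C`. -/
theorem Matrix.norm_det_le_of_entry_le {ι : Type*} [Fintype ι] [DecidableEq ι]
    (A : Matrix ι ι ℂ) {C : ℝ} (hC : 0 ≤ C) (hA : ∀ p q, ‖A p q‖ ≤ C) :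
    ‖A.det‖ ≤ C ^ Fintype.card ι * √((Fintype.card ι : ℝ) ^ Fintype.card ι) := by
  classical
  set n := Fintype.card ι with hn
  rcases Nat.eq_zero_or_pos n with h0 | hpos
  · have : IsEmpty ι := Fintype.card_eq_zero_iff.1 h0
    simp [h0]
  have hn' : (0 : ℝ) < n := by exact_mod_cast hpos
  -- The eigenvalues of A Aᴴ have product |det A|² and sum equal to the squared Frobenius norm, at
  -- most n · nC²; the arithmetic-geometric mean inequality compares the two.
  have hpsd := Matrix.posSemidef_self_mul_conjTranspose A
  have hH := hpsd.isHermitian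
  have hev : ∀ p, 0 ≤ hH.eigenvalues p := hpsd.eigenvalues_nonneg
  have hdet : ‖A.det‖ ^ 2 = ∏ p, hH.eigenvalues p := by
    have h1 := hH.det_eq_prod_eigenvalues
    rw [Matrix.det_mul, Matrix.det_conjTranspose, Complex.star_def, Complex.mul_conj,
      Complex.normSq_eq_norm_sq] at h1
    have h2 : ((∏ p, hH.eigenvalues p : ℝ) : ℂ) = ∏ p, (hH.eigenvalues p : ℂ) := by push_cast; rfl
    exact Complex.ofReal_injective (h1.trans h2.symm)
  have htr : ∑ p, hH.eigenvalues p ≤ n * (n * C ^ 2) := by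
    have h1 := hH.trace_eq_sum_eigenvalues
    have h2 : (A * A.conjTranspose).trace = ((∑ p, ∑ q, ‖A p q‖ ^ 2 : ℝ) : ℂ) := by
      simp only [Matrix.trace, Matrix.diag, Matrix.mul_apply, Matrix.conjTranspose_apply,
        Complex.star_def, Complex.mul_conj, Complex.normSq_eq_norm_sq]
      push_cast
      rfl
    have h3 : ∑ p, hH.eigenvalues p = ∑ p, ∑ q, ‖A p q‖ ^ 2 := by
      apply Complex.ofReal_injective
      rw [← h2, h1]
      push_cast
      rfl
    rw [h3]
    calc ∑ p, ∑ q, ‖A p q‖ ^ 2 ≤ ∑ _p : ι, ∑ _q : ι, C ^ 2 := by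
          gcongr with p _ q _
          exact hA p q
      _ = n * (n * C ^ 2) := by simp [hn]
  have hamgm := Real.geom_mean_le_arith_mean_weighted Finset.univ (fun _ : ι => (n : ℝ)⁻¹)
    hH.eigenvalues (fun _ _ => by positivity) (by simp [← hn, hn'.ne']) (fun p _ => hev p)
  have hle : ∏ p, hH.eigenvalues p ≤ (n * C ^ 2) ^ n := by
    have h1 : ∏ p, hH.eigenvalues p = (∏ p, hH.eigenvalues p ^ ((n : ℝ)⁻¹)) ^ n := by
      rw [← Finset.prod_pow]
      refine Finset.prod_congr rfl fun p _ => ?_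
      rw [Real.rpow_inv_natCast_pow (hev p) hpos.ne']
    rw [h1]
    refine pow_le_pow_left₀ (Finset.prod_nonneg fun p _ => Real.rpow_nonneg (hev p) _)
      (hamgm.trans ?_) n
    rw [← Finset.mul_sum, inv_mul_le_iff₀ hn']
    exact htr
  have hsq : ‖A.det‖ ^ 2 ≤ (C ^ n * √((n : ℝ) ^ n)) ^ 2 := by
    rw [hdet, mul_pow, Real.sq_sqrt (by positivity)]
    refine hle.trans (le_of_eq ?_)
    rw [mul_pow]
    ring
  exact le_of_sq_le_sq hsq (by positivity)

/-- After squaring, one factor n^n / n! is at most e^n, and the remaining (B² e)^n / n! is a single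
term of an exponential series. The bound is uniform in n. -/
theorem sqrt_pow_self_div_factorial_le (B : ℝ) (n : ℕ) :
    B ^ n * (√((n : ℝ) ^ n) / n.factorial) ≤ √(Real.exp (B ^ 2 * Real.exp 1)) := by
  have hf : (0 : ℝ) < n.factorial := by exact_mod_cast n.factorial_pos
  apply Real.le_sqrt_of_sq_le
  rw [mul_pow, div_pow, Real.sq_sqrt (by positivity)]
  have h1 : (n : ℝ) ^ n / n.factorial ≤ Real.exp n :=
    Real.pow_div_factorial_le_exp _ (Nat.cast_nonneg n) n
  have h2 : (B ^ 2 * Real.exp 1) ^ n / n.factorial ≤ Real.exp (B ^ 2 * Real.exp 1) :=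
    Real.pow_div_factorial_le_exp _ (by positivity) n
  calc (B ^ n) ^ 2 * ((n : ℝ) ^ n / (n.factorial : ℝ) ^ 2)
      = (B ^ n) ^ 2 * ((n : ℝ) ^ n / n.factorial) / n.factorial := by field_simp
    _ ≤ (B ^ n) ^ 2 * Real.exp n / n.factorial := by gcongr
    _ = (B ^ 2 * Real.exp 1) ^ n / n.factorial := by
        rw [mul_pow, ← Real.exp_nat_mul, mul_one]; ring
    _ ≤ _ := h2

/-! ### Chains of indices linked by Dirac factors -/

theorem integral_quot_congr {α : Type*} {R R' : α → α → Prop} (h : R = R')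
    [Fintype (Quot R)] [Fintype (Quot R')] (F : (α → ℝ) → ℂ) :
    ∫ u : Quot R → ℝ, F (fun p => u (Quot.mk R p)) =
      ∫ u : Quot R' → ℝ, F (fun p => u (Quot.mk R' p)) := by
  subst h
  rename_i i1 i2
  obtain rfl : i1 = i2 := Subsingleton.elim _ _
  rfl

namespace DeltaKernel

variable {m k : ℕ} {r : Fin m → ℝ} {i : Fin k → Fin m} {σ σ' : Equiv.Perm (Fin k)}
  {S : Finset (Fin k)}

/-- Every step from a point of S strictly increases the time, and only m times are available, so an
orbit leaves S in fewer than m steps. -/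
theorem Admissible.exists_pow_notMem (h : Admissible r i σ S) (p : Fin k) :
    ∃ j : Fin m, (σ ^ (j : ℕ)) p ∉ S := by
  by_contra! hS
  have hmono : StrictMono fun j : Fin (m + 1) => r (i ((σ ^ (j : ℕ)) p)) := by
    rw [Fin.strictMono_iff_lt_succ]
    intro j
    have := h _ (hS j)
    simpa [pow_succ'] using this
  have hinj : Function.Injective fun j : Fin (m + 1) => i ((σ ^ (j : ℕ)) p) :=
    fun j j' hj => hmono.injective (congrArg r hj)
  simpa using Fintype.card_le_of_injective _ hinj

/-- An index is recovered from the point of Sᶜ that its orbit reaches and the number of steps taken,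
and that number is less than m. -/
theorem Admissible.card_le (h : Admissible r i σ S) : k ≤ Sᶜ.card * m := by
  choose j hj using h.exists_pow_notMem
  have hinj : Function.Injective
      fun p => ((⟨(σ ^ (j p : ℕ)) p, by simpa using hj p⟩ : {x // x ∈ Sᶜ}), j p) := by
    intro p q hpq
    simp only [Prod.mk.injEq, Subtype.mk.injEq] at hpq
    rw [hpq.2] at hpq
    exact (σ ^ (j q : ℕ)).injective hpq.1
  simpa only [Fintype.card_fin, Fintype.card_prod, Fintype.card_coe] using
    Fintype.card_le_of_injective _ hinj

theorem linkClass_mk_apply {p : Fin k} (hp : p ∈ S) :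
    LinkClass.mk σ S (σ p) = LinkClass.mk σ S p :=
  (Quot.sound ⟨hp, rfl⟩).symm

/-- The end of a chain lies outside S, and following the links up to it does not leave the class. So
every class contains a row with a regular factor, which provides decay in the variable of that
class. -/
theorem Admissible.exists_mk_eq (h : Admissible r i σ S) (c : LinkClass σ S) :
    ∃ q, q ∉ S ∧ LinkClass.mk σ S q = c := by
  obtain ⟨p, rfl⟩ := Quot.exists_rep c
  have key : ∀ (j : ℕ) (p : Fin k), (σ ^ j) p ∉ S →
      ∃ q, q ∉ S ∧ LinkClass.mk σ S q = LinkClass.mk σ S p := by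
    intro j
    induction j with
    | zero => exact fun p hp => ⟨p, by simpa using hp, rfl⟩
    | succ j ih =>
      intro p hp
      by_cases hpS : p ∈ S
      · obtain ⟨q, hq, hqp⟩ := ih (σ p) (by simpa [pow_succ] using hp)
        exact ⟨q, hq, hqp.trans (linkClass_mk_apply hpS)⟩
      · exact ⟨p, hpS, rfl⟩
  obtain ⟨j, hj⟩ := h.exists_pow_notMem p
  exact key j p hj

theorem admissible_congr (h : ∀ p ∈ S, σ p = σ' p) : Admissible r i σ S ↔ Admissible r i σ' S := by
  unfold Admissible
  refine forall₂_congr fun p hp => ?_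
  rw [h p hp]

/-- The classes depend only on the restriction of σ to S. The integrand is a function of the values
at all indices, so that it makes sense for both quotients and all permutations agreeing on S can be
integrated over the same space. -/
theorem integral_linkClass_congr (h : ∀ p ∈ S, σ p = σ' p) (F : (Fin k → ℝ) → ℂ) :
    ∫ u : LinkClass σ S → ℝ, F (fun p => u (LinkClass.mk σ S p)) =
      ∫ u : LinkClass σ' S → ℝ, F (fun p => u (LinkClass.mk σ' S p)) := by
  have hR : (fun p q : Fin k => p ∈ S ∧ q = σ p) = fun p q : Fin k => p ∈ S ∧ q = σ' p := by
    ext p q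
    refine and_congr_right fun hp => ?_
    rw [h p hp]
  let : Fintype (Quot fun p q : Fin k => p ∈ S ∧ q = σ p) :=
    inferInstanceAs (Fintype (LinkClass σ S))
  let : Fintype (Quot fun p q : Fin k => p ∈ S ∧ q = σ' p) :=
    inferInstanceAs (Fintype (LinkClass σ' S))
  exact integral_quot_congr hR F

end DeltaKernel

/-! ### Exponential weights and domination of the integrands -/

namespace DeltaKernel

variable {m k : ℕ}

/-- The integrand of `permTerm` as a function of the values of `x + shift` at all indices. -/
def pathIntegrand (K : DeltaKernel) (r a : Fin m → ℝ) (i : Fin k → Fin m)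
    (σ : Equiv.Perm (Fin k)) (S : Finset (Fin k)) (U : Fin k → ℝ) : ℂ :=
  (∏ p, if a (i p) ≤ U p - K.shift (r (i p)) then (1 : ℂ) else 0) *
    ∏ p ∈ Sᶜ, K.reg (r (i p)) (U p - K.shift (r (i p))) (r (i (σ p)))
      (U (σ p) - K.shift (r (i (σ p))))

theorem integrand_eq (K : DeltaKernel) (r a : Fin m → ℝ) (i : Fin k → Fin m)
    (σ : Equiv.Perm (Fin k)) (S : Finset (Fin k)) (u : LinkClass σ S → ℝ) :
    K.integrand r a i σ S u = K.pathIntegrand r a i σ S fun p => u (LinkClass.mk σ S p) := rfl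

/-- Exponential weights `exp (c j * u)`, monotone in the time `r j`, in which the conjugated regular
part of the kernel decays in both variables at rate `κ`, on the half-line `[b, ∞)` of the variables
`x + shift`. -/
structure ExpBound (K : DeltaKernel) (r a : Fin m → ℝ) (b C κ M : ℝ) (c : Fin m → ℝ) : Prop where
  mono : ∀ i j, r i < r j → c i ≤ c j
  abs_le : ∀ i, |c i| ≤ M
  one_le : 1 ≤ C
  pos : 0 < κ
  le_add_shift : ∀ j, b ≤ a j + K.shift (r j)
  norm_le : ∀ i j u v, b ≤ u → b ≤ v →
    ‖K.reg (r i) (u - K.shift (r i)) (r j) (v - K.shift (r j))‖ ≤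
      C * (Real.exp (-(c i + κ) * u) * Real.exp ((c j - κ) * v))

/-- The truncated exponential function dominating the integrands in one variable. -/
def expTail (b κ x : ℝ) : ℝ := if b ≤ x then Real.exp (-κ * x) else 0

theorem expTail_nonneg (b κ x : ℝ) : 0 ≤ expTail b κ x := by
  unfold expTail; split_ifs <;> positivity

theorem integrable_expTail (b : ℝ) {κ : ℝ} (hκ : 0 < κ) : Integrable (expTail b κ) := by
  have h : expTail b κ = (Set.Ici b).indicator fun x => Real.exp (-κ * x) := by
    ext x
    simp [expTail, Set.indicator_apply]
  rw [h, integrable_indicator_iff measurableSet_Ici, integrableOn_Ici_iff_integrableOn_Ioi]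
  exact exp_neg_integrableOn_Ioi b hκ

variable {r a : Fin m → ℝ} {i : Fin k → Fin m} {σ : Equiv.Perm (Fin k)} {S : Finset (Fin k)}
  {b C κ M : ℝ} {c : Fin m → ℝ} {K : DeltaKernel}

theorem Admissible.sum_weight_le (h : Admissible r i σ S) (hmono : ∀ i j, r i < r j → c i ≤ c j)
    (hM : ∀ i, |c i| ≤ M) (hκ : 0 < κ) (u : LinkClass σ S → ℝ) (hu : ∀ x, b ≤ u x) :
    ∑ p ∈ Sᶜ, (-(c (i p) + κ) * u (LinkClass.mk σ S p) +
      (c (i (σ p)) - κ) * u (LinkClass.mk σ S (σ p))) ≤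
      k * (2 * (M + κ) * |b|) + ∑ x, -κ * u x := by
  classical
  set U : Fin k → ℝ := fun p => u (LinkClass.mk σ S p) with hU
  have hbU : ∀ p, -|b| ≤ U p := fun p => (neg_abs_le b).trans (hu _)
  -- Summed over all p the weights telescope around σ, so the contribution of Sᶜ is minus that of S.
  have htot : ∑ p, (c (i (σ p)) * U (σ p) - c (i p) * U p) = 0 := by
    rw [Finset.sum_sub_distrib, Equiv.sum_comp σ fun p => c (i p) * U p, sub_self]
  rw [← Finset.sum_add_sum_compl S] at htot
  have hSle : -∑ p ∈ S, (c (i (σ p)) * U (σ p) - c (i p) * U p) ≤ ∑ _p ∈ S, 2 * M * |b| := by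
    rw [← Finset.sum_neg_distrib]
    refine Finset.sum_le_sum fun p hp => ?_
    have h1 : U (σ p) = U p := congrArg u (linkClass_mk_apply hp)
    have h2 := hmono _ _ (h p hp)
    have h3 := abs_le.1 (hM (i (σ p)))
    have h4 := abs_le.1 (hM (i p))
    rw [h1]
    -- On a link u is the same at both ends and c does not decrease, so the weight can only lose
    -- what comes from negative u, which is at least -|b|.
    have h5 : 0 ≤ (c (i (σ p)) - c (i p)) * (U p + |b|) :=
      mul_nonneg (by linarith) (by linarith [hbU p])
    have h6 : (c (i (σ p)) - c (i p)) * |b| ≤ 2 * M * |b| :=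
      mul_le_mul_of_nonneg_right (by linarith) (abs_nonneg b)
    linarith
  have hclass : ∑ p ∈ Sᶜ, -κ * U p ≤ ∑ x, -κ * u x + k * (κ * |b|) := by
    -- One regular row is kept per class. After subtracting κ|b| the terms of the other rows are
    -- nonpositive and can be dropped.
    choose e he1 he2 using h.exists_mk_eq
    have heinj : Function.Injective e := fun x y hxy => by rw [← he2 x, ← he2 y, hxy]
    have hsub : Finset.univ.image e ⊆ Sᶜ := by
      intro p hp
      obtain ⟨x, -, rfl⟩ := Finset.mem_image.1 hp
      simpa using he1 x
    have h1 : ∑ p ∈ Sᶜ, (-κ * U p - κ * |b|) ≤ ∑ p ∈ Finset.univ.image e, (-κ * U p - κ * |b|) := by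
      rw [← Finset.sum_sdiff hsub]
      have : ∑ p ∈ Sᶜ \ Finset.univ.image e, (-κ * U p - κ * |b|) ≤ 0 := by
        refine Finset.sum_nonpos fun p _ => ?_
        nlinarith [hbU p]
      linarith
    rw [Finset.sum_image (fun x _ y _ hxy => heinj hxy)] at h1
    have h2 : ∀ x, U (e x) = u x := fun x => congrArg u (he2 x)
    simp only [h2, Finset.sum_sub_distrib, Finset.sum_const, nsmul_eq_mul] at h1
    have h3 : (Sᶜ.card : ℝ) ≤ k := by
      have := Finset.card_le_univ Sᶜ
      rw [Fintype.card_fin] at this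
      exact_mod_cast this
    have h4 : 0 ≤ κ * |b| := by positivity
    have h5 : (Sᶜ.card : ℝ) * (κ * |b|) ≤ k * (κ * |b|) := by gcongr
    have h6 : 0 ≤ ((Finset.univ : Finset (LinkClass σ S)).card : ℝ) * (κ * |b|) := by positivity
    linarith
  -- The decay in the column variables is not needed; it is only bounded above.
  have hσ : ∑ p ∈ Sᶜ, -κ * U (σ p) ≤ ∑ _p ∈ Sᶜ, κ * |b| := by
    refine Finset.sum_le_sum fun p _ => ?_
    nlinarith [hbU (σ p)]
  have hsplit : ∑ p ∈ Sᶜ, (-(c (i p) + κ) * U p + (c (i (σ p)) - κ) * U (σ p)) =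
      ∑ p ∈ Sᶜ, (c (i (σ p)) * U (σ p) - c (i p) * U p) + ∑ p ∈ Sᶜ, -κ * U p +
        ∑ p ∈ Sᶜ, -κ * U (σ p) := by
    rw [← Finset.sum_add_distrib, ← Finset.sum_add_distrib]
    exact Finset.sum_congr rfl fun p _ => by ring
  have hM0 : k = 0 ∨ 0 ≤ M := by
    rcases Nat.eq_zero_or_pos k with h0 | h0
    · exact Or.inl h0
    · exact Or.inr ((abs_nonneg _).trans (hM (i ⟨0, h0⟩)))
  have hcard : (S.card : ℝ) * (2 * M * |b|) + Sᶜ.card * (κ * |b|) + k * (κ * |b|) ≤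
      k * (2 * (M + κ) * |b|) := by
    have h3 : (Sᶜ.card : ℝ) ≤ k := by
      have := Finset.card_le_univ Sᶜ
      rw [Fintype.card_fin] at this
      exact_mod_cast this
    have h4 : (S.card : ℝ) ≤ k := by
      have := Finset.card_le_univ S
      rw [Fintype.card_fin] at this
      exact_mod_cast this
    rcases hM0 with h0 | h0
    · subst h0
      have e1 : (Sᶜ.card : ℝ) ≤ 0 := by exact_mod_cast h3
      have e2 : (S.card : ℝ) ≤ 0 := by exact_mod_cast h4
      have e1' : (Sᶜ.card : ℝ) = 0 := le_antisymm e1 (by positivity)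
      have e2' : (S.card : ℝ) = 0 := le_antisymm e2 (by positivity)
      rw [e1', e2']
      simp
    · have e1 : (S.card : ℝ) * (2 * M * |b|) ≤ k * (2 * M * |b|) := by gcongr
      have e2 : (Sᶜ.card : ℝ) * (κ * |b|) ≤ k * (κ * |b|) := by gcongr
      linarith
  simp only [Finset.sum_const, nsmul_eq_mul] at hSle hσ
  rw [hsplit]
  linarith

theorem Admissible.prod_weight_le (h : Admissible r i σ S)
    (hmono : ∀ i j, r i < r j → c i ≤ c j)
    (hM : ∀ i, |c i| ≤ M) (hκ : 0 < κ) (u : LinkClass σ S → ℝ) (hu : ∀ x, b ≤ u x) :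
    ∏ p ∈ Sᶜ, (Real.exp (-(c (i p) + κ) * u (LinkClass.mk σ S p)) *
      Real.exp ((c (i (σ p)) - κ) * u (LinkClass.mk σ S (σ p)))) ≤
      Real.exp (2 * (M + κ) * |b|) ^ k * ∏ x, expTail b κ (u x) := by
  simp only [← Real.exp_add, ← Real.exp_sum, expTail, hu, if_true]
  rw [← Real.exp_nat_mul, ← Real.exp_add]
  exact Real.exp_le_exp.2 (h.sum_weight_le hmono hM hκ u hu)

theorem ExpBound.pathIntegrand_eq_zero (hK : K.ExpBound r a b C κ M c) {U : Fin k → ℝ} {p : Fin k}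
    (hp : U p < b) : K.pathIntegrand r a i σ S U = 0 := by
  unfold pathIntegrand
  rw [Finset.prod_eq_zero (Finset.mem_univ p), zero_mul]
  rw [if_neg]
  have := hK.le_add_shift (i p)
  linarith

theorem norm_prod_ite_le (P : Fin k → Prop) [DecidablePred P] :
    ‖∏ p, if P p then (1 : ℂ) else 0‖ ≤ 1 := by
  rw [norm_prod]
  refine Finset.prod_le_one (fun _ _ => norm_nonneg _) fun p _ => ?_
  split_ifs <;> simp

theorem ExpBound.norm_sum_pathIntegrand_le (hK : K.ExpBound r a b C κ M c)
    (h : Admissible r i σ S) (u : LinkClass σ S → ℝ) :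
    ‖∑ ρ : Equiv.Perm {p // p ∉ S}, ((Equiv.Perm.sign ρ : ℤ) : ℂ) *
      K.pathIntegrand r a i (σ * Equiv.Perm.ofSubtype ρ) S fun p => u (LinkClass.mk σ S p)‖ ≤
      √((Sᶜ.card : ℝ) ^ Sᶜ.card) * (C * Real.exp (2 * (M + κ) * |b|)) ^ k *
        ∏ x, expTail b κ (u x) := by
  classical
  have hC0 : 0 ≤ C := zero_le_one.trans hK.one_le
  have hRHS : 0 ≤ √((Sᶜ.card : ℝ) ^ Sᶜ.card) * (C * Real.exp (2 * (M + κ) * |b|)) ^ k *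
        ∏ x, expTail b κ (u x) :=
    mul_nonneg (by positivity) (Finset.prod_nonneg fun x _ => expTail_nonneg _ _ _)
  by_cases hu : ∀ x, b ≤ u x
  swap
  · push Not at hu
    obtain ⟨x, hx⟩ := hu
    obtain ⟨p, rfl⟩ := Quot.exists_rep x
    rw [Finset.sum_eq_zero]
    · simpa using hRHS
    · intro ρ _
      rw [hK.pathIntegrand_eq_zero (p := p) hx, mul_zero]
  set U : Fin k → ℝ := fun p => u (LinkClass.mk σ S p) with hU
  set R : Fin k → Fin k → ℂ := fun p q =>
    K.reg (r (i p)) (U p - K.shift (r (i p))) (r (i q)) (U q - K.shift (r (i q))) with hR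
  set w : Fin k → ℝ := fun p => Real.exp (-(c (i p) + κ) * U p) with hw
  set w' : Fin k → ℝ := fun q => Real.exp ((c (i q) - κ) * U q) with hw'
  have hwpos : ∀ p, 0 < w p := fun p => Real.exp_pos _
  have hwpos' : ∀ p, 0 < w' p := fun p => Real.exp_pos _
  -- Rows and columns are divided by their weights, which makes the entries bounded by C. The
  -- product of all weights is the same for every ρ and comes out of the determinant.
  set A : Matrix {p // p ∉ S} {p // p ∉ S} ℂ := fun p q =>
    R p (σ q) / ((w p : ℂ) * (w' (σ q) : ℂ)) with hA
  have hAle : ∀ p q, ‖A p q‖ ≤ C := by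
    intro p q
    have h1 := hK.norm_le (i p) (i (σ q)) (U p) (U (σ q)) (hu _) (hu _)
    simp only [hA, norm_div, norm_mul, Complex.norm_real, Real.norm_eq_abs, abs_of_pos (hwpos _),
      abs_of_pos (hwpos' _)]
    rw [div_le_iff₀ (mul_pos (hwpos _) (hwpos' _))]
    exact h1
  have hcard : Fintype.card {p // p ∉ S} = Sᶜ.card :=
    Fintype.card_of_subtype _ fun x => by simp
  have hprod : ∀ f : Fin k → ℂ, ∏ p ∈ Sᶜ, f p = ∏ p : {p // p ∉ S}, f p := fun f =>
    Finset.prod_subtype _ (fun x => by simp) _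
  have hsum : ∑ ρ : Equiv.Perm {p // p ∉ S}, ((Equiv.Perm.sign ρ : ℤ) : ℂ) *
      K.pathIntegrand r a i (σ * Equiv.Perm.ofSubtype ρ) S U =
      (∏ p, if a (i p) ≤ U p - K.shift (r (i p)) then (1 : ℂ) else 0) *
        ((∏ p ∈ Sᶜ, ((w p : ℂ) * (w' (σ p) : ℂ))) * A.det) := by
    rw [← Matrix.det_transpose, Matrix.det_apply', Finset.mul_sum, Finset.mul_sum]
    refine Finset.sum_congr rfl fun ρ _ => ?_
    unfold pathIntegrand
    rw [hprod, hprod, Finset.prod_mul_distrib,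
      ← Equiv.prod_comp ρ fun p : {p // p ∉ S} => (w' (σ p) : ℂ)]
    have : ∀ p : {p // p ∉ S}, K.reg (r (i p)) (U p - K.shift (r (i p)))
        (r (i ((σ * Equiv.Perm.ofSubtype ρ) p)))
        (U ((σ * Equiv.Perm.ofSubtype ρ) p) - K.shift (r (i ((σ * Equiv.Perm.ofSubtype ρ) p)))) =
        (w p : ℂ) * (w' (σ (ρ p)) : ℂ) * A.transpose (ρ p) p := by
      intro p
      have h1 : (w p : ℂ) ≠ 0 := by exact_mod_cast (hwpos p).ne'
      have h2 : (w' (σ (ρ p)) : ℂ) ≠ 0 := by exact_mod_cast (hwpos' _).ne'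
      simp only [Equiv.Perm.mul_apply, Equiv.Perm.ofSubtype_apply_coe]
      exact (mul_div_cancel₀ (R p (σ (ρ p))) (mul_ne_zero h1 h2)).symm
    rw [Finset.prod_congr rfl fun p _ => this p, Finset.prod_mul_distrib, Finset.prod_mul_distrib]
    ring
  rw [hsum, norm_mul, norm_mul]
  have hdet := A.norm_det_le_of_entry_le hC0 hAle
  rw [hcard] at hdet
  have hwt : ‖∏ p ∈ Sᶜ, ((w p : ℂ) * (w' (σ p) : ℂ))‖ ≤
      Real.exp (2 * (M + κ) * |b|) ^ k * ∏ x, expTail b κ (u x) := by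
    refine le_trans (le_of_eq ?_) (h.prod_weight_le hK.mono hK.abs_le hK.pos u hu)
    rw [norm_prod]
    refine Finset.prod_congr rfl fun p _ => ?_
    rw [norm_mul, Complex.norm_real, Complex.norm_real, Real.norm_of_nonneg (hwpos _).le,
      Real.norm_of_nonneg (hwpos' _).le]
  have hCk : C ^ Sᶜ.card ≤ C ^ k := by
    refine pow_le_pow_right₀ hK.one_le ?_
    simpa using Finset.card_le_univ Sᶜ
  have htail : 0 ≤ ∏ x, expTail b κ (u x) := Finset.prod_nonneg fun x _ => expTail_nonneg _ _ _
  calc _ ≤ 1 * ((Real.exp (2 * (M + κ) * |b|) ^ k * ∏ x, expTail b κ (u x)) *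
        (C ^ k * √((Sᶜ.card : ℝ) ^ Sᶜ.card))) := by
        gcongr
        · exact norm_prod_ite_le _
        · exact hdet.trans (by gcongr)
    _ = _ := by rw [mul_pow]; ring

theorem ExpBound.norm_pathIntegrand_le (hK : K.ExpBound r a b C κ M c)
    (h : Admissible r i σ S) (u : LinkClass σ S → ℝ) :
    ‖K.pathIntegrand r a i σ S fun p => u (LinkClass.mk σ S p)‖ ≤
      (C * Real.exp (2 * (M + κ) * |b|)) ^ k * ∏ x, expTail b κ (u x) := by
  classical
  have hC0 : 0 ≤ C := zero_le_one.trans hK.one_le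
  have htail : 0 ≤ ∏ x, expTail b κ (u x) := Finset.prod_nonneg fun x _ => expTail_nonneg _ _ _
  by_cases hu : ∀ x, b ≤ u x
  swap
  · push Not at hu
    obtain ⟨x, hx⟩ := hu
    obtain ⟨p, rfl⟩ := Quot.exists_rep x
    rw [hK.pathIntegrand_eq_zero (p := p) hx, norm_zero]
    positivity
  unfold pathIntegrand
  rw [norm_mul, norm_prod (s := Sᶜ)]
  have h1 := h.prod_weight_le hK.mono hK.abs_le hK.pos u hu
  have hCk : C ^ Sᶜ.card ≤ C ^ k := by
    refine pow_le_pow_right₀ hK.one_le ?_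
    simpa using Finset.card_le_univ Sᶜ
  calc _ ≤ 1 * ∏ p ∈ Sᶜ, (C * (Real.exp (-(c (i p) + κ) * u (LinkClass.mk σ S p)) *
      Real.exp ((c (i (σ p)) - κ) * u (LinkClass.mk σ S (σ p))))) := by
        gcongr with p
        · exact norm_prod_ite_le _
        · exact hK.norm_le _ _ _ _ (hu _) (hu _)
    _ = C ^ Sᶜ.card * ∏ p ∈ Sᶜ, (Real.exp (-(c (i p) + κ) * u (LinkClass.mk σ S p)) *
      Real.exp ((c (i (σ p)) - κ) * u (LinkClass.mk σ S (σ p)))) := by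
        rw [Finset.prod_mul_distrib, Finset.prod_const, one_mul]
    _ ≤ C ^ k * (Real.exp (2 * (M + κ) * |b|) ^ k * ∏ x, expTail b κ (u x)) := by
        gcongr
    _ = _ := by rw [mul_pow]; ring

end DeltaKernel

/-! ### Summation of the Fredholm series and passage to the limit -/

namespace DeltaKernel

variable {m k : ℕ} {r a : Fin m → ℝ} {i : Fin k → Fin m} {σ : Equiv.Perm (Fin k)}
  {S : Finset (Fin k)} {b C κ M : ℝ} {c : Fin m → ℝ} {K : DeltaKernel}

theorem measurable_pathIntegrand
    (hmeas : ∀ i j, Measurable fun x : ℝ × ℝ => K.reg (r i) x.1 (r j) x.2) :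
    Measurable (K.pathIntegrand r a i σ S) := by
  unfold pathIntegrand
  refine Measurable.mul ?_ ?_
  · refine Finset.measurable_prod _ fun p _ => Measurable.ite ?_ measurable_const measurable_const
    exact measurableSet_le measurable_const ((measurable_pi_apply p).sub_const _)
  · refine Finset.measurable_prod _ fun p _ => ?_
    have h : Measurable fun U : Fin k → ℝ =>
        (U p - K.shift (r (i p)), U (σ p) - K.shift (r (i (σ p)))) :=
      ((measurable_pi_apply p).sub_const _).prodMk ((measurable_pi_apply (σ p)).sub_const _)
    exact (hmeas (i p) (i (σ p))).comp h

theorem measurable_linkClass_comp (σ : Equiv.Perm (Fin k)) (S : Finset (Fin k)) :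
    Measurable fun (u : LinkClass σ S → ℝ) (p : Fin k) => u (LinkClass.mk σ S p) :=
  measurable_pi_lambda _ fun _ => measurable_pi_apply _

theorem integrable_prod_expTail (b : ℝ) (hκ : 0 < κ) (D : ℝ) :
    Integrable fun u : LinkClass σ S → ℝ => D * ∏ x, expTail b κ (u x) :=
  (Integrable.fintype_prod (f := fun _ => expTail b κ)
    fun _ => integrable_expTail b hκ).const_mul D

theorem ExpBound.integrable_pathIntegrand (hK : K.ExpBound r a b C κ M c)
    (hmeas : ∀ i j, Measurable fun x : ℝ × ℝ => K.reg (r i) x.1 (r j) x.2)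
    (h : Admissible r i σ S) :
    Integrable fun u : LinkClass σ S → ℝ =>
      K.pathIntegrand r a i σ S fun p => u (LinkClass.mk σ S p) :=
  (integrable_prod_expTail b hK.pos _).mono'
    ((measurable_pathIntegrand hmeas).comp
      (measurable_linkClass_comp σ S)).aestronglyMeasurable
    (ae_of_all _ fun u => hK.norm_pathIntegrand_le h u)

theorem integral_prod_expTail_le (σ : Equiv.Perm (Fin k)) (S : Finset (Fin k)) (b κ : ℝ) :
    ∫ u : LinkClass σ S → ℝ, ∏ x, expTail b κ (u x) ≤ max 1 (∫ x, expTail b κ x) ^ k := by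
  rw [integral_fintype_prod_volume_eq_pow]
  have hcard : Fintype.card (LinkClass σ S) ≤ k := by
    simpa using Fintype.card_le_of_surjective (LinkClass.mk σ S) Quot.mk_surjective
  calc _ ≤ max 1 (∫ x, expTail b κ x) ^ Fintype.card (LinkClass σ S) :=
        pow_le_pow_left₀ (integral_nonneg fun x => expTail_nonneg _ _ _) (le_max_right _ _) _
    _ ≤ _ := pow_le_pow_right₀ (le_max_left _ _) hcard

/-- Right multiplication by a fixed permutation does not change a sum over the group. Averaging over
the permutations of the regular rows produces determinants on these rows, at the price of 1/n!
instead of a count of cosets. -/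
theorem sum_perm_eq_average {ι : Type*} [Fintype ι] [DecidableEq ι] (P : ι → Prop)
    [DecidablePred P] (f : Equiv.Perm ι → ℂ) :
    (Fintype.card {p // P p}).factorial * ∑ σ, f σ =
      ∑ σ, ∑ ρ : Equiv.Perm {p // P p}, f (σ * Equiv.Perm.ofSubtype ρ) := by
  rw [Finset.sum_comm]
  have : ∀ ρ : Equiv.Perm {p // P p}, ∑ σ, f (σ * Equiv.Perm.ofSubtype ρ) = ∑ σ, f σ := fun ρ =>
    Equiv.sum_comp (Equiv.mulRight (Equiv.Perm.ofSubtype ρ)) f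
  simp [this, Fintype.card_perm]

theorem mul_ofSubtype_apply (σ : Equiv.Perm (Fin k)) (ρ : Equiv.Perm {p // p ∉ S}) {p : Fin k}
    (hp : p ∈ S) : (σ * Equiv.Perm.ofSubtype ρ) p = σ p := by
  rw [Equiv.Perm.mul_apply, Equiv.Perm.ofSubtype_apply_of_not_mem ρ (by simpa using hp)]

theorem permTerm_mul_ofSubtype (h : Admissible r i σ S) (ρ : Equiv.Perm {p // p ∉ S}) :
    K.permTerm r a i (σ * Equiv.Perm.ofSubtype ρ) S = (-1) ^ S.card *
      ∫ u : LinkClass σ S → ℝ, K.pathIntegrand r a i (σ * Equiv.Perm.ofSubtype ρ) S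
        fun p => u (LinkClass.mk σ S p) := by
  unfold permTerm
  rw [if_pos ((admissible_congr fun p hp => (mul_ofSubtype_apply σ ρ hp).symm).1 h)]
  congr 1
  exact integral_linkClass_congr (fun p hp => mul_ofSubtype_apply σ ρ hp)
    (K.pathIntegrand r a i (σ * Equiv.Perm.ofSubtype ρ) S)

theorem ExpBound.norm_sum_ofSubtype_permTerm_le (hK : K.ExpBound r a b C κ M c)
    (hmeas : ∀ i j, Measurable fun x : ℝ × ℝ => K.reg (r i) x.1 (r j) x.2)
    (h : Admissible r i σ S) :
    ‖∑ ρ : Equiv.Perm {p // p ∉ S},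
      ((Equiv.Perm.sign (σ * Equiv.Perm.ofSubtype ρ) : ℤ) : ℂ) *
        K.permTerm r a i (σ * Equiv.Perm.ofSubtype ρ) S‖ ≤
      √((Sᶜ.card : ℝ) ^ Sᶜ.card) *
        (C * Real.exp (2 * (M + κ) * |b|) * max 1 (∫ x, expTail b κ x)) ^ k := by
  have hint : ∀ ρ : Equiv.Perm {p // p ∉ S}, Integrable fun u : LinkClass σ S → ℝ =>
      K.pathIntegrand r a i (σ * Equiv.Perm.ofSubtype ρ) S fun p => u (LinkClass.mk σ S p) := by
    intro ρ
    refine (integrable_prod_expTail b hK.pos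
      ((C * Real.exp (2 * (M + κ) * |b|)) ^ k)).mono'
      ((measurable_pathIntegrand hmeas).comp
        (measurable_linkClass_comp σ S)).aestronglyMeasurable (ae_of_all _ fun u => ?_)
    have hagree : ∀ p ∈ S, (σ * Equiv.Perm.ofSubtype ρ) p = σ p := fun p hp =>
      mul_ofSubtype_apply σ ρ hp
    have hrel : (fun p q : Fin k => p ∈ S ∧ q = (σ * Equiv.Perm.ofSubtype ρ) p) =
        fun p q : Fin k => p ∈ S ∧ q = σ p := by
      ext p q
      exact and_congr_right fun hp => by rw [hagree p hp]
    have hadm : Admissible r i (σ * Equiv.Perm.ofSubtype ρ) S :=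
      (admissible_congr hagree).2 h
    -- Both quotients are by the same relation, so the bound for the modified permutation is carried
    -- over to the classes of σ.
    let e : LinkClass (σ * Equiv.Perm.ofSubtype ρ) S ≃ LinkClass σ S :=
      Quot.congrRight fun p q => by
        exact and_congr_right fun hp => by rw [hagree p hp]
    have key := hK.norm_pathIntegrand_le hadm fun x => u (e x)
    rw [Equiv.prod_comp e fun x => expTail b κ (u x)] at key
    exact key
  have hsum : ∑ ρ : Equiv.Perm {p // p ∉ S},
      ((Equiv.Perm.sign (σ * Equiv.Perm.ofSubtype ρ) : ℤ) : ℂ) *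
        K.permTerm r a i (σ * Equiv.Perm.ofSubtype ρ) S =
      ((Equiv.Perm.sign σ : ℤ) : ℂ) * (-1) ^ S.card * ∫ u : LinkClass σ S → ℝ,
        ∑ ρ : Equiv.Perm {p // p ∉ S}, ((Equiv.Perm.sign ρ : ℤ) : ℂ) *
          K.pathIntegrand r a i (σ * Equiv.Perm.ofSubtype ρ) S
            fun p => u (LinkClass.mk σ S p) := by
    rw [integral_finsetSum _ fun ρ _ => (hint ρ).const_mul _, Finset.mul_sum]
    refine Finset.sum_congr rfl fun ρ _ => ?_
    rw [permTerm_mul_ofSubtype h, integral_const_mul, Equiv.Perm.sign_mul,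
      Equiv.Perm.sign_ofSubtype]
    push_cast
    ring
  have hsign : ‖((Equiv.Perm.sign σ : ℤ) : ℂ)‖ = 1 := by
    rcases Int.units_eq_one_or (Equiv.Perm.sign σ) with h | h <;> simp [h]
  rw [hsum, norm_mul, norm_mul, hsign, norm_pow, norm_neg, norm_one, one_pow, one_mul, one_mul]
  refine (norm_integral_le_of_norm_le (integrable_prod_expTail b hK.pos _)
    (ae_of_all _ fun u => hK.norm_sum_pathIntegrand_le h u)).trans ?_
  rw [integral_const_mul, mul_pow _ (max _ _), ← mul_assoc]
  have hC0 : 0 ≤ C := zero_le_one.trans hK.one_le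
  gcongr
  exact integral_prod_expTail_le σ S b κ

/-- The base of the geometric bound of the Fredholm series. -/
def growth (m : ℕ) (b C κ M : ℝ) : ℝ :=
  2 * (2 * ((m + 1) * (C * Real.exp (2 * (M + κ) * |b|) * max 1 (∫ x, expTail b κ x))))

/-- A summable bound of the terms of the Fredholm series. -/
def termBound (m : ℕ) (b C κ M : ℝ) (k : ℕ) : ℝ :=
  √(Real.exp ((growth m b C κ M ^ m) ^ 2 * Real.exp 1)) * (1 / 2) ^ k

theorem summable_termBound (m : ℕ) (b C κ M : ℝ) : Summable (termBound m b C κ M) :=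
  summable_geometric_two.mul_left _

theorem ExpBound.norm_sum_permTerm_le (hK : K.ExpBound r a b C κ M c)
    (hmeas : ∀ i j, Measurable fun x : ℝ × ℝ => K.reg (r i) x.1 (r j) x.2)
    (i : Fin k → Fin m) (S : Finset (Fin k)) :
    ((2 * (m + 1)) ^ k : ℝ) * ‖∑ σ : Equiv.Perm (Fin k),
      ((Equiv.Perm.sign σ : ℤ) : ℂ) * K.permTerm r a i σ S‖ ≤ k.factorial * termBound m b C κ M k := by
  by_cases hex : ∃ σ : Equiv.Perm (Fin k), Admissible r i σ S
  swap
  · push Not at hex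
    rw [Finset.sum_eq_zero]
    · simp only [norm_zero, mul_zero, termBound]
      positivity
    · intro σ _
      simp [permTerm, hex σ]
  set n := Sᶜ.card with hn
  set D := C * Real.exp (2 * (M + κ) * |b|) * max 1 (∫ x, expTail b κ x) with hD
  have hC0 : 0 ≤ C := zero_le_one.trans hK.one_le
  have hM0 : k = 0 ∨ 0 ≤ M := by
    rcases Nat.eq_zero_or_pos k with h0 | h0
    · exact Or.inl h0
    · exact Or.inr ((abs_nonneg _).trans (hK.abs_le (i ⟨0, h0⟩)))
  have hD0 : 0 ≤ D := by positivity
  have hcard : Fintype.card {p // p ∉ S} = n := Fintype.card_of_subtype _ fun x => by simp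
  have hnf : (0 : ℝ) < n.factorial := by exact_mod_cast n.factorial_pos
  have hkf : (0 : ℝ) < k.factorial := by exact_mod_cast k.factorial_pos
  have h1 : n.factorial * ‖∑ σ : Equiv.Perm (Fin k),
      ((Equiv.Perm.sign σ : ℤ) : ℂ) * K.permTerm r a i σ S‖ ≤ k.factorial * (√((n : ℝ) ^ n) * D ^ k) := by
    have h2 := sum_perm_eq_average (fun p => p ∉ S)
      fun σ => ((Equiv.Perm.sign σ : ℤ) : ℂ) * K.permTerm r a i σ S
    have h3 := congrArg norm h2
    rw [norm_mul, Complex.norm_natCast, hcard] at h3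
    rw [h3]
    refine (norm_sum_le _ _).trans ?_
    have h4 : ∀ σ ∈ (Finset.univ : Finset (Equiv.Perm (Fin k))),
        ‖∑ ρ : Equiv.Perm {p // p ∉ S},
          ((Equiv.Perm.sign (σ * Equiv.Perm.ofSubtype ρ) : ℤ) : ℂ) *
            K.permTerm r a i (σ * Equiv.Perm.ofSubtype ρ) S‖ ≤ √((n : ℝ) ^ n) * D ^ k := by
      intro σ _
      by_cases h : Admissible r i σ S
      · exact hK.norm_sum_ofSubtype_permTerm_le hmeas h
      · rw [Finset.sum_eq_zero]
        · rw [norm_zero]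
          positivity
        · intro ρ _
          have : ¬ Admissible r i (σ * Equiv.Perm.ofSubtype ρ) S := fun h' =>
            h ((admissible_congr fun p hp => mul_ofSubtype_apply σ ρ hp).1 h')
          simp [permTerm, this]
    refine (Finset.sum_le_card_nsmul _ _ _ h4).trans (le_of_eq ?_)
    rw [Finset.card_univ, Fintype.card_perm, Fintype.card_fin, nsmul_eq_mul]
  obtain ⟨σ, hσ⟩ := hex
  have hkn : k ≤ n * m := hσ.card_le
  set G := growth m b C κ M with hG
  -- One factor 2 produces the geometric factor (1/2)^k, the other pays for the 2^k subsets S, and m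
  -- + 1 pays for the m^k index choices while keeping the divisor nonzero for m = 0.
  have hGD : G = 2 * (2 * (m + 1) * D) := by rw [hG, growth, ← hD]; ring
  have hpow : G ^ k ≤ (G ^ m) ^ n := by
    rcases Nat.eq_zero_or_pos k with h0 | h0
    · subst h0
      have hn0 : n = 0 := by rw [hn]; simpa using Finset.card_le_univ Sᶜ
      rw [hn0]; simp
    · rw [← pow_mul, mul_comm m n]
      refine pow_le_pow_right₀ ?_ hkn
      have hM : 0 ≤ M := hM0.resolve_left h0.ne'
      have e1 : (1 : ℝ) ≤ Real.exp (2 * (M + κ) * |b|) := by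
        refine Real.one_le_exp ?_
        have := hK.pos
        positivity
      have hDone : 1 ≤ D := by
        rw [hD]
        exact one_le_mul_of_one_le_of_one_le
          (one_le_mul_of_one_le_of_one_le hK.one_le e1) (le_max_left _ _)
      rw [hGD]
      have : (0 : ℝ) ≤ m := Nat.cast_nonneg m
      nlinarith
  have hmain := sqrt_pow_self_div_factorial_le (G ^ m) n
  have hfin : (2 * (2 * (m + 1) * D)) ^ k * (√((n : ℝ) ^ n) / n.factorial) ≤
      √(Real.exp ((G ^ m) ^ 2 * Real.exp 1)) := by
    rw [← hGD]
    refine le_trans ?_ hmain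
    gcongr
  calc _ ≤ ((2 * (m + 1)) ^ k : ℝ) * (k.factorial * (√((n : ℝ) ^ n) * D ^ k) / n.factorial) := by
        gcongr
        rw [le_div_iff₀ hnf, mul_comm]
        exact h1
    _ = k.factorial * ((2 * (2 * (m + 1) * D)) ^ k * (√((n : ℝ) ^ n) / n.factorial) *
          (1 / 2) ^ k) := by
        rw [mul_pow 2 (2 * (m + 1) * D), mul_pow _ D]
        have : (2 : ℝ) ^ k * (1 / 2) ^ k = 1 := by rw [← mul_pow]; norm_num
        linear_combination (-(k.factorial : ℝ) * ((2 * (m + 1)) ^ k * D ^ k) *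
          (√((n : ℝ) ^ n) / n.factorial)) * this
    _ ≤ _ := by
        unfold termBound
        gcongr

theorem ExpBound.norm_fredholmTerm_le (hK : K.ExpBound r a b C κ M c)
    (hmeas : ∀ i j, Measurable fun x : ℝ × ℝ => K.reg (r i) x.1 (r j) x.2) (k : ℕ) :
    ‖K.fredholmTerm r a k‖ ≤ termBound m b C κ M k := by
  unfold fredholmTerm
  have hkf : (0 : ℝ) < k.factorial := by exact_mod_cast k.factorial_pos
  have hb : (0 : ℝ) ≤ termBound m b C κ M k := by unfold termBound; positivity
  rw [norm_mul, norm_div, norm_pow, norm_neg, norm_one, one_pow, Complex.norm_natCast,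
    div_mul_eq_mul_div, one_mul, div_le_iff₀ hkf]
  have h1 : ∀ i : Fin k → Fin m,
      ‖∑ σ : Equiv.Perm (Fin k), ∑ S : Finset (Fin k),
        ((Equiv.Perm.sign σ : ℤ) : ℂ) * K.permTerm r a i σ S‖ ≤
      2 ^ k * (k.factorial * termBound m b C κ M k / (2 * (m + 1)) ^ k) := by
    intro i
    rw [Finset.sum_comm]
    refine (norm_sum_le _ _).trans ?_
    refine (Finset.sum_le_card_nsmul _ _ (k.factorial * termBound m b C κ M k / (2 * (m + 1)) ^ k)
      fun S _ => ?_).trans (le_of_eq ?_)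
    · rw [le_div_iff₀ (by positivity), mul_comm]
      exact hK.norm_sum_permTerm_le hmeas i S
    · rw [Finset.card_univ, Fintype.card_finset, Fintype.card_fin, nsmul_eq_mul]
      push_cast
      rfl
  refine (norm_sum_le _ _).trans ?_
  refine (Finset.sum_le_card_nsmul _ _ _ fun i _ => h1 i).trans ?_
  rw [Finset.card_univ, Fintype.card_fun, Fintype.card_fin, Fintype.card_fin, nsmul_eq_mul]
  push_cast
  have h2 : (m : ℝ) ^ k ≤ (m + 1) ^ k := by gcongr; linarith
  calc (m : ℝ) ^ k * (2 ^ k * (k.factorial * termBound m b C κ M k / (2 * (m + 1)) ^ k))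
      ≤ (m + 1 : ℝ) ^ k * (2 ^ k * (k.factorial * termBound m b C κ M k / (2 * (m + 1)) ^ k)) := by
        gcongr
    _ = _ := by
        rw [mul_pow]
        field_simp

theorem ExpBound.fredholmConverges (hK : K.ExpBound r a b C κ M c)
    (hmeas : ∀ i j, Measurable fun x : ℝ × ℝ => K.reg (r i) x.1 (r j) x.2) :
    K.FredholmConverges r a :=
  ⟨fun _ _ _ _ h => hK.integrable_pathIntegrand hmeas h,
    (summable_termBound m b C κ M).of_norm_bounded fun k => hK.norm_fredholmTerm_le hmeas k⟩

/-- Fredholm determinants converge if the kernels converge pointwise in the variables `x + shift`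
with a uniform exponential bound. -/
theorem tendsto_fredholmDet {ι : Type*} {l : Filter ι} [l.IsCountablyGenerated]
    {Kn : ι → DeltaKernel} (hK : ∀ᶠ n in l, (Kn n).ExpBound r a b C κ M c)
    (hmeas : ∀ᶠ n in l, ∀ i j, Measurable fun x : ℝ × ℝ => (Kn n).reg (r i) x.1 (r j) x.2)
    (hshift : ∀ j, Tendsto (fun n => (Kn n).shift (r j)) l (𝓝 (K.shift (r j))))
    (hlim : ∀ i j u v, Tendsto
      (fun n => (Kn n).reg (r i) (u - (Kn n).shift (r i)) (r j) (v - (Kn n).shift (r j))) l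
      (𝓝 (K.reg (r i) (u - K.shift (r i)) (r j) (v - K.shift (r j))))) :
    Tendsto (fun n => (Kn n).fredholmDet r a) l (𝓝 (K.fredholmDet r a)) := by
  rcases l.eq_or_neBot with rfl | hl
  · exact tendsto_bot
  refine tendsto_tsum_of_dominated_convergence (bound := termBound m b C κ M)
    (summable_termBound _ _ _ _ _) (fun k => ?_) ?_
  swap
  · filter_upwards [hK, hmeas] with n h1 h2 k using h1.norm_fredholmTerm_le h2 k
  refine Tendsto.const_mul _ (tendsto_finsetSum _ fun i _ => tendsto_finsetSum _ fun σ _ =>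
    tendsto_finsetSum _ fun S _ => Tendsto.const_mul _ ?_)
  by_cases h : Admissible r i σ S
  swap
  · simp [permTerm, h]
  simp only [permTerm, h, if_true]
  refine Tendsto.const_mul _ ?_
  refine tendsto_integral_filter_of_dominated_convergence
    (fun u : LinkClass σ S → ℝ => (C * Real.exp (2 * (M + κ) * |b|)) ^ k * ∏ x, expTail b κ (u x))
    ?_ ?_ ?_ ?_
  · filter_upwards [hmeas] with n h2
    exact ((measurable_pathIntegrand h2).comp
      (measurable_linkClass_comp σ S)).aestronglyMeasurable
  · filter_upwards [hK] with n h1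
    exact ae_of_all _ fun u => h1.norm_pathIntegrand_le h u
  · obtain ⟨n, hn⟩ := hK.exists
    exact integrable_prod_expTail b hn.pos _
  -- With moving shifts the indicators may fail to converge where a variable sits exactly at its
  -- level; these are hyperplanes, hence null sets.
  · have hae : ∀ p : Fin k, ∀ᵐ u : LinkClass σ S → ℝ,
        u (LinkClass.mk σ S p) ≠ a (i p) + K.shift (r (i p)) := by
      intro p
      have h0 : (volume : Measure (LinkClass σ S → ℝ))
          {u | u (LinkClass.mk σ S p) = a (i p) + K.shift (r (i p))} = 0 :=
        Measure.pi_hyperplane _ _ _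
      exact measure_eq_zero_iff_ae_notMem.1 h0
    filter_upwards [ae_all_iff.2 hae] with u hu
    refine Tendsto.mul (tendsto_finsetProd _ fun p _ => ?_)
      (tendsto_finsetProd _ fun p _ => hlim _ _ _ _)
    have hpt : Tendsto (fun n => (Kn n).point r i σ S u p) l (𝓝 (K.point r i σ S u p)) :=
      (hshift (i p)).const_sub _
    rcases lt_or_gt_of_ne (hu p) with hlt | hgt
    · have h1 : K.point r i σ S u p < a (i p) := by unfold point; linarith
      refine tendsto_const_nhds.congr' ?_
      filter_upwards [hpt.eventually_lt_const h1] with n hn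
      rw [if_neg h1.not_ge, if_neg hn.not_ge]
    · have h1 : a (i p) < K.point r i σ S u p := by unfold point; linarith
      refine tendsto_const_nhds.congr' ?_
      filter_upwards [hpt.eventually_const_lt h1] with n hn
      rw [if_pos h1.le, if_pos hn.le]

end DeltaKernel

/-! ### Permutations that increase a function off one index -/

/-- The number of indices with a strictly smaller value. -/
def valueRank {k : ℕ} (f : Fin k → ℝ) (p : Fin k) : ℕ := (Finset.univ.filter fun q => f q < f p).card

section valueRank

variable {k : ℕ} {f : Fin k → ℝ}

theorem valueRank_lt (f : Fin k → ℝ) (p : Fin k) : valueRank f p < k := by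
  have h : (Finset.univ.filter fun q => f q < f p) ⊂ Finset.univ := by
    rw [Finset.ssubset_univ_iff]
    intro h
    have := (Finset.mem_filter.1 (h ▸ Finset.mem_univ p)).2
    exact lt_irrefl _ this
  have := Finset.card_lt_card h
  rwa [Finset.card_univ, Fintype.card_fin] at this

theorem valueRank_mono {p q : Fin k} (h : f p ≤ f q) : valueRank f p ≤ valueRank f q :=
  Finset.card_le_card fun x hx => by
    simp only [Finset.mem_filter, Finset.mem_univ, true_and] at hx ⊢
    exact hx.trans_le h

theorem valueRank_add_le {p q : Fin k} (h : f p < f q) :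
    valueRank f p + (Finset.univ.filter fun x => f x = f p).card ≤ valueRank f q := by
  unfold valueRank
  rw [← Finset.card_union_of_disjoint]
  · refine Finset.card_le_card fun x hx => ?_
    simp only [Finset.mem_union, Finset.mem_filter, Finset.mem_univ, true_and] at hx ⊢
    rcases hx with hx | hx
    · exact hx.trans h
    · exact hx ▸ h
  · rw [Finset.disjoint_filter]
    exact fun x _ h1 h2 => h1.ne h2

theorem valueRank_lt_of_lt {p q : Fin k} (h : f p < f q) : valueRank f p < valueRank f q := by
  refine lt_of_lt_of_le ?_ (valueRank_add_le h)
  have : 0 < (Finset.univ.filter fun x => f x = f p).card :=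
    Finset.card_pos.2 ⟨p, by simp⟩
  omega

theorem valueRank_injective (hf : Function.Injective f) : Function.Injective (valueRank f) := by
  intro p q h
  by_contra hne
  rcases lt_or_gt_of_ne (hf.ne hne) with h1 | h1
  · exact (valueRank_lt_of_lt h1).ne h
  · exact (valueRank_lt_of_lt h1).ne' h

/-- A permutation which increases `f` at all points but one is the cyclic shift in the order given
by `f`. -/
theorem valueRank_perm {σ : Equiv.Perm (Fin k)} {p₀ : Fin k} (h : ∀ p ≠ p₀, f p < f (σ p)) :
    Function.Injective f ∧ valueRank f p₀ = k - 1 ∧ valueRank f (σ p₀) = 0 ∧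
      ∀ p ≠ p₀, valueRank f (σ p) = valueRank f p + 1 := by
  set s : Fin k → ℕ := fun p => (Finset.univ.filter fun x => f x = f p).card with hs
  have hs1 : ∀ p, 1 ≤ s p := fun p => Finset.card_pos.2 ⟨p, by simp⟩
  have hstep : ∀ p ≠ p₀, valueRank f p + s p ≤ valueRank f (σ p) := fun p hp =>
    valueRank_add_le (h p hp)
  have hsum : ∑ p, (valueRank f (σ p) : ℤ) = ∑ p, (valueRank f p : ℤ) :=
    Equiv.sum_comp σ fun p => (valueRank f p : ℤ)
  -- The increments of the rank along σ sum to zero. Off p₀ each is at least 1, and at p₀ it is at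
  -- least -(k - 1) because ranks lie in {0, …, k - 1}; hence all these inequalities are equalities.
  have hsplit : ∑ p ∈ Finset.univ.erase p₀, ((valueRank f (σ p) : ℤ) - valueRank f p - 1) +
      ((valueRank f (σ p₀) : ℤ) - valueRank f p₀ + (k - 1)) = 0 := by
    have h1 := Finset.sum_erase_add Finset.univ
      (fun p => (valueRank f (σ p) : ℤ) - valueRank f p) (Finset.mem_univ p₀)
    rw [Finset.sum_sub_distrib (s := Finset.univ), hsum, sub_self] at h1
    rw [Finset.sum_sub_distrib, Finset.sum_const, Finset.card_erase_of_mem (Finset.mem_univ _),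
      Finset.card_univ, Fintype.card_fin, nsmul_eq_mul, mul_one,
      Nat.cast_sub (Nat.one_le_of_lt p₀.pos)]
    push_cast
    linarith
  have hnn : ∀ p ∈ Finset.univ.erase p₀,
      (0 : ℤ) ≤ (valueRank f (σ p) : ℤ) - valueRank f p - 1 := by
    intro p hp
    have h1 := hstep p (Finset.ne_of_mem_erase hp)
    have h2 := hs1 p
    omega
  have hp0 := valueRank_lt f p₀
  have hsumnn := Finset.sum_nonneg hnn
  have hzero : ∑ p ∈ Finset.univ.erase p₀, ((valueRank f (σ p) : ℤ) - valueRank f p - 1) = 0 := by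
    omega
  have heach : ∀ p ≠ p₀, valueRank f (σ p) = valueRank f p + 1 := by
    intro p hp
    have := (Finset.sum_eq_zero_iff_of_nonneg hnn).1 hzero p
      (Finset.mem_erase.2 ⟨hp, Finset.mem_univ _⟩)
    omega
  have hp0' : valueRank f p₀ = k - 1 := by omega
  refine ⟨?_, hp0', by omega, heach⟩
  -- A rank increment of exactly 1 leaves no room for a second index with the same value.
  have hsingle : ∀ p ≠ p₀, ∀ q, f q = f p → q = p := by
    intro p hp q hq
    have h1 := hstep p hp
    have h2 := heach p hp
    have h3 : s p ≤ 1 := by omega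
    exact Finset.card_le_one.1 h3 q (by simp [hq]) p (by simp)
  intro p q hpq
  by_cases hp : p = p₀
  · by_cases hq : q = p₀
    · rw [hp, hq]
    · exact hsingle q hq p hpq
  · exact (hsingle p hp q hpq.symm).symm

theorem exists_cyclic_perm (hf : Function.Injective f) (hk : 0 < k) :
    ∃ (σ : Equiv.Perm (Fin k)) (p₀ : Fin k), (∀ p ≠ p₀, f p < f (σ p)) ∧
      Equiv.Perm.sign σ = (-1) ^ (k - 1) ∧
      ∀ (σ' : Equiv.Perm (Fin k)) (p' : Fin k), (∀ p ≠ p', f p < f (σ' p)) → p' = p₀ ∧ σ' = σ := by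
  let g : Fin k → Fin k := fun p => ⟨valueRank f p, valueRank_lt f p⟩
  have hg : Function.Injective g := fun p q h =>
    valueRank_injective hf (congrArg Fin.val h)
  let e : Fin k ≃ Fin k := Equiv.ofBijective g (Finite.injective_iff_bijective.1 hg)
  have he : ∀ p, (e p : ℕ) = valueRank f p := fun p => rfl
  obtain ⟨n, rfl⟩ : ∃ n, k = n + 1 := ⟨k - 1, by omega⟩
  -- The standard rotation transported by ranks; p₀ is the index of largest value, the only one at
  -- which σ goes down.
  let σ : Equiv.Perm (Fin (n + 1)) := (e.trans (finRotate (n + 1))).trans e.symm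
  have hσ : ∀ p, e (σ p) = finRotate (n + 1) (e p) := fun p => by simp [σ]
  let p₀ := e.symm (Fin.last n)
  have hp₀ : ∀ p, p ≠ p₀ → e p ≠ Fin.last n := by
    intro p hp h
    exact hp (by simp [p₀, ← h])
  have hstep : ∀ p ≠ p₀, valueRank f (σ p) = valueRank f p + 1 := by
    intro p hp
    rw [← he, ← he, hσ, coe_finRotate, if_neg (hp₀ p hp)]
  have hadm : ∀ p ≠ p₀, f p < f (σ p) := by
    intro p hp
    by_contra hle
    have h1 := valueRank_mono (not_lt.1 hle)
    have h2 := hstep p hp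
    omega
  refine ⟨σ, p₀, hadm, ?_, ?_⟩
  · rw [show σ = (e.trans (finRotate (n + 1))).trans e.symm from rfl]
    have := Equiv.Perm.sign_symm_trans_trans (finRotate (n + 1)) e.symm
    rw [Equiv.symm_symm] at this
    rw [this, sign_finRotate]
  · intro σ' p' h'
    obtain ⟨-, h1, h2, h3⟩ := valueRank_perm h'
    obtain ⟨-, h1', h2', h3'⟩ := valueRank_perm hadm
    have hpp : p' = p₀ := valueRank_injective hf (h1.trans h1'.symm)
    subst hpp
    refine ⟨rfl, Equiv.ext fun p => valueRank_injective hf ?_⟩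
    by_cases hp : p = p₀
    · rw [hp, h2, h2']
    · rw [h3 p hp, h3' p hp]

end valueRank

/-! ### Determinants with a regular part depending on the row variable only -/

theorem card_injective_image_eq {k m : ℕ} {I : Finset (Fin m)} (hI : I.card = k) :
    (Finset.univ.filter fun i : Fin k → Fin m =>
      Function.Injective i ∧ Finset.univ.image i = I).card = k.factorial := by
  have h1 : (Finset.univ : Finset (Fin k ↪ {x // x ∈ I})).card = k.factorial := by
    rw [Finset.card_univ, Fintype.card_embedding_eq, Fintype.card_coe, Fintype.card_fin, hI,
      Nat.descFactorial_self]
  rw [← h1]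
  symm
  refine Finset.card_bij (fun e _ p => (e p : Fin m)) ?_ ?_ ?_
  · intro e _
    have hinj : Function.Injective fun p => (e p : Fin m) :=
      Subtype.val_injective.comp e.injective
    simp only [Finset.mem_filter, Finset.mem_univ, true_and]
    refine ⟨hinj, Finset.eq_of_subset_of_card_le ?_ ?_⟩
    · intro x hx
      obtain ⟨p, -, rfl⟩ := Finset.mem_image.1 hx
      exact (e p).2
    · rw [Finset.card_image_of_injective _ hinj, hI]
      simp
  · intro e _ e' _ h
    ext p
    exact congrArg Fin.val (congrFun h p)
  · intro i hi
    simp only [Finset.mem_filter, Finset.mem_univ, true_and] at hi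
    refine ⟨⟨fun p => ⟨i p, hi.2 ▸ Finset.mem_image_of_mem i (Finset.mem_univ p)⟩, ?_⟩,
      Finset.mem_univ _, rfl⟩
    intro p q h
    exact hi.1 (congrArg Subtype.val h)

/-- Each k-element set is the image of k! injections; this cancels the 1/k! of the Fredholm series.
-/
theorem sum_injective_image {k m : ℕ} (ψ : Finset (Fin m) → ℂ) :
    (∑ i : Fin k → Fin m, open Classical in
      if Function.Injective i then ψ (Finset.univ.image i) else 0) =
      k.factorial * ∑ I ∈ Finset.powersetCard k Finset.univ, ψ I := by
  classical
  rw [← Finset.sum_filter, Finset.mul_sum,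
    ← Finset.sum_fiberwise_of_maps_to (t := Finset.powersetCard k Finset.univ)
      (g := fun i => Finset.univ.image i)]
  · refine Finset.sum_congr rfl fun I hI => ?_
    rw [Finset.filter_filter]
    rw [← card_injective_image_eq (Finset.mem_powersetCard.1 hI).2, ← nsmul_eq_mul,
      ← Finset.sum_const]
    refine Finset.sum_congr ?_ fun i hi => ?_
    · congr
    · rw [(Finset.mem_filter.1 hi).2.2]
  · intro i hi
    rw [Finset.mem_powersetCard]
    refine ⟨Finset.subset_univ _, ?_⟩
    rw [Finset.card_image_of_injective _ (Finset.mem_filter.1 hi).2]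
    simp

namespace DeltaKernel

variable {m k : ℕ} {r a : Fin m → ℝ} {i : Fin k → Fin m} {σ : Equiv.Perm (Fin k)}
  {S : Finset (Fin k)} {K : DeltaKernel} {φ : ℝ → ℝ} {h : ℝ}

/-- For a kernel of rank one, transposing two rows of the regular part reverses the sign. -/
theorem sum_permTerm_eq_zero (hreg : ∀ i j s s', K.reg (r i) s (r j) s' = φ s) (i : Fin k → Fin m)
    (hS : 1 < Sᶜ.card) :
    ∑ σ : Equiv.Perm (Fin k), ((Equiv.Perm.sign σ : ℤ) : ℂ) * K.permTerm r a i σ S = 0 := by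
  obtain ⟨p, hp, q, hq, hpq⟩ := Finset.one_lt_card.1 hS
  rw [Finset.mem_compl] at hp hq
  have hswap : ∀ σ : Equiv.Perm (Fin k),
      K.permTerm r a i (σ * Equiv.swap p q) S = K.permTerm r a i σ S := by
    intro σ
    have hagree : ∀ x ∈ S, (σ * Equiv.swap p q) x = σ x := by
      intro x hx
      rw [Equiv.Perm.mul_apply, Equiv.swap_apply_of_ne_of_ne] <;> rintro rfl <;> contradiction
    unfold permTerm
    by_cases hadm : Admissible r i σ S
    · rw [if_pos hadm, if_pos ((admissible_congr hagree).2 hadm)]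
      congr 1
      have h1 := integral_linkClass_congr hagree (K.pathIntegrand r a i (σ * Equiv.swap p q) S)
      refine h1.trans ?_
      refine integral_congr_ae (ae_of_all _ fun u => ?_)
      simp only [integrand_eq, pathIntegrand, hreg]
    · rw [if_neg hadm, if_neg fun h' => hadm ((admissible_congr hagree).1 h')]
  have hsum : ∑ σ : Equiv.Perm (Fin k), ((Equiv.Perm.sign σ : ℤ) : ℂ) * K.permTerm r a i σ S =
      -∑ σ : Equiv.Perm (Fin k), ((Equiv.Perm.sign σ : ℤ) : ℂ) * K.permTerm r a i σ S := by
    conv_lhs => rw [← Equiv.sum_comp (Equiv.mulRight (Equiv.swap p q))]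
    rw [← Finset.sum_neg_distrib]
    refine Finset.sum_congr rfl fun σ _ => ?_
    simp only [Equiv.coe_mulRight]
    rw [hswap, Equiv.Perm.sign_mul, Equiv.Perm.sign_swap hpq]
    simp
  exact self_eq_neg.1 hsum

theorem permTerm_compl_singleton (hshift : ∀ j, K.shift (r j) = h)
    (hreg : ∀ i j s s', K.reg (r i) s (r j) s' = φ s) {p₀ : Fin k}
    (hadm : Admissible r i σ {p₀}ᶜ) :
    K.permTerm r a i σ {p₀}ᶜ =
      (-1) ^ (k - 1) * ∫ x : ℝ, (∏ p, if a (i p) ≤ x then (1 : ℂ) else 0) * φ x := by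
  -- With a single regular row all indices form one chain, so the integral is one-dimensional and
  -- the constant shift disappears by translation.
  have hmk : ∀ x : LinkClass σ {p₀}ᶜ, x = LinkClass.mk σ {p₀}ᶜ p₀ := by
    intro x
    obtain ⟨q, hq, rfl⟩ := hadm.exists_mk_eq x
    rw [show q = p₀ by simpa using hq]
  let : Unique (LinkClass σ {p₀}ᶜ) := ⟨⟨LinkClass.mk σ {p₀}ᶜ p₀⟩, hmk⟩
  unfold permTerm
  rw [if_pos hadm]
  congr 1
  · rw [Finset.card_compl]
    simp
  · have h0 : MeasurePreserving (MeasurableEquiv.funUnique (LinkClass σ {p₀}ᶜ) ℝ) := by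
      convert volume_preserving_funUnique (LinkClass σ {p₀}ᶜ) ℝ <;> rfl
    have h1 := h0.integral_comp'
      (g := fun x => (∏ p, if a (i p) ≤ x - h then (1 : ℂ) else 0) * φ (x - h))
    rw [← integral_sub_right_eq_self
      (fun x => (∏ p, if a (i p) ≤ x then (1 : ℂ) else 0) * (φ x : ℂ)) h, ← h1]
    refine integral_congr_ae (ae_of_all _ fun u => ?_)
    have h2 : ∀ p, K.point r i σ {p₀}ᶜ u p = MeasurableEquiv.funUnique (LinkClass σ {p₀}ᶜ) ℝ u - h :=
      fun p => by
        rw [point, hshift, hmk (LinkClass.mk σ {p₀}ᶜ p)]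
        rfl
    simp only [integrand, h2, hreg, compl_compl, Finset.prod_singleton]

theorem sum_compl_singleton {F : Finset (Fin k) → ℂ} (hF : ∀ S, Sᶜ.card ≠ 1 → F S = 0) :
    ∑ S, F S = ∑ p, F {p}ᶜ := by
  symm
  refine Finset.sum_of_injOn (fun p => {p}ᶜ) ?_ (by simp) ?_ (fun _ _ => rfl)
  · intro p _ q _ hpq
    exact Finset.singleton_injective (compl_injective hpq)
  · intro S _ hS
    refine hF S fun h1 => hS ?_
    obtain ⟨p, hp⟩ := Finset.card_eq_one.1 h1
    exact ⟨p, by simp, show {p}ᶜ = S by rw [← hp, compl_compl]⟩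

theorem sum_perm_permTerm_rankOne (hr : Function.Injective r) (hshift : ∀ j, K.shift (r j) = h)
    (hreg : ∀ i j s s', K.reg (r i) s (r j) s' = φ s) (hk : 0 < k) (i : Fin k → Fin m) :
    ∑ σ : Equiv.Perm (Fin k), ∑ S : Finset (Fin k),
      ((Equiv.Perm.sign σ : ℤ) : ℂ) * K.permTerm r a i σ S =
      open Classical in if Function.Injective i then
        ∫ x : ℝ, (∏ j ∈ Finset.univ.image i, if a j ≤ x then (1 : ℂ) else 0) * φ x else 0 := by
  classical
  rw [Finset.sum_comm, sum_compl_singleton, ← Fintype.sum_prod_type']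
  swap
  · intro S hS
    -- No regular row is impossible for k > 0, since an admissible chain must end; with two or more
    -- the antisymmetry applies.
    rcases Nat.lt_or_gt_of_ne hS with h1 | h1
    · refine Finset.sum_eq_zero fun σ _ => ?_
      have : ¬ Admissible r i σ S := fun hadm => by
        have := hadm.card_le
        rw [Nat.lt_one_iff.1 h1] at this
        omega
      simp [permTerm, this]
    · exact sum_permTerm_eq_zero hreg i h1
  have hadm_iff : ∀ (σ : Equiv.Perm (Fin k)) (p₀ : Fin k), Admissible r i σ {p₀}ᶜ ↔
      ∀ p ≠ p₀, r (i p) < r (i (σ p)) := by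
    intro σ p₀
    simp [Admissible]
  split_ifs with hi
  · obtain ⟨σ, p₀, h1, h2, h3⟩ := exists_cyclic_perm (hr.comp hi) hk
    rw [Finset.sum_eq_single (p₀, σ)]
    · have hadm := (hadm_iff σ p₀).2 h1
      simp only
      rw [permTerm_compl_singleton hshift hreg hadm, h2]
      simp only [Finset.prod_image hi.injOn]
      -- The sign of the k-cycle cancels the signs of the k - 1 Dirac terms.
      have h4 : ((-1 : ℂ) ^ (k - 1)) * (-1) ^ (k - 1) = 1 := by
        rw [← mul_pow]; norm_num
      push_cast
      rw [← mul_assoc, h4, one_mul]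
    · rintro ⟨p', σ'⟩ - hne
      have : ¬ Admissible r i σ' {p'}ᶜ := fun hadm => by
        obtain ⟨h4, h5⟩ := h3 σ' p' ((hadm_iff σ' p').1 hadm)
        exact hne (by rw [h4, h5])
      simp [permTerm, this]
    · simp
  · refine Finset.sum_eq_zero fun x _ => ?_
    have : ¬ Admissible r i x.2 {x.1}ᶜ := fun hadm => by
      have := (valueRank_perm ((hadm_iff _ _).1 hadm)).1
      exact hi fun p q hpq => this (by simp [hpq])
    simp [permTerm, this]

theorem fredholmTerm_rankOne (hr : Function.Injective r) (hshift : ∀ j, K.shift (r j) = h)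
    (hreg : ∀ i j s s', K.reg (r i) s (r j) s' = φ s) (hφ : ∫ x, φ x = 1) (k : ℕ) :
    K.fredholmTerm r a k = ∑ I ∈ Finset.powersetCard k Finset.univ,
      (-1) ^ k * ∫ x : ℝ, (∏ j ∈ I, if a j ≤ x then (1 : ℂ) else 0) * φ x := by
  have hkf : (k.factorial : ℂ) ≠ 0 := by exact_mod_cast k.factorial_ne_zero
  rcases Nat.eq_zero_or_pos k with h0 | hk
  · subst h0
    have h1 : ∀ (i : Fin 0 → Fin m) (σ : Equiv.Perm (Fin 0)) (S : Finset (Fin 0)),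
        K.permTerm r a i σ S = 1 := by
      intro i σ S
      have hadm : Admissible r i σ S := fun p => p.elim0
      have hS : S = ∅ := Subsingleton.elim _ _
      have : IsEmpty (LinkClass σ S) := ⟨fun x => by
        obtain ⟨p, -⟩ := Quot.exists_rep x
        exact p.elim0⟩
      subst hS
      unfold permTerm
      rw [if_pos hadm]
      simp only [Finset.card_empty, pow_zero, one_mul]
      have h2 : ∀ u : LinkClass σ ∅ → ℝ, K.integrand r a i σ ∅ u = 1 := by
        intro u
        simp [integrand]
      simp only [h2]
      rw [integral_const]
      simp [Measure.real, volume_pi]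
    have h2 : ∫ x, (φ x : ℂ) = 1 := by
      rw [integral_complex_ofReal, hφ]
      simp
    simp [fredholmTerm, h1, h2]
  · rw [fredholmTerm]
    simp_rw [sum_perm_permTerm_rankOne hr hshift hreg hk]
    rw [sum_injective_image fun I => ∫ x : ℝ, (∏ j ∈ I, if a j ≤ x then (1 : ℂ) else 0) * φ x,
      ← Finset.mul_sum, ← mul_assoc, div_mul_cancel₀ _ hkf]

/-- The Fredholm determinant of a kernel with rank one regular part `φ(s)` and constant shift is
the distribution function of the minimum of the levels. -/
theorem fredholmDet_rankOne (hr : Function.Injective r) (hshift : ∀ j, K.shift (r j) = h)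
    (hreg : ∀ i j s s', K.reg (r i) s (r j) s' = φ s) (hφ : ∫ x, φ x = 1) :
    K.fredholmDet r a = ((∫ x in {x | ∀ j, x < a j}, φ x : ℝ) : ℂ) := by
  classical
  -- A function that is not integrable has integral 0 by convention, so integral 1 forces
  -- integrability.
  have hint : Integrable φ := by
    by_contra hn
    rw [integral_undef hn] at hφ
    exact zero_ne_one hφ
  have hmeas : MeasurableSet {x | ∀ j, x < a j} := by
    rw [Set.ofPred_forall]
    exact MeasurableSet.iInter fun j => measurableSet_Iio
  unfold fredholmDet
  rw [tsum_eq_sum (s := Finset.range (m + 1))]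
  swap
  · intro k hk
    rw [fredholmTerm_rankOne hr hshift hreg hφ, Finset.powersetCard_eq_empty.2]
    · simp
    · rw [Finset.mem_range, not_lt] at hk
      rw [Finset.card_univ, Fintype.card_fin]
      omega
  have h1 : ∀ I : Finset (Fin m), Integrable fun x : ℝ =>
      (∏ j ∈ I, if a j ≤ x then (-1 : ℂ) else 0) * φ x := by
    intro I
    refine (hint.ofReal (𝕜 := ℂ)).bdd_mul (c := 1) (Measurable.aestronglyMeasurable ?_) ?_
    · refine Finset.measurable_fun_prod _ fun j _ =>
        Measurable.ite (measurableSet_le measurable_const measurable_id) measurable_const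
          measurable_const
    · refine ae_of_all _ fun x => ?_
      rw [norm_prod]
      refine Finset.prod_le_one (fun _ _ => norm_nonneg _) fun j _ => ?_
      split_ifs <;> simp
  -- The sign (-1)^k is distributed over the k indicators, so that the sum over all subsets I is the
  -- expansion of ∏_j (1 - 1_{a_j ≤ x}).
  have h2 : ∀ k ∈ Finset.range (m + 1), K.fredholmTerm r a k =
      ∑ I ∈ Finset.powersetCard k Finset.univ,
        ∫ x : ℝ, (∏ j ∈ I, if a j ≤ x then (-1 : ℂ) else 0) * φ x := by
    intro k _
    rw [fredholmTerm_rankOne hr hshift hreg hφ]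
    refine Finset.sum_congr rfl fun I hI => ?_
    rw [← integral_const_mul]
    refine integral_congr_ae (ae_of_all _ fun x => ?_)
    simp only
    rw [← (Finset.mem_powersetCard.1 hI).2, ← Finset.prod_const, ← mul_assoc,
      ← Finset.prod_mul_distrib]
    congr 1
    refine Finset.prod_congr rfl fun j _ => ?_
    split_ifs <;> simp
  rw [Finset.sum_congr rfl h2]
  have h3 := (Finset.sum_powerset (Finset.univ : Finset (Fin m))
    fun I => ∫ x : ℝ, (∏ j ∈ I, if a j ≤ x then (-1 : ℂ) else 0) * φ x).symm
  rw [Finset.card_univ, Fintype.card_fin] at h3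
  rw [h3, ← integral_finsetSum _ fun I _ => h1 I, ← integral_complex_ofReal,
    ← integral_indicator hmeas]
  refine integral_congr_ae (ae_of_all _ fun x => ?_)
  simp only
  rw [← Finset.sum_mul, ← Finset.prod_one_add, Set.indicator_apply]
  split_ifs with hx
  · rw [Finset.prod_eq_one, one_mul]
    intro j _
    rw [if_neg (not_le.2 (hx j)), add_zero]
  · simp only [Set.mem_ofPred_eq, not_forall, not_lt] at hx
    obtain ⟨j, hj⟩ := hx
    rw [Finset.prod_eq_zero (Finset.mem_univ j), zero_mul]
    rw [if_pos hj]
    ring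

end DeltaKernel

/-! ### From joint distribution functions to weak convergence -/

theorem measurableSet_orthant {m : ℕ} (a : Fin m → ℝ) :
    MeasurableSet {x : Fin m → ℝ | ∀ j, x j < a j} := by
  rw [Set.ofPred_forall]
  exact MeasurableSet.iInter fun j => measurableSet_lt (measurable_pi_apply j) measurable_const

/-- Inclusion-exclusion for the probability of a half-open box. -/
theorem measureReal_box_eq {m : ℕ} (μ : Measure (Fin m → ℝ)) [IsFiniteMeasure μ] {x y : Fin m → ℝ}
    (hxy : x ≤ y) :
    μ.real (Set.univ.pi fun j => Set.Ico (x j) (y j)) =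
      ∑ J ∈ (Finset.univ : Finset (Fin m)).powerset,
        (-1) ^ J.card * μ.real {z | ∀ j, z j < J.piecewise x y j} := by
  classical
  have hbox : MeasurableSet (Set.univ.pi fun j => Set.Ico (x j) (y j)) :=
    MeasurableSet.univ_pi fun j => measurableSet_Ico
  have h1 : ∀ a : Fin m → ℝ, μ.real {z | ∀ j, z j < a j} =
      ∫ z, Set.indicator {z | ∀ j, z j < a j} (fun _ => (1 : ℝ)) z ∂μ := fun a => by
    rw [integral_indicator (measurableSet_orthant a)]
    simp
  simp_rw [h1, ← integral_const_mul]
  rw [← integral_finsetSum]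
  swap
  · intro J _
    exact ((integrable_const (1 : ℝ)).indicator (measurableSet_orthant _)).const_mul _
  have h2 : μ.real (Set.univ.pi fun j => Set.Ico (x j) (y j)) =
      ∫ z, Set.indicator (Set.univ.pi fun j => Set.Ico (x j) (y j)) (fun _ => (1 : ℝ)) z ∂μ := by
    rw [integral_indicator hbox]
    simp
  rw [h2]
  refine integral_congr_ae (ae_of_all _ fun z => ?_)
  have h3 : ∀ a : Fin m → ℝ, Set.indicator {z | ∀ j, z j < a j} (fun _ => (1 : ℝ)) z =
      ∏ j, if z j < a j then (1 : ℝ) else 0 := by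
    intro a
    rw [Finset.prod_ite_zero]
    simp [Set.indicator_apply]
  -- The indicator of [x_j, y_j) is the difference of those of z_j < y_j and z_j < x_j; expanding
  -- the product selects x on J and y elsewhere.
  have h4 : Set.indicator (Set.univ.pi fun j => Set.Ico (x j) (y j)) (fun _ => (1 : ℝ)) z =
      ∏ j, ((-if z j < x j then (1 : ℝ) else 0) + if z j < y j then (1 : ℝ) else 0) := by
    have h5 : ∀ j, ((-if z j < x j then (1 : ℝ) else 0) + if z j < y j then (1 : ℝ) else 0) =
        if z j ∈ Set.Ico (x j) (y j) then 1 else 0 := by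
      intro j
      have := hxy j
      simp only [Set.mem_Ico]
      split_ifs <;> first | (exfalso; grind) | norm_num
    simp_rw [h5]
    rw [Finset.prod_ite_zero]
    simp [Set.indicator_apply, Set.mem_pi]
  simp only
  rw [h4, Finset.prod_add]
  refine Finset.sum_congr rfl fun J _ => ?_
  rw [h3, Finset.prod_neg, mul_assoc]
  congr 1
  rw [← Finset.prod_mul_prod_compl J, Finset.compl_eq_univ_sdiff]
  congr 1
  · refine Finset.prod_congr rfl fun j hj => ?_
    rw [Finset.piecewise_eq_of_mem _ _ _ hj]
  · refine Finset.prod_congr rfl fun j hj => ?_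
    rw [Finset.piecewise_eq_of_notMem _ _ _ (Finset.mem_sdiff.1 hj).2]

/-- Convergence of the joint distribution functions at all points implies weak convergence. -/
theorem tendsto_probabilityMeasure_of_orthant {ι : Type*} {m : ℕ} {l : Filter ι}
    [l.IsCountablyGenerated] {μ : ι → ProbabilityMeasure (Fin m → ℝ)}
    {ν : ProbabilityMeasure (Fin m → ℝ)}
    (h : ∀ a : Fin m → ℝ, Tendsto (fun n => (μ n : Measure (Fin m → ℝ)).real {x | ∀ j, x j < a j}) l
      (𝓝 ((ν : Measure (Fin m → ℝ)).real {x | ∀ j, x j < a j}))) :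
    Tendsto μ l (𝓝 ν) := by
  -- Half-open boxes are closed under nonempty intersection and contain neighbourhoods of every
  -- point inside every open set. No box has to be a continuity set of the limit, as convergence is
  -- assumed at all levels.
  have hpi : IsPiSystem {s : Set (Fin m → ℝ) |
      ∃ x y : Fin m → ℝ, x ≤ y ∧ s = Set.univ.pi fun j => Set.Ico (x j) (y j)} := by
    rintro _ ⟨x, y, hxy, rfl⟩ _ ⟨x', y', hxy', rfl⟩ ⟨z, hz, hz'⟩
    refine ⟨x ⊔ x', y ⊓ y', fun j => ?_, ?_⟩
    · have h1 := hz j (Set.mem_univ j)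
      have h2 := hz' j (Set.mem_univ j)
      simp only [Pi.sup_apply, Pi.inf_apply]
      exact (sup_le h1.1 h2.1).trans (le_inf h1.2.le h2.2.le)
    · rw [← Set.pi_inter_distrib]
      simp only [Set.Ico_inter_Ico, Pi.sup_apply, Pi.inf_apply]
  refine hpi.tendsto_probabilityMeasure_of_tendsto_of_mem ?_ ?_ ?_
  · rintro _ ⟨x, y, -, rfl⟩
    exact MeasurableSet.univ_pi fun j => measurableSet_Ico
  · intro u hu z hz
    obtain ⟨ε, hε, hsub⟩ := Metric.isOpen_iff.1 hu z hz
    refine ⟨_, ⟨fun j => z j - ε / 2, fun j => z j + ε / 2, fun j => by simp only; linarith, rfl⟩,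
      ?_, ?_⟩
    · exact set_pi_mem_nhds Set.finite_univ fun j _ => Ico_mem_nhds (by linarith) (by linarith)
    · refine subset_trans (fun w hw => ?_) hsub
      rw [Metric.mem_ball, dist_pi_lt_iff hε]
      intro j
      have h1 := hw j (Set.mem_univ j)
      rw [Real.dist_eq, abs_lt]
      constructor <;> linarith [h1.1, h1.2]
  · rintro _ ⟨x, y, hxy, rfl⟩
    have key : Tendsto (fun n => (μ n : Measure (Fin m → ℝ)).real
        (Set.univ.pi fun j => Set.Ico (x j) (y j))) l
        (𝓝 ((ν : Measure (Fin m → ℝ)).real (Set.univ.pi fun j => Set.Ico (x j) (y j)))) := by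
      simp_rw [measureReal_box_eq _ hxy]
      exact tendsto_finsetSum _ fun J _ => (h _).const_mul _
    simpa using key

theorem tendstoFDD_of_tendsto_orthant {T ι Ω' : Type*} {Ω : ι → Type*}
    [∀ n, MeasurableSpace (Ω n)] [MeasurableSpace Ω'] {X : (n : ι) → T → Ω n → ℝ} {l : Filter ι}
    [l.IsCountablyGenerated] {Y : T → Ω' → ℝ} {P : (n : ι) → Measure (Ω n)}
    [∀ n, IsProbabilityMeasure (P n)] {P' : Measure Ω'} [IsProbabilityMeasure P']
    (hX : ∀ n t, AEMeasurable (X n t) (P n)) (hY : ∀ t, AEMeasurable (Y t) P')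
    (h : ∀ (m : ℕ) (r : Fin m → T), Function.Injective r → ∀ a : Fin m → ℝ,
      Tendsto (fun n => (P n).real {ω | ∀ j, X n (r j) ω < a j}) l
        (𝓝 (P'.real {ω | ∀ j, Y (r j) ω < a j}))) :
    TendstoFDD X l Y P P' := by
  intro m r hr
  have h1 : ∀ n, AEMeasurable (fun ω j => X n (r j) ω) (P n) := fun n =>
    aemeasurable_pi_lambda _ fun j => hX n (r j)
  have h2 : AEMeasurable (fun ω j => Y (r j) ω) P' := aemeasurable_pi_lambda _ fun j => hY (r j)
  refine ⟨h1, h2, tendsto_probabilityMeasure_of_orthant fun a => ?_⟩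
  have h3 : ∀ n, ((P n).map fun ω j => X n (r j) ω).real {x | ∀ j, x j < a j} =
      (P n).real {ω | ∀ j, X n (r j) ω < a j} := fun n => by
    rw [measureReal_def, Measure.map_apply_of_aemeasurable (h1 n) (measurableSet_orthant a)]
    rfl
  have h4 : (P'.map fun ω j => Y (r j) ω).real {x | ∀ j, x j < a j} =
      P'.real {ω | ∀ j, Y (r j) ω < a j} := by
    rw [measureReal_def, Measure.map_apply_of_aemeasurable h2 (measurableSet_orthant a)]
    rfl
  simp only [ProbabilityMeasure.coe_mk, h3, h4]
  exact h m r hr a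

theorem IsFredholmProcess.fredholmDet_eq {T Ω : Type*} [MeasurableSpace Ω] {K : DeltaKernel}
    {time : T → ℝ} {X : T → Ω → ℝ} {P : Measure Ω} (hX : IsFredholmProcess K time X P) {m : ℕ}
    {r : Fin m → T} (hr : Function.Injective r) (a : Fin m → ℝ) :
    K.fredholmDet (fun j => time (r j)) a = ((P.real {ω | ∀ j, X (r j) ω < a j} : ℝ) : ℂ) :=
  (hX.hasSum m r hr a).tsum_eq

theorem hasLaw_of_real_lt_eq {Ω : Type*} [MeasurableSpace Ω] {P : Measure Ω}
    [IsProbabilityMeasure P] {X : Ω → ℝ} (hX : AEMeasurable X P) {ν : Measure ℝ}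
    [IsProbabilityMeasure ν] (h : ∀ a, P.real {ω | X ω < a} = ν.real (Set.Iio a)) :
    HasLaw X ν P := by
  refine ⟨hX, ?_⟩
  have := Measure.isProbabilityMeasure_map hX
  refine Measure.ext_of_Ici _ _ fun a => ?_
  have h1 : (P.map X).real (Set.Iio a) = ν.real (Set.Iio a) := by
    rw [← h a, measureReal_def, Measure.map_apply_of_aemeasurable hX measurableSet_Iio]
    rfl
  have h2 : (P.map X).real (Set.Iio a)ᶜ = ν.real (Set.Iio a)ᶜ := by
    rw [probReal_compl_eq_one_sub measurableSet_Iio, probReal_compl_eq_one_sub measurableSet_Iio,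
      h1]
  rw [Set.compl_Iio] at h2
  exact (measureReal_eq_measureReal_iff (by finiteness) (by finiteness)).1 h2

/-! ### The Gaussian density and estimates of I₁ -/

theorem gaussianReal_real_eq_integral (s : Set ℝ) :
    (gaussianReal 0 1).real s = ∫ x in s, gaussianPDFReal 0 1 x := by
  rw [measureReal_def, gaussianReal_apply_eq_integral 0 one_ne_zero,
    ENNReal.toReal_ofReal (integral_nonneg fun x => gaussianPDFReal_nonneg _ _ _)]

theorem gaussianPDFReal_zero_one (x : ℝ) :
    gaussianPDFReal 0 1 x = Real.exp (-x ^ 2 / 2) / √(2 * Real.pi) := by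
  simp [gaussianPDFReal, div_eq_inv_mul]

/-- The integral of t⁻² over the circle is zero, so the exponential may be replaced by exp(w) - 1
with |w| ≤ x. The resulting factor x is essential: it removes the singularity of √(ρ/d) and makes
the Bessel terms vanish for small time differences. -/
theorem norm_besselI_one_le {x : ℝ} (hx : 0 ≤ x) : ‖besselI 1 x‖ ≤ x * Real.exp x := by
  have hne : ∀ t ∈ Metric.sphere (0 : ℂ) 1, t ≠ 0 := fun t ht h => by simp [h] at ht
  have hc1 : ContinuousOn (fun t : ℂ => t ^ (-1 - 1 : ℤ)) (Metric.sphere 0 1) :=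
    continuousOn_id.zpow₀ _ fun t ht => Or.inl (hne t ht)
  have hc2 : ContinuousOn (fun t : ℂ => Complex.exp ((x / 2 : ℂ) * (t + t⁻¹)))
      (Metric.sphere 0 1) :=
    (continuousOn_const.mul (continuousOn_id.add (continuousOn_id.inv₀ hne))).cexp
  have h0 : ∮ t in C((0 : ℂ), 1), t ^ (-1 - 1 : ℤ) = 0 := by
    have := circleIntegral.integral_sub_zpow_of_ne (n := (-1 - 1 : ℤ)) (by norm_num) 0 0 1
    simpa using this
  have h1 : ∮ t in C((0 : ℂ), 1), t ^ (-1 - 1 : ℤ) * Complex.exp ((x / 2 : ℂ) * (t + t⁻¹)) =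
      ∮ t in C((0 : ℂ), 1),
        t ^ (-1 - 1 : ℤ) * (Complex.exp ((x / 2 : ℂ) * (t + t⁻¹)) - 1) := by
    simp_rw [mul_sub, mul_one]
    have h := circleIntegral.integral_sub ((hc1.mul hc2).circleIntegrable zero_le_one)
      (hc1.circleIntegrable zero_le_one)
    simp only [Pi.mul_apply] at h
    rw [h, h0, sub_zero]
  have h2 : ‖∮ t in C((0 : ℂ), 1),
      t ^ (-1 - 1 : ℤ) * (Complex.exp ((x / 2 : ℂ) * (t + t⁻¹)) - 1)‖ ≤
      2 * Real.pi * 1 * (x * Real.exp x) := by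
    refine circleIntegral.norm_integral_le_of_norm_le_const zero_le_one fun t ht => ?_
    have ht1 : ‖t‖ = 1 := by simpa using ht
    have hw : ‖(x / 2 : ℂ) * (t + t⁻¹)‖ ≤ x := by
      rw [norm_mul, norm_div, Complex.norm_real, Real.norm_of_nonneg hx]
      have : ‖t + t⁻¹‖ ≤ 2 := (norm_add_le _ _).trans (by rw [norm_inv, ht1]; norm_num)
      have h3 : ‖(2 : ℂ)‖ = 2 := by simp
      rw [h3]
      calc x / 2 * ‖t + t⁻¹‖ ≤ x / 2 * 2 := by gcongr
        _ = x := by ring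
    have he := Complex.norm_exp_sub_sum_le_norm_mul_exp ((x / 2 : ℂ) * (t + t⁻¹)) 1
    simp only [Finset.range_one, Finset.sum_singleton, pow_zero, Nat.factorial_zero, Nat.cast_one,
      div_one, pow_one] at he
    rw [norm_mul, norm_zpow, ht1, one_zpow, one_mul]
    exact he.trans (by gcongr)
  unfold besselI
  rw [h1, norm_mul]
  have h4 : ‖(2 * Real.pi * Complex.I : ℂ)⁻¹‖ = (2 * Real.pi)⁻¹ := by
    simp [abs_of_pos Real.pi_pos]
  rw [h4]
  calc _ ≤ (2 * Real.pi)⁻¹ * (2 * Real.pi * 1 * (x * Real.exp x)) := by gcongr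
    _ = _ := by field_simp

theorem continuous_besselI (n : ℤ) : Continuous (besselI n) := by
  unfold besselI circleIntegral
  refine continuous_const.mul ?_
  refine intervalIntegral.continuous_parametric_intervalIntegral_of_continuous' ?_ _ _
  simp only [deriv_circleMap, smul_eq_mul]
  have hne : ∀ θ : ℝ, circleMap 0 1 θ ≠ 0 := fun θ => circleMap_ne_center one_ne_zero
  have hc : Continuous fun p : ℝ × ℝ => circleMap 0 1 p.2 := (continuous_circleMap 0 1).comp continuous_snd
  refine (hc.mul continuous_const).mul ((hc.zpow₀ _ fun p => Or.inl (hne _)).mul ?_)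
  refine Complex.continuous_exp.comp ?_
  exact ((Complex.continuous_ofReal.comp continuous_fst).div_const 2).mul
    (hc.add (hc.inv₀ fun p => hne _))

/-- The linear factor turns √(ρ/d) · 2√(dρ) into 2ρ, and 2√(dρ) ≤ ρ/γ + γd gives growth in d at any
prescribed rate γ. -/
theorem norm_sqrt_mul_besselI_le {ρ d γ : ℝ} (hρ : 0 ≤ ρ) (hd : 0 < d) (hγ : 0 < γ) :
    ‖(√(ρ / d) : ℂ) * besselI 1 (2 * √(d * ρ))‖ ≤
      2 * ρ * Real.exp (ρ / γ) * Real.exp (γ * d) := by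
  rw [norm_mul, Complex.norm_real, Real.norm_of_nonneg (Real.sqrt_nonneg _)]
  have h1 := norm_besselI_one_le (x := 2 * √(d * ρ)) (by positivity)
  have h2 : √(ρ / d) * (2 * √(d * ρ)) = 2 * ρ := by
    rw [mul_left_comm, ← Real.sqrt_mul (by positivity)]
    have : ρ / d * (d * ρ) = ρ ^ 2 := by field_simp
    rw [this, Real.sqrt_sq hρ]
  have h3 : 2 * √(d * ρ) ≤ ρ / γ + γ * d := by
    have e1 : d * ρ = (ρ / γ) * (γ * d) := by field_simp
    rw [e1, Real.sqrt_mul (by positivity)]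
    have e2 := Real.sq_sqrt (show 0 ≤ ρ / γ by positivity)
    have e3 := Real.sq_sqrt (show 0 ≤ γ * d by positivity)
    nlinarith [sq_nonneg (√(ρ / γ) - √(γ * d))]
  calc √(ρ / d) * ‖besselI 1 (2 * √(d * ρ))‖
      ≤ √(ρ / d) * (2 * √(d * ρ) * Real.exp (2 * √(d * ρ))) := by gcongr
    _ = 2 * ρ * Real.exp (2 * √(d * ρ)) := by rw [← mul_assoc, h2]
    _ ≤ 2 * ρ * Real.exp (ρ / γ + γ * d) := by gcongr
    _ = _ := by rw [Real.exp_add]; ring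

/-! ### Rescaled times and a criterion for exponential bounds -/

namespace DeltaKernel

variable {m : ℕ} {r a : Fin m → ℝ}

/-- The kernel with the time variables multiplied by `ε`. -/
def rescale (K : DeltaKernel) (ε : ℝ) : DeltaKernel where
  reg r₁ s₁ r₂ s₂ := K.reg (ε * r₁) s₁ (ε * r₂) s₂
  shift r := K.shift (ε * r)

theorem rescale_one (K : DeltaKernel) : K.rescale 1 = K := by
  simp [rescale]

/-- A positive factor preserves the order of times, hence admissibility. With ε inside the kernel
the times stay fixed, so the weights are built from gaps that do not shrink with ε. -/
theorem fredholmDet_rescale (K : DeltaKernel) {ε : ℝ} (hε : 0 < ε) (r a : Fin m → ℝ) :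
    (K.rescale ε).fredholmDet r a = K.fredholmDet (fun j => ε * r j) a := by
  have hadm : ∀ {k : ℕ} (i : Fin k → Fin m) (σ : Equiv.Perm (Fin k)) (S : Finset (Fin k)),
      Admissible (fun j => ε * r j) i σ S ↔ Admissible r i σ S := by
    intro k i σ S
    simp only [Admissible, mul_lt_mul_iff_right₀ hε]
  unfold fredholmDet fredholmTerm
  refine tsum_congr fun k => ?_
  congr 1
  refine Finset.sum_congr rfl fun i _ => Finset.sum_congr rfl fun σ _ =>
    Finset.sum_congr rfl fun S _ => ?_
  congr 1
  unfold permTerm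
  by_cases h : Admissible r i σ S
  · rw [if_pos h, if_pos ((hadm i σ S).2 h)]
    rfl
  · rw [if_neg h, if_neg fun h' => h ((hadm i σ S).1 h')]

theorem exists_pos_le_gap (r : Fin m → ℝ) : ∃ g > 0, ∀ i j, r i < r j → g ≤ r j - r i := by
  have h : ∀ᶠ g in 𝓝[>] (0 : ℝ), ∀ i j, r i < r j → g ≤ r j - r i := by
    rw [eventually_all]
    intro i
    rw [eventually_all]
    intro j
    by_cases hij : r i < r j
    · filter_upwards [Ioo_mem_nhdsGT (sub_pos.2 hij)] with g hg _ using hg.2.le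
    · exact Eventually.of_forall fun g h => absurd h hij
  obtain ⟨g, hg, hg0⟩ := (h.and self_mem_nhdsWithin).exists
  exact ⟨g, hg0, hg⟩

/-- A kernel which is the sum of a part bounded by `exp (-β * u + α * v)` with `α < β` and of a part
supported on `r < r'`, `u < v`, and bounded by `exp (γ * (v - u))` with `γ = (α + β) / 2`, has an
exponential bound with weights increasing in time. -/
theorem exists_expBound (r a : Fin m → ℝ) (b : ℝ) {α β C₀ : ℝ} (hαβ : α < β) (hC₀ : 0 ≤ C₀) :
    ∃ C κ M c, ∀ K : DeltaKernel, (∀ j, b ≤ a j + K.shift (r j)) →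
      (∀ i j u v, b ≤ u → b ≤ v →
        ‖K.reg (r i) (u - K.shift (r i)) (r j) (v - K.shift (r j))‖ ≤
          C₀ * Real.exp (-β * u + α * v) +
            if r i < r j ∧ u < v then C₀ * Real.exp ((α + β) / 2 * (v - u)) else 0) →
      K.ExpBound r a b C κ M c := by
  obtain ⟨g, hg0, hg⟩ := exists_pos_le_gap r
  set δ := (β - α) / 2 with hδ
  set γ := (α + β) / 2 with hγ
  have hδ0 : 0 < δ := by rw [hδ]; linarith
  set R := ∑ j, |r j| with hR
  have hrR : ∀ j, |r j| ≤ R := fun j =>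
    Finset.single_le_sum (f := fun j => |r j|) (fun j _ => abs_nonneg _) (Finset.mem_univ j)
  have hR0 : 0 ≤ R := Finset.sum_nonneg fun j _ => abs_nonneg _
  -- This slope keeps all weights within [γ, γ + δ/2]; the summand 1 avoids division by zero when
  -- all times vanish.
  set η := δ / 2 / (2 * R + 1) with hη
  have hη0 : 0 < η := by positivity
  have hηR : η * (2 * R + 1) = δ / 2 := by rw [hη]; field_simp
  -- The bound by δ/2 leaves room between α and β for the contour part; the bound by ηg/2 makes 2κ
  -- at most the increase of the weight between successive times, as the Bessel part requires.
  set κ := min (δ / 2) (η * g / 2) with hκ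
  have hκ0 : 0 < κ := lt_min (by positivity) (by positivity)
  have hκ1 : κ ≤ δ / 2 := min_le_left _ _
  have hκ2 : 2 * κ ≤ η * g := by
    have : κ ≤ η * g / 2 := min_le_right _ _
    linarith
  set c : Fin m → ℝ := fun j => γ + η * (r j + R) with hc
  have hc1 : ∀ j, γ ≤ c j := fun j => by
    have := abs_le.1 (hrR j)
    have : 0 ≤ η * (r j + R) := mul_nonneg hη0.le (by linarith)
    simp only [hc]; linarith
  have hc2 : ∀ j, c j ≤ γ + δ / 2 := fun j => by
    have := abs_le.1 (hrR j)
    have : η * (r j + R) ≤ η * (2 * R + 1) := mul_le_mul_of_nonneg_left (by linarith) hη0.le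
    simp only [hc]; linarith
  have hgap : ∀ i j, r i < r j → 2 * κ ≤ c j - c i := fun i j hij => by
    have h1 : η * g ≤ η * (r j - r i) := mul_le_mul_of_nonneg_left (hg i j hij) hη0.le
    simp only [hc]; linarith
  refine ⟨1 + C₀ * Real.exp (4 * δ * |b|) + C₀ * Real.exp (4 * δ * |b|), κ, |γ| + δ / 2, c,
    fun K h1 h2 => ⟨fun i j hij => ?_, fun i => ?_, ?_, hκ0, h1, fun i j u v hu hv => ?_⟩⟩
  · have := hgap i j hij
    linarith
  · rw [abs_le]
    have := hc1 i
    have := hc2 i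
    constructor <;> linarith [neg_abs_le γ, le_abs_self γ]
  · have : 0 ≤ C₀ * Real.exp (4 * δ * |b|) := by positivity
    linarith
  have hu' : -|b| ≤ u := (neg_abs_le b).trans hu
  have hv' : -|b| ≤ v := (neg_abs_le b).trans hv
  have hb0 := abs_nonneg b
  have hci := hc1 i
  have hci2 := hc2 i
  have hcj := hc1 j
  have hcj2 := hc2 j
  have hγβ : γ + δ = β := by rw [hγ, hδ]; ring
  have hγα : γ - δ = α := by rw [hγ, hδ]; ring
  set E := Real.exp (-(c i + κ) * u) * Real.exp ((c j - κ) * v) with hE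
  have hE0 : 0 < E := by positivity
  have hA : Real.exp (-β * u + α * v) ≤ Real.exp (4 * δ * |b|) * E := by
    rw [hE, ← Real.exp_add, ← Real.exp_add]
    refine Real.exp_le_exp.2 ?_
    have e1 : 0 ≤ (β - c i - κ) * (u + |b|) := mul_nonneg (by linarith) (by linarith)
    have e2 : 0 ≤ (c j - κ - α) * (v + |b|) := mul_nonneg (by linarith) (by linarith)
    have e3 : (β - c i - κ + (c j - κ - α)) * |b| ≤ 4 * δ * |b| :=
      mul_le_mul_of_nonneg_right (by linarith) hb0
    linarith
  have hB : (if r i < r j ∧ u < v then C₀ * Real.exp (γ * (v - u)) else 0) ≤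
      C₀ * Real.exp (4 * δ * |b|) * E := by
    split_ifs with hij
    · rw [mul_assoc]
      refine mul_le_mul_of_nonneg_left ?_ hC₀
      rw [hE, ← Real.exp_add, ← Real.exp_add]
      refine Real.exp_le_exp.2 ?_
      have e0 := hgap i j hij.1
      -- The difference of the two exponents is (c_i + κ - γ)(v - u) + (c_j - c_i - 2κ)v; the first
      -- product is nonnegative as u < v, the second up to a constant as r_i < r_j.
      have e1 : 0 ≤ (c i + κ - γ) * (v - u) := mul_nonneg (by linarith) (by linarith [hij.2])
      have e2 : 0 ≤ (c j - c i - 2 * κ) * (v + |b|) := mul_nonneg (by linarith) (by linarith)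
      have e3 : (c j - c i - 2 * κ) * |b| ≤ 4 * δ * |b| :=
        mul_le_mul_of_nonneg_right (by linarith) hb0
      linarith
    · positivity
  calc _ ≤ C₀ * (Real.exp (4 * δ * |b|) * E) + C₀ * Real.exp (4 * δ * |b|) * E :=
        (h2 i j u v hu hv).trans (add_le_add (mul_le_mul_of_nonneg_left hA hC₀) hB)
    _ ≤ (1 + C₀ * Real.exp (4 * δ * |b|) + C₀ * Real.exp (4 * δ * |b|)) * E := by
        linarith

end DeltaKernel

/-! ### The contour integral of the step kernel -/

theorem re_vertLine (L y : ℝ) : (-(L : ℂ) + y * Complex.I).re = -L := by simp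

theorem le_norm_vertLine (L y : ℝ) : L ≤ ‖-(L : ℂ) + y * Complex.I‖ := by
  have := (neg_le_abs _).trans (Complex.abs_re_le_norm (-(L : ℂ) + y * Complex.I))
  rwa [re_vertLine, neg_neg] at this

theorem re_vertLine_sq (L y : ℝ) : ((-(L : ℂ) + y * Complex.I) ^ 2).re = L ^ 2 - y ^ 2 := by
  simp [pow_two]

theorem integrable_exp_neg_sq_div_two : Integrable fun y : ℝ => Real.exp (-y ^ 2 / 2) := by
  have := integrable_exp_neg_mul_sq (b := 1 / 2) (by norm_num)
  refine this.congr (ae_of_all _ fun y => ?_)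
  simp only
  congr 1
  ring

/-- The Gaussian density as an integral over a vertical line. -/
theorem integral_vertLine_gaussian (L s : ℝ) :
    ∫ y : ℝ, Complex.exp ((-(L : ℂ) + y * Complex.I) ^ 2 / 2 + s * (-(L : ℂ) + y * Complex.I)) =
      (2 * Real.pi * gaussianPDFReal 0 1 s : ℝ) := by
  have h1 : ∀ y : ℝ, (-(L : ℂ) + y * Complex.I) ^ 2 / 2 + s * (-(L : ℂ) + y * Complex.I) =
      (-1 / 2 : ℂ) * (y : ℂ) ^ 2 + ((s - L) * Complex.I) * y + (L ^ 2 / 2 - s * L) := by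
    intro y
    linear_combination ((y : ℂ) ^ 2 / 2) * Complex.I_sq
  simp_rw [h1]
  rw [integral_cexp_quadratic (by norm_num)]
  have h2 : (Real.pi / -(-1 / 2 : ℂ)) ^ (1 / 2 : ℂ) = (√(2 * Real.pi) : ℝ) := by
    rw [Real.sqrt_eq_rpow, Complex.ofReal_cpow (by positivity)]
    push_cast
    congr 1
    ring
  have h3 : (L ^ 2 / 2 - s * L : ℂ) - ((s - L) * Complex.I) ^ 2 / (4 * (-1 / 2)) =
      ((-s ^ 2 / 2 : ℝ) : ℂ) := by
    push_cast
    linear_combination ((s - L : ℂ) ^ 2 / 2) * Complex.I_sq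
  rw [h2, h3, ← Complex.ofReal_exp, gaussianPDFReal_zero_one, ← Complex.ofReal_mul]
  congr 1
  have h4 : √(2 * Real.pi) * √(2 * Real.pi) = 2 * Real.pi := Real.mul_self_sqrt (by positivity)
  have h5 : √(2 * Real.pi) ≠ 0 := by positivity
  field_simp
  linear_combination h4

/-- The integrand of the double contour integral in `stepKernel`. -/
def stepIntegrand (r₁ s₁ r₂ s₂ : ℝ) (x₁ x₂ : ℂ) : ℂ :=
  x₁ * Complex.exp ((x₁ ^ 2 - x₂ ^ 2) / 2 + r₁ / x₁ + s₁ * x₁ - r₂ / x₂ - s₂ * x₂) /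
    (x₂ * (x₁ - x₂))

/-- The double contour integral in `stepKernel`. -/
def stepContour (r₁ s₁ r₂ s₂ : ℝ) : ℂ :=
  ((2 * Real.pi * Complex.I) ^ 2)⁻¹ *
    vertIntegral fun x₁ => ∮ x₂ in C(0, 1 / 2), stepIntegrand r₁ s₁ r₂ s₂ x₁ x₂

theorem norm_le_two_mul_norm_sub {x₁ x₂ : ℂ} (h₁ : 1 ≤ ‖x₁‖) (h₂ : ‖x₂‖ = 1 / 2) :
    ‖x₁‖ ≤ 2 * ‖x₁ - x₂‖ := by
  have := norm_sub_norm_le x₁ x₂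
  linarith

/-- The line at distance 1 from the origin gives decay at rate 1 in s₁, the circle of radius 1/2
gives growth at rate at most 1/2 in s₂, and the square of x₁ gives Gaussian decay along the line.
The contours stay apart, which controls x₁/(x₁ - x₂). -/
theorem norm_stepIntegrand_le (r₁ s₁ r₂ s₂ y : ℝ) {x₂ : ℂ} (h₂ : ‖x₂‖ = 1 / 2) :
    ‖stepIntegrand r₁ s₁ r₂ s₂ (-((1 : ℝ) : ℂ) + y * Complex.I) x₂‖ ≤
      4 * (Real.exp (1 + |r₁| + 2 * |r₂| - s₁ + |s₂| / 2) * Real.exp (-y ^ 2 / 2)) := by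
  set x₁ : ℂ := -((1 : ℝ) : ℂ) + y * Complex.I with hx₁
  have h₁ : 1 ≤ ‖x₁‖ := le_norm_vertLine 1 y
  have h₃ := norm_le_two_mul_norm_sub h₁ h₂
  have hre : ((x₁ ^ 2 - x₂ ^ 2) / 2 + r₁ / x₁ + s₁ * x₁ - r₂ / x₂ - s₂ * x₂).re ≤
      1 + |r₁| + 2 * |r₂| - s₁ + |s₂| / 2 + -y ^ 2 / 2 := by
    have e1 : (x₁ ^ 2).re = 1 - y ^ 2 := by rw [hx₁, re_vertLine_sq]; norm_num
    have e2 : -(1 / 4) ≤ (x₂ ^ 2).re := by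
      have := Complex.abs_re_le_norm (x₂ ^ 2)
      rw [norm_pow, h₂] at this
      have := (abs_le.1 this).1
      linarith
    have e3 : (r₁ / x₁).re ≤ |r₁| := by
      refine (Complex.re_le_norm _).trans ?_
      rw [norm_div, Complex.norm_real, Real.norm_eq_abs]
      exact div_le_self (abs_nonneg _) h₁
    have e4 : -(2 * |r₂|) ≤ (r₂ / x₂).re := by
      have := Complex.abs_re_le_norm (r₂ / x₂)
      rw [norm_div, Complex.norm_real, Real.norm_eq_abs, h₂] at this
      have := (abs_le.1 this).1
      linarith
    have e5 : (s₁ * x₁).re = -s₁ := by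
      rw [Complex.re_ofReal_mul, hx₁, re_vertLine]
      ring
    have e6 : -(|s₂| / 2) ≤ (s₂ * x₂).re := by
      have := Complex.abs_re_le_norm (s₂ * x₂)
      rw [norm_mul, Complex.norm_real, Real.norm_eq_abs, h₂] at this
      have := (abs_le.1 this).1
      linarith
    have e7 : ((x₁ ^ 2 - x₂ ^ 2) / 2).re = ((x₁ ^ 2).re - (x₂ ^ 2).re) / 2 := by
      rw [← Complex.sub_re]
      exact Complex.div_ofNat_re _ 2
    simp only [Complex.sub_re, Complex.add_re, e7, e1, e5]
    linarith
  unfold stepIntegrand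
  rw [norm_div, norm_mul, norm_mul, h₂, Complex.norm_exp, ← Real.exp_add]
  have h₄ : 0 < ‖x₁ - x₂‖ := by linarith
  rw [div_le_iff₀ (by positivity)]
  have h₅ := Real.exp_le_exp.2 hre
  have h₆ := Real.exp_pos (1 + |r₁| + 2 * |r₂| - s₁ + |s₂| / 2 + -y ^ 2 / 2)
  calc ‖x₁‖ * _ ≤ (2 * ‖x₁ - x₂‖) *
        Real.exp (1 + |r₁| + 2 * |r₂| - s₁ + |s₂| / 2 + -y ^ 2 / 2) := by gcongr
    _ = _ := by ring

theorem norm_circleIntegral_stepIntegrand_le (r₁ s₁ r₂ s₂ y : ℝ) :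
    ‖∮ x₂ in C(0, 1 / 2), stepIntegrand r₁ s₁ r₂ s₂ (-((1 : ℝ) : ℂ) + y * Complex.I) x₂‖ ≤
      4 * Real.pi * Real.exp (1 + |r₁| + 2 * |r₂| - s₁ + |s₂| / 2) * Real.exp (-y ^ 2 / 2) := by
  refine (circleIntegral.norm_integral_le_of_norm_le_const (by norm_num) fun x₂ hx₂ =>
    norm_stepIntegrand_le r₁ s₁ r₂ s₂ y (by simpa using hx₂)).trans (le_of_eq ?_)
  ring

theorem vertIntegral_eq (f : ℂ → ℂ) :
    vertIntegral f = ∫ y : ℝ, f (-((1 : ℝ) : ℂ) + y * Complex.I) * Complex.I := by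
  simp [vertIntegral]

theorem norm_stepContour_le (r₁ s₁ r₂ s₂ : ℝ) :
    ‖stepContour r₁ s₁ r₂ s₂‖ ≤ 4 * Real.pi * Real.exp (1 + |r₁| + 2 * |r₂| - s₁ + |s₂| / 2) *
      ∫ y : ℝ, Real.exp (-y ^ 2 / 2) := by
  unfold stepContour
  rw [vertIntegral_eq, norm_mul]
  have h1 : ‖((2 * Real.pi * Complex.I : ℂ) ^ 2)⁻¹‖ ≤ 1 := by
    rw [norm_inv, norm_pow]
    refine inv_le_one_of_one_le₀ (one_le_pow₀ ?_)
    simp only [norm_mul, Complex.norm_real, Complex.norm_I, mul_one, Complex.norm_ofNat,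
      Real.norm_of_nonneg Real.pi_pos.le]
    linarith [Real.pi_gt_three]
  have h2 : ‖∫ y : ℝ, (∮ x₂ in C(0, 1 / 2),
      stepIntegrand r₁ s₁ r₂ s₂ (-((1 : ℝ) : ℂ) + y * Complex.I) x₂) * Complex.I‖ ≤
      ∫ y : ℝ, 4 * Real.pi * Real.exp (1 + |r₁| + 2 * |r₂| - s₁ + |s₂| / 2) *
        Real.exp (-y ^ 2 / 2) := by
    refine norm_integral_le_of_norm_le (integrable_exp_neg_sq_div_two.const_mul _)
      (ae_of_all _ fun y => ?_)
    rw [norm_mul, Complex.norm_I, mul_one]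
    exact norm_circleIntegral_stepIntegrand_le r₁ s₁ r₂ s₂ y
  rw [integral_const_mul] at h2
  calc _ ≤ 1 * _ := mul_le_mul h1 h2 (norm_nonneg _) zero_le_one
    _ = _ := one_mul _

theorem continuous_circleIntegral_stepIntegrand :
    Continuous fun q : (ℝ × ℝ × ℝ × ℝ) × ℝ => ∮ x₂ in C(0, 1 / 2),
      stepIntegrand q.1.1 q.1.2.1 q.1.2.2.1 q.1.2.2.2 (-((1 : ℝ) : ℂ) + q.2 * Complex.I) x₂ := by
  unfold circleIntegral
  refine intervalIntegral.continuous_parametric_intervalIntegral_of_continuous' ?_ _ _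
  simp only [deriv_circleMap, smul_eq_mul, stepIntegrand]
  have hx₂ : Continuous fun p : ((ℝ × ℝ × ℝ × ℝ) × ℝ) × ℝ => circleMap 0 (1 / 2) p.2 :=
    (continuous_circleMap 0 (1 / 2)).comp continuous_snd
  have hx₁ : Continuous fun p : ((ℝ × ℝ × ℝ × ℝ) × ℝ) × ℝ =>
      -((1 : ℝ) : ℂ) + p.1.2 * Complex.I := by fun_prop
  have hn₂ : ∀ θ : ℝ, ‖circleMap 0 (1 / 2) θ‖ = 1 / 2 := fun θ => by simp
  have hne₂ : ∀ p : ((ℝ × ℝ × ℝ × ℝ) × ℝ) × ℝ, circleMap 0 (1 / 2) p.2 ≠ 0 := fun p =>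
    circleMap_ne_center (by norm_num)
  have hne₁ : ∀ p : ((ℝ × ℝ × ℝ × ℝ) × ℝ) × ℝ, -((1 : ℝ) : ℂ) + p.1.2 * Complex.I ≠ 0 := by
    intro p h
    have := le_norm_vertLine 1 p.1.2
    rw [h, norm_zero] at this
    linarith
  have hne₃ : ∀ p : ((ℝ × ℝ × ℝ × ℝ) × ℝ) × ℝ,
      -((1 : ℝ) : ℂ) + p.1.2 * Complex.I - circleMap 0 (1 / 2) p.2 ≠ 0 := by
    intro p h
    have h1 := le_norm_vertLine 1 p.1.2
    have h2 := norm_le_two_mul_norm_sub h1 (hn₂ p.2)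
    rw [h, norm_zero] at h2
    linarith
  unfold Function.uncurry
  refine (hx₂.mul continuous_const).mul ((hx₁.mul ?_).div (hx₂.mul (hx₁.sub hx₂))
    fun p => mul_ne_zero (hne₂ p) (hne₃ p))
  refine Complex.continuous_exp.comp ?_
  refine Continuous.sub (Continuous.sub (Continuous.add (Continuous.add ?_ ?_) ?_) ?_) ?_
  · exact ((hx₁.pow 2).sub (hx₂.pow 2)).div_const 2
  · exact Continuous.div (by fun_prop) hx₁ hne₁
  · exact Continuous.mul (by fun_prop) hx₁
  · exact Continuous.div (by fun_prop) hx₂ hne₂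
  · exact Continuous.mul (by fun_prop) hx₂

/-- Joint continuity includes the times: it gives both measurability in the space variables and the
limit at time zero. -/
theorem continuous_stepContour :
    Continuous fun q : ℝ × ℝ × ℝ × ℝ => stepContour q.1 q.2.1 q.2.2.1 q.2.2.2 := by
  unfold stepContour
  simp_rw [vertIntegral_eq]
  refine continuous_const.mul (continuous_iff_continuousAt.2 fun q₀ => ?_)
  set B : ℝ × ℝ × ℝ × ℝ → ℝ := fun q =>
    4 * Real.pi * Real.exp (1 + |q.1| + 2 * |q.2.2.1| - q.2.1 + |q.2.2.2| / 2) with hB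
  have hBc : Continuous B := by fun_prop
  refine continuousAt_of_dominated (bound := fun y => (B q₀ + 1) * Real.exp (-y ^ 2 / 2))
    ?_ ?_ (integrable_exp_neg_sq_div_two.const_mul _) ?_
  · refine Eventually.of_forall fun q => Continuous.aestronglyMeasurable ?_
    exact (continuous_circleIntegral_stepIntegrand.comp
      (continuous_const.prodMk continuous_id)).mul continuous_const
  · have h1 : ∀ᶠ q in 𝓝 q₀, B q < B q₀ + 1 :=
      hBc.continuousAt.eventually_lt continuousAt_const (by linarith)
    filter_upwards [h1] with q hq
    refine ae_of_all _ fun y => ?_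
    rw [norm_mul, Complex.norm_I, mul_one]
    refine (norm_circleIntegral_stepIntegrand_le _ _ _ _ y).trans ?_
    gcongr
  · refine ae_of_all _ fun y => ContinuousAt.mul ?_ continuousAt_const
    exact (continuous_circleIntegral_stepIntegrand.comp
      (continuous_id.prodMk continuous_const)).continuousAt

/-- At time zero the circle around the origin collects the residue at the origin only. -/
theorem stepContour_zero (s₁ s₂ : ℝ) :
    stepContour 0 s₁ 0 s₂ = (gaussianPDFReal 0 1 s₁ : ℂ) := by
  have hinner : ∀ y : ℝ, ∮ x₂ in C(0, 1 / 2),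
      stepIntegrand 0 s₁ 0 s₂ (-((1 : ℝ) : ℂ) + y * Complex.I) x₂ =
      2 * Real.pi * Complex.I * Complex.exp ((-((1 : ℝ) : ℂ) + y * Complex.I) ^ 2 / 2 +
        s₁ * (-((1 : ℝ) : ℂ) + y * Complex.I)) := by
    intro y
    set x₁ : ℂ := -((1 : ℝ) : ℂ) + y * Complex.I with hx₁
    have h₁ : 1 ≤ ‖x₁‖ := le_norm_vertLine 1 y
    have hx₁0 : x₁ ≠ 0 := by
      intro h
      rw [h, norm_zero] at h₁
      linarith
    -- At time zero the essential singularity is gone and x₁ lies outside the circle, so Cauchy's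
    -- formula at the origin evaluates the integral.
    set f : ℂ → ℂ := fun x₂ =>
      x₁ * Complex.exp ((x₁ ^ 2 - x₂ ^ 2) / 2 + s₁ * x₁ - s₂ * x₂) / (x₁ - x₂) with hf
    have hd : DifferentiableOn ℂ f (Metric.closedBall 0 (1 / 2)) := by
      intro x₂ hx₂
      have h2 : x₁ - x₂ ≠ 0 := by
        intro h
        rw [sub_eq_zero] at h
        rw [← h, mem_closedBall_zero_iff] at hx₂
        linarith
      refine DifferentiableAt.differentiableWithinAt ?_
      exact DifferentiableAt.div (by fun_prop) (by fun_prop) h2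
    have hc := hd.circleIntegral_sub_inv_smul (w := 0) (by simp)
    have h3 : ∀ x₂ : ℂ, stepIntegrand 0 s₁ 0 s₂ x₁ x₂ = (x₂ - 0)⁻¹ • f x₂ := by
      intro x₂
      simp only [stepIntegrand, hf, Complex.ofReal_zero, zero_div, add_zero, sub_zero,
        smul_eq_mul]
      rw [inv_mul_eq_div, div_div, mul_comm x₂]
    simp_rw [h3]
    rw [hc, smul_eq_mul]
    congr 1
    simp only [hf, sub_zero, mul_zero]
    rw [mul_div_assoc, mul_div_cancel₀ _ hx₁0]
    congr 1
    ring
  unfold stepContour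
  rw [vertIntegral_eq]
  simp_rw [hinner]
  rw [integral_mul_const, integral_const_mul, integral_vertLine_gaussian]
  have hpi : (Real.pi : ℂ) ≠ 0 := by exact_mod_cast Real.pi_ne_zero
  push_cast
  field_simp

theorem stepKernel_reg (r₁ s₁ r₂ s₂ : ℝ) :
    stepKernel.reg r₁ s₁ r₂ s₂ = stepContour r₁ s₁ r₂ s₂ - if r₁ < r₂ ∧ s₁ < s₂ then
        (√((r₂ - r₁) / (s₂ - s₁)) : ℂ) * besselI 1 (2 * √((s₂ - s₁) * (r₂ - r₁)))
      else 0 := rfl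

theorem measurable_stepKernel_reg (r₁ r₂ : ℝ) :
    Measurable fun x : ℝ × ℝ => stepKernel.reg r₁ x.1 r₂ x.2 := by
  simp only [stepKernel_reg]
  refine Measurable.sub ?_ (Measurable.ite ?_ ?_ measurable_const)
  · exact (continuous_stepContour.comp
      (by fun_prop : Continuous fun x : ℝ × ℝ => (r₁, x.1, r₂, x.2))).measurable
  · exact (MeasurableSet.const (r₁ < r₂)).inter (measurableSet_lt measurable_fst measurable_snd)
  · refine Measurable.mul ?_ ((continuous_besselI 1).measurable.comp (by fun_prop))
    exact Complex.measurable_ofReal.comp (by fun_prop)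

namespace DeltaKernel

variable {m : ℕ}

theorem exists_expBound_step (r a : Fin m → ℝ) :
    ∃ b C κ M c, ∀ ε ∈ Set.Ioc (0 : ℝ) 1, (stepKernel.rescale ε).ExpBound r a b C κ M c := by
  set b := -∑ j, |a j| with hb
  have hba : ∀ j, b ≤ a j := fun j => by
    have h1 : |a j| ≤ ∑ j, |a j| := Finset.single_le_sum (f := fun j => |a j|)
      (fun j _ => abs_nonneg _) (Finset.mem_univ j)
    have h2 := neg_abs_le (a j)
    linarith
  set R := ∑ j, |r j| with hR
  have hrR : ∀ j, |r j| ≤ R := fun j =>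
    Finset.single_le_sum (f := fun j => |r j|) (fun j _ => abs_nonneg _) (Finset.mem_univ j)
  have hR0 : 0 ≤ R := Finset.sum_nonneg fun j _ => abs_nonneg _
  set I := ∫ y : ℝ, Real.exp (-y ^ 2 / 2) with hI
  have hI0 : 0 ≤ I := integral_nonneg fun y => (Real.exp_pos _).le
  set A := 4 * Real.pi * Real.exp (1 + 3 * R + |b|) * I with hA
  set B := 4 * R * Real.exp (2 * R / (3 / 4)) with hB
  have hA0 : 0 ≤ A := by positivity
  have hB0 : 0 ≤ B := by positivity
  -- The rates are the radius of the circle and the distance of the line; the Bessel part is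
  -- estimated at their mean 3/4.
  obtain ⟨C, κ, M, c, h⟩ := exists_expBound r a b (α := 1 / 2) (β := 1) (C₀ := A + B) (by norm_num)
    (by positivity)
  refine ⟨b, C, κ, M, c, fun ε hε => h _ (fun j => ?_) fun i j u v hu hv => ?_⟩
  · simpa [rescale, stepKernel] using hba j
  have hshift : ∀ t, (stepKernel.rescale ε).shift t = 0 := fun t => rfl
  rw [hshift, hshift, sub_zero, sub_zero]
  change ‖stepKernel.reg (ε * r i) u (ε * r j) v‖ ≤ _
  rw [stepKernel_reg]
  have hεr : ∀ l, |ε * r l| ≤ R := fun l => by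
    rw [abs_mul, abs_of_pos hε.1]
    calc ε * |r l| ≤ 1 * |r l| := by gcongr; exact hε.2
      _ ≤ R := by rw [one_mul]; exact hrR l
  refine (norm_sub_le _ _).trans (add_le_add ?_ ?_)
  · refine (norm_stepContour_le _ _ _ _).trans ?_
    have h1 : |v| ≤ v + 2 * |b| := by
      have hv' : -|b| ≤ v := (neg_abs_le b).trans hv
      have := abs_nonneg b
      rcases abs_cases v with h | h <;> linarith
    have h2 : 1 + |ε * r i| + 2 * |ε * r j| - u + |v| / 2 ≤
        (1 + 3 * R + |b|) + (-1 * u + 1 / 2 * v) := by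
      linarith [hεr i, hεr j]
    calc _ ≤ 4 * Real.pi * Real.exp ((1 + 3 * R + |b|) + (-1 * u + 1 / 2 * v)) * I := by gcongr
      _ = A * Real.exp (-1 * u + 1 / 2 * v) := by rw [Real.exp_add, hA]; ring
      _ ≤ _ := by gcongr; linarith
  · by_cases hc : r i < r j ∧ u < v
    · have hc' : ε * r i < ε * r j ∧ u < v := ⟨mul_lt_mul_of_pos_left hc.1 hε.1, hc.2⟩
      rw [if_pos hc, if_pos hc']
      have hρ0 : 0 ≤ ε * r j - ε * r i := by linarith [hc'.1]
      have hρ1 : ε * r j - ε * r i ≤ 2 * R := by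
        have h1 := abs_le.1 (hεr i)
        have h2 := abs_le.1 (hεr j)
        linarith
      have key := norm_sqrt_mul_besselI_le (γ := 3 / 4) hρ0 (sub_pos.2 hc.2) (by norm_num)
      refine key.trans ?_
      rw [show (1 / 2 + 1 : ℝ) / 2 = 3 / 4 by norm_num]
      gcongr
      calc 2 * (ε * r j - ε * r i) * Real.exp ((ε * r j - ε * r i) / (3 / 4))
          ≤ 2 * (2 * R) * Real.exp (2 * R / (3 / 4)) := by gcongr
        _ = B := by rw [hB]; ring
        _ ≤ A + B := by linarith
    · have hc' : ¬ (ε * r i < ε * r j ∧ u < v) := fun h =>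
        hc ⟨lt_of_mul_lt_mul_left h.1 hε.1.le, h.2⟩
      rw [if_neg hc, if_neg hc', norm_zero]

theorem fredholmConverges_step (r a : Fin m → ℝ) : stepKernel.FredholmConverges r a := by
  obtain ⟨b, C, κ, M, c, h⟩ := exists_expBound_step r a
  have h1 := h 1 (by simp)
  rw [rescale_one] at h1
  exact h1.fredholmConverges fun i j => measurable_stepKernel_reg _ _

/-- The kernel with Gaussian regular part independent of the times and of the second variable. -/
def gaussianKernel : DeltaKernel where
  reg _ s _ _ := (gaussianPDFReal 0 1 s : ℂ)
  shift _ := 0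

theorem fredholmDet_gaussianKernel {r : Fin m → ℝ} (hr : Function.Injective r) (a : Fin m → ℝ) :
    gaussianKernel.fredholmDet r a = (((gaussianReal 0 1).real {z | ∀ j, z < a j} : ℝ) : ℂ) := by
  rw [fredholmDet_rankOne hr (h := 0) (φ := gaussianPDFReal 0 1) (fun _ => rfl)
    (fun _ _ _ _ => rfl) (integral_gaussianPDFReal_eq_one 0 one_ne_zero),
    gaussianReal_real_eq_integral]

theorem tendsto_fredholmDet_step {r : Fin m → ℝ} (hr : Function.Injective r) (a : Fin m → ℝ) :
    Tendsto (fun ε : ℝ => stepKernel.fredholmDet (fun j => ε * r j) a) (𝓝[>] 0)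
      (𝓝 (((gaussianReal 0 1).real {z | ∀ j, z < a j} : ℝ) : ℂ)) := by
  obtain ⟨b, C, κ, M, c, h⟩ := exists_expBound_step r a
  have hIoc : ∀ᶠ ε : ℝ in 𝓝[>] 0, ε ∈ Set.Ioc (0 : ℝ) 1 := Ioc_mem_nhdsGT one_pos
  have hid : Tendsto (fun ε : ℝ => ε) (𝓝[>] 0) (𝓝 0) := tendsto_id.mono_left nhdsWithin_le_nhds
  rw [← fredholmDet_gaussianKernel hr]
  have key : Tendsto (fun ε : ℝ => (stepKernel.rescale ε).fredholmDet r a) (𝓝[>] 0)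
      (𝓝 (gaussianKernel.fredholmDet r a)) := by
    refine tendsto_fredholmDet (hIoc.mono fun ε hε => h ε hε)
      (Eventually.of_forall fun ε i j => measurable_stepKernel_reg _ _)
      (fun j => tendsto_const_nhds) fun i j u v => ?_
    simp only [show ∀ ε t, (stepKernel.rescale ε).shift t = 0 from fun _ _ => rfl,
      show ∀ t, gaussianKernel.shift t = 0 from fun _ => rfl, sub_zero]
    change Tendsto (fun ε => stepKernel.reg (ε * r i) u (ε * r j) v) _
      (𝓝 (gaussianPDFReal 0 1 u : ℂ))
    simp only [stepKernel_reg]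
    rw [← sub_zero (gaussianPDFReal 0 1 u : ℂ), ← stepContour_zero u v]
    have hmul : ∀ x : ℝ, Tendsto (fun ε : ℝ => ε * x) (𝓝[>] 0) (𝓝 0) := fun x => by
      simpa using hid.mul_const x
    refine Tendsto.sub ?_ ?_
    · have h1 : Tendsto (fun ε : ℝ => (ε * r i, u, ε * r j, v)) (𝓝[>] 0)
          (𝓝 ((0 : ℝ), u, (0 : ℝ), v)) :=
        (hmul _).prodMk_nhds (tendsto_const_nhds.prodMk_nhds
          ((hmul _).prodMk_nhds tendsto_const_nhds))
      have h2 := (continuous_stepContour.tendsto ((0 : ℝ), u, (0 : ℝ), v)).comp h1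
      simpa only [Function.comp_def] using h2
    · by_cases hc : r i < r j ∧ u < v
      · have h2 : Tendsto (fun ε : ℝ => 2 * (ε * (r j - r i)) *
            Real.exp (ε * (r j - r i) / 1) * Real.exp (1 * (v - u))) (𝓝[>] 0) (𝓝 0) := by
          have h3 : Continuous fun ε : ℝ => 2 * (ε * (r j - r i)) *
            Real.exp (ε * (r j - r i) / 1) * Real.exp (1 * (v - u)) := by fun_prop
          have h4 := (h3.tendsto 0).comp hid
          simpa only [Function.comp_def, zero_mul, mul_zero] using h4
        refine squeeze_zero_norm' ?_ h2
        filter_upwards [self_mem_nhdsWithin] with ε (hε : 0 < ε)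
        rw [if_pos ⟨mul_lt_mul_of_pos_left hc.1 hε, hc.2⟩, ← mul_sub]
        exact norm_sqrt_mul_besselI_le (mul_nonneg hε.le (sub_pos.2 hc.1).le) (sub_pos.2 hc.2)
          one_pos
      · refine tendsto_const_nhds.congr' ?_
        filter_upwards [self_mem_nhdsWithin] with ε (hε : 0 < ε)
        rw [if_neg fun h => hc ⟨lt_of_mul_lt_mul_left h.1 hε.le, h.2⟩]
  refine key.congr' ?_
  filter_upwards [self_mem_nhdsWithin] with ε hε
  exact fredholmDet_rescale _ hε r a

end DeltaKernel

/-! ### The contour integral of the alternating kernel -/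

/-- Shift of a vertical contour in the left half-plane. -/
theorem integral_vertLine_eq_of_bound {f : ℂ → ℂ} (hf : DifferentiableOn ℂ f {z | z.re < 0})
    {L₁ L₂ B : ℝ} (h0 : 0 < L₁) (hL : L₁ ≤ L₂)
    (hB : ∀ L ∈ Set.Icc L₁ L₂, ∀ y : ℝ, ‖f (-(L : ℂ) + y * Complex.I)‖ ≤
      B * Real.exp (-y ^ 2 / 2)) :
    ∫ y : ℝ, f (-(L₁ : ℂ) + y * Complex.I) = ∫ y : ℝ, f (-(L₂ : ℂ) + y * Complex.I) := by
  have hint : ∀ L ∈ Set.Icc L₁ L₂, Integrable fun y : ℝ => f (-(L : ℂ) + y * Complex.I) := by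
    intro L hL'
    refine (integrable_exp_neg_sq_div_two.const_mul B).mono' ?_ (ae_of_all _ (hB L hL'))
    refine Continuous.aestronglyMeasurable (hf.continuousOn.comp_continuous (by fun_prop) ?_)
    intro y
    simp only [Set.mem_ofPred_eq, re_vertLine]
    linarith [hL'.1]
  have hlim : ∀ L ∈ Set.Icc L₁ L₂, Tendsto
      (fun T : ℝ => ∫ y in (-T)..T, f (-(L : ℂ) + y * Complex.I)) atTop
      (𝓝 (∫ y : ℝ, f (-(L : ℂ) + y * Complex.I))) := fun L hL' =>
    intervalIntegral_tendsto_integral (hint L hL') tendsto_neg_atTop_atBot tendsto_id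
  have hhor : ∀ T : ℝ, ‖∫ x in (-L₂)..(-L₁), f (x + T * Complex.I)‖ ≤
      B * Real.exp (-T ^ 2 / 2) * |-L₁ - -L₂| := by
    intro T
    refine intervalIntegral.norm_integral_le_of_norm_le_const fun x hx => ?_
    rw [Set.uIoc_of_le (by linarith)] at hx
    have := hB (-x) ⟨by linarith [hx.2], by linarith [hx.1]⟩ T
    simpa using this
  have hexp : Tendsto (fun T : ℝ => Real.exp (-T ^ 2 / 2)) atTop (𝓝 0) := by
    refine Real.tendsto_exp_atBot.comp ?_
    refine Tendsto.atBot_div_const (by norm_num) ?_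
    exact tendsto_neg_atTop_atBot.comp (tendsto_pow_atTop two_ne_zero)
  -- Stated for g so that it covers both the upper and the lower horizontal side.
  have hhor0 : ∀ g : ℝ → ℝ, (∀ T, g T ^ 2 = T ^ 2) → Tendsto
      (fun T : ℝ => ∫ x in (-L₂)..(-L₁), f (x + g T * Complex.I)) atTop (𝓝 0) := by
    intro g hg
    have h1 : Tendsto (fun T : ℝ => B * Real.exp (-T ^ 2 / 2) * |-L₁ - -L₂|) atTop (𝓝 0) := by
      simpa using (hexp.const_mul B).mul_const (|-L₁ - -L₂|)
    refine squeeze_zero_norm (fun T => ?_) h1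
    have := hhor (g T)
    rwa [hg] at this
  have hrect : ∀ T : ℝ, (∫ x in (-L₂)..(-L₁), f (x + ((-T : ℝ) : ℂ) * Complex.I)) -
      (∫ x in (-L₂)..(-L₁), f (x + T * Complex.I)) +
      Complex.I • (∫ y in (-T)..T, f (-(L₁ : ℂ) + y * Complex.I)) -
      Complex.I • (∫ y in (-T)..T, f (-(L₂ : ℂ) + y * Complex.I)) = 0 := by
    intro T
    have := Complex.integral_boundary_rect_eq_zero_of_differentiableOn f
      (((-L₂ : ℝ) : ℂ) + ((-T : ℝ) : ℂ) * Complex.I) (((-L₁ : ℝ) : ℂ) + (T : ℂ) * Complex.I) ?_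
    · simpa using this
    · refine hf.mono fun z hz => ?_
      have h1 := hz.1
      simp only [Set.mem_preimage, Complex.add_re, Complex.ofReal_re, Complex.mul_re,
        Complex.I_re, mul_zero, Complex.ofReal_im, Complex.I_im, mul_one, sub_self, add_zero] at h1
      rw [Set.uIcc_of_le (by linarith)] at h1
      simp only [Set.mem_ofPred_eq]
      linarith [h1.2]
  have htot := (((hhor0 (fun T => -T) fun T => by ring).sub (hhor0 (fun T => T) fun T => rfl)).add
    ((hlim L₁ ⟨le_rfl, hL⟩).const_smul Complex.I)).sub ((hlim L₂ ⟨hL, le_rfl⟩).const_smul Complex.I)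
  have hzero := tendsto_nhds_unique htot (tendsto_const_nhds.congr fun T => (hrect T).symm)
  have h2 : Complex.I * ((∫ y : ℝ, f (-(L₁ : ℂ) + y * Complex.I)) -
      ∫ y : ℝ, f (-(L₂ : ℂ) + y * Complex.I)) = 0 := by
    simp only [smul_eq_mul] at hzero
    linear_combination hzero
  exact sub_eq_zero.1 ((mul_eq_zero.1 h2).resolve_left Complex.I_ne_zero)

/-- The integrand of the regular part of `altKernel τ` in the variable `τ * x`. -/
def altIntegrand (τ p q : ℝ) (z : ℂ) : ℂ :=
  Complex.exp ((z ^ 2 - τ ^ 4 * (z ^ 2)⁻¹) / 2 + p * z - τ ^ 2 * (q * z⁻¹))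

/-- The contour integral in `altKernel τ` over the line `Re z = -L`. -/
def altContour (L τ p q : ℝ) : ℂ :=
  (2 * Real.pi : ℂ)⁻¹ * ∫ y : ℝ, altIntegrand τ p q (-(L : ℂ) + y * Complex.I)

theorem vertLine_ne_zero {L : ℝ} (hL : 0 < L) (y : ℝ) : -(L : ℂ) + y * Complex.I ≠ 0 := by
  intro h
  have := le_norm_vertLine L y
  rw [h, norm_zero] at this
  linarith

/-- On the line the real part of 1/z is negative and at least -1/L, so only the positive part of q
can enlarge the integrand. -/
theorem norm_altIntegrand_le {L : ℝ} (hL : 0 < L) (τ p q y : ℝ) :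
    ‖altIntegrand τ p q (-(L : ℂ) + y * Complex.I)‖ ≤
      Real.exp (L ^ 2 / 2 + τ ^ 4 / (2 * L ^ 2) - p * L + τ ^ 2 / L * max q 0) *
        Real.exp (-y ^ 2 / 2) := by
  set z : ℂ := -(L : ℂ) + y * Complex.I with hz
  have hzL : L ≤ ‖z‖ := le_norm_vertLine L y
  have hzre : z.re = -L := re_vertLine L y
  have e1 : (z ^ 2).re = L ^ 2 - y ^ 2 := re_vertLine_sq L y
  have e2 : -(τ ^ 4 / L ^ 2) ≤ ((τ : ℂ) ^ 4 * (z ^ 2)⁻¹).re := by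
    have h1 := (abs_le.1 (Complex.abs_re_le_norm ((τ : ℂ) ^ 4 * (z ^ 2)⁻¹))).1
    refine le_trans (neg_le_neg ?_) h1
    rw [norm_mul, norm_inv, norm_pow, norm_pow, Complex.norm_real, Real.norm_eq_abs,
      Even.pow_abs (by decide), ← div_eq_mul_inv]
    gcongr
  have e3 : (p * z).re = -(p * L) := by
    rw [Complex.re_ofReal_mul, hzre]
    ring
  have e4 : -(τ ^ 2 / L * max q 0) ≤ ((τ : ℂ) ^ 2 * (q * z⁻¹)).re := by
    have h1 : (τ : ℂ) ^ 2 = ((τ ^ 2 : ℝ) : ℂ) := by push_cast; rfl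
    rw [h1, Complex.re_ofReal_mul, Complex.re_ofReal_mul, Complex.inv_re, hzre]
    have h2 : L ^ 2 ≤ Complex.normSq z := by
      rw [Complex.normSq_eq_norm_sq]
      gcongr
    have h3 : L / Complex.normSq z ≤ 1 / L := by
      rw [div_le_div_iff₀ ((pow_pos hL 2).trans_le h2) hL]
      linarith
    have h4 : 0 ≤ L / Complex.normSq z := div_nonneg hL.le (Complex.normSq_nonneg z)
    have h5 : q * (L / Complex.normSq z) ≤ max q 0 * (1 / L) := by
      calc q * (L / Complex.normSq z) ≤ max q 0 * (L / Complex.normSq z) := by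
            gcongr
            exact le_max_left _ _
        _ ≤ _ := by gcongr
    have h6 := mul_le_mul_of_nonneg_left h5 (sq_nonneg τ)
    have h7 : τ ^ 2 * (q * (-L / Complex.normSq z)) = -(τ ^ 2 * (q * (L / Complex.normSq z))) := by
      ring
    rw [h7]
    refine neg_le_neg (h6.trans (le_of_eq ?_))
    ring
  unfold altIntegrand
  rw [Complex.norm_exp, ← Real.exp_add]
  refine Real.exp_le_exp.2 ?_
  have e5 : ((z ^ 2 - (τ : ℂ) ^ 4 * (z ^ 2)⁻¹) / 2).re =
      ((z ^ 2).re - ((τ : ℂ) ^ 4 * (z ^ 2)⁻¹).re) / 2 := by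
    rw [← Complex.sub_re]
    exact Complex.div_ofNat_re _ 2
  rw [Complex.sub_re, Complex.add_re, e5, e1, e3]
  have e6 : τ ^ 4 / (2 * L ^ 2) = τ ^ 4 / L ^ 2 / 2 := by
    rw [div_div, mul_comm]
  rw [e6]
  linarith

/-- The original line becomes Re z = -τ after rescaling and would reach the singularity as τ → 0.
Moving it to a fixed distance L makes the limit regular and leaves L free for the estimates. -/
theorem altContour_eq {L₁ L₂ : ℝ} (h₁ : 0 < L₁) (h₂ : 0 < L₂) (τ p q : ℝ) :
    altContour L₁ τ p q = altContour L₂ τ p q := by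
  wlog hL : L₁ ≤ L₂ generalizing L₁ L₂
  · exact (this h₂ h₁ (le_of_not_ge hL)).symm
  unfold altContour
  congr 1
  refine integral_vertLine_eq_of_bound (f := altIntegrand τ p q)
    (B := Real.exp (L₂ ^ 2 / 2 + τ ^ 4 / (2 * L₁ ^ 2) + |p| * L₂ + τ ^ 2 / L₁ * max q 0))
    ?_ h₁ hL fun L hL' y => ?_
  · intro z hz
    have hz0 : z ≠ 0 := by
      rintro rfl
      simp at hz
    refine DifferentiableAt.differentiableWithinAt ?_
    unfold altIntegrand
    have h1 : DifferentiableAt ℂ (fun z : ℂ => (z ^ 2)⁻¹) z :=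
      (differentiableAt_id.pow 2).inv (pow_ne_zero 2 hz0)
    have h2 : DifferentiableAt ℂ (fun z : ℂ => z⁻¹) z := differentiableAt_inv hz0
    fun_prop
  · have hL0 : 0 < L := h₁.trans_le hL'.1
    refine (norm_altIntegrand_le hL0 τ p q y).trans ?_
    have e1 : -p * L ≤ |p| * L₂ := by
      calc -p * L ≤ |p| * L := by gcongr; exact neg_le_abs p
        _ ≤ |p| * L₂ := by gcongr; exact hL'.2
    have e2 : L ^ 2 / 2 ≤ L₂ ^ 2 / 2 := by gcongr; exact hL'.2
    have e3 : τ ^ 4 / (2 * L ^ 2) ≤ τ ^ 4 / (2 * L₁ ^ 2) := by gcongr; exact hL'.1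
    have e4 : τ ^ 2 / L * max q 0 ≤ τ ^ 2 / L₁ * max q 0 := by gcongr; exact hL'.1
    exact mul_le_mul_of_nonneg_right (Real.exp_le_exp.2 (by linarith)) (Real.exp_pos _).le

theorem norm_altContour_le {L : ℝ} (hL : 0 < L) (τ p q : ℝ) :
    ‖altContour L τ p q‖ ≤
      Real.exp (L ^ 2 / 2 + τ ^ 4 / (2 * L ^ 2) - p * L + τ ^ 2 / L * max q 0) *
        ∫ y : ℝ, Real.exp (-y ^ 2 / 2) := by
  unfold altContour
  rw [norm_mul]
  have h1 : ‖(2 * Real.pi : ℂ)⁻¹‖ ≤ 1 := by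
    rw [norm_inv]
    refine inv_le_one_of_one_le₀ ?_
    simp only [norm_mul, Complex.norm_real, Complex.norm_ofNat, Real.norm_of_nonneg Real.pi_pos.le]
    linarith [Real.pi_gt_three]
  have h2 := norm_integral_le_of_norm_le (integrable_exp_neg_sq_div_two.const_mul _)
    (ae_of_all _ fun y => norm_altIntegrand_le hL τ p q y)
  rw [integral_const_mul] at h2
  calc _ ≤ 1 * _ := mul_le_mul h1 h2 (norm_nonneg _) zero_le_one
    _ = _ := one_mul _

theorem continuous_altIntegrand {L : ℝ} (hL : 0 < L) :
    Continuous fun x : (ℝ × ℝ × ℝ) × ℝ =>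
      altIntegrand x.1.1 x.1.2.1 x.1.2.2 (-(L : ℂ) + x.2 * Complex.I) := by
  unfold altIntegrand
  have h1 : Continuous fun x : (ℝ × ℝ × ℝ) × ℝ => (-(L : ℂ) + x.2 * Complex.I)⁻¹ :=
    Continuous.inv₀ (by fun_prop) fun x => vertLine_ne_zero hL x.2
  have h2 : Continuous fun x : (ℝ × ℝ × ℝ) × ℝ => ((-(L : ℂ) + x.2 * Complex.I) ^ 2)⁻¹ :=
    Continuous.inv₀ (by fun_prop) fun x => pow_ne_zero 2 (vertLine_ne_zero hL x.2)
  fun_prop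

theorem continuous_altContour {L : ℝ} (hL : 0 < L) :
    Continuous fun x : ℝ × ℝ × ℝ => altContour L x.1 x.2.1 x.2.2 := by
  unfold altContour
  refine continuous_const.mul (continuous_iff_continuousAt.2 fun x₀ => ?_)
  set B : ℝ × ℝ × ℝ → ℝ := fun x => Real.exp (L ^ 2 / 2 + x.1 ^ 4 / (2 * L ^ 2) - x.2.1 * L +
    x.1 ^ 2 / L * max x.2.2 0) with hB
  have hBc : Continuous B := by fun_prop
  refine continuousAt_of_dominated (bound := fun y => (B x₀ + 1) * Real.exp (-y ^ 2 / 2))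
    ?_ ?_ (integrable_exp_neg_sq_div_two.const_mul _) ?_
  · refine Eventually.of_forall fun x => Continuous.aestronglyMeasurable ?_
    have h : Continuous fun y : ℝ => (x, y) := by fun_prop
    simpa only [Function.comp_def] using (continuous_altIntegrand hL).comp h
  · have h1 : ∀ᶠ x in 𝓝 x₀, B x < B x₀ + 1 :=
      hBc.continuousAt.eventually_lt continuousAt_const (by linarith)
    filter_upwards [h1] with x hx
    refine ae_of_all _ fun y => (norm_altIntegrand_le hL _ _ _ y).trans ?_
    gcongr
  · refine ae_of_all _ fun y => ?_
    have h : Continuous fun x : ℝ × ℝ × ℝ => (x, y) := by fun_prop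
    simpa only [Function.comp_def] using ((continuous_altIntegrand hL).comp h).continuousAt

theorem altContour_zero (L p q : ℝ) : altContour L 0 p q = (gaussianPDFReal 0 1 p : ℂ) := by
  unfold altContour
  have h1 : ∀ y : ℝ, altIntegrand 0 p q (-(L : ℂ) + y * Complex.I) =
      Complex.exp ((-(L : ℂ) + y * Complex.I) ^ 2 / 2 + p * (-(L : ℂ) + y * Complex.I)) := by
    intro y
    simp [altIntegrand]
  simp_rw [h1]
  rw [integral_vertLine_gaussian]
  have hpi : (Real.pi : ℂ) ≠ 0 := by exact_mod_cast Real.pi_ne_zero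
  push_cast
  field_simp

/-- In u and v the exponent depends on the space variables through p = u - r₂ and q = v - r₁, and
the Bessel term is that of the step kernel with time difference τ²(r₂ - r₁) and space difference v -
u. -/
theorem altKernel_reg {τ L : ℝ} (hτ : 0 < τ) (hL : 0 < L) (r₁ r₂ u v : ℝ) :
    (altKernel τ).reg r₁ (u - r₁) r₂ (v - r₂) = altContour L τ (u - r₂) (v - r₁) -
      if r₁ < r₂ ∧ u < v then
        (√(τ ^ 2 * (r₂ - r₁) / (v - u)) : ℂ) *
          besselI 1 (2 * √((v - u) * (τ ^ 2 * (r₂ - r₁))))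
      else 0 := by
  have hτ' : (τ : ℂ) ≠ 0 := by exact_mod_cast hτ.ne'
  have hA : (τ : ℂ) * (2 * Real.pi * Complex.I)⁻¹ * vertIntegral (fun x =>
      Complex.exp (τ ^ 2 * ((x ^ 2 - (x ^ 2)⁻¹) / 2) +
        τ * ((u - r₁ : ℝ) * x - (v - r₂ : ℝ) * x⁻¹ - (r₂ - r₁) * (x + x⁻¹)))) =
      altContour L τ (u - r₂) (v - r₁) := by
    rw [altContour_eq hL hτ, vertIntegral_eq]
    have h1 : ∀ y : ℝ, Complex.exp (τ ^ 2 * (((-((1 : ℝ) : ℂ) + y * Complex.I) ^ 2 -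
        ((-((1 : ℝ) : ℂ) + y * Complex.I) ^ 2)⁻¹) / 2) +
        τ * ((u - r₁ : ℝ) * (-((1 : ℝ) : ℂ) + y * Complex.I) -
          (v - r₂ : ℝ) * (-((1 : ℝ) : ℂ) + y * Complex.I)⁻¹ -
          (r₂ - r₁) * ((-((1 : ℝ) : ℂ) + y * Complex.I) +
            (-((1 : ℝ) : ℂ) + y * Complex.I)⁻¹))) =
        altIntegrand τ (u - r₂) (v - r₁) (-(τ : ℂ) + (τ * y : ℝ) * Complex.I) := by
      intro y
      have h2 : -(τ : ℂ) + (τ * y : ℝ) * Complex.I =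
          τ * (-((1 : ℝ) : ℂ) + y * Complex.I) := by
        push_cast
        ring
      rw [h2, altIntegrand]
      have h3 := vertLine_ne_zero one_pos y
      set x : ℂ := -((1 : ℝ) : ℂ) + y * Complex.I with hx
      congr 1
      push_cast
      field_simp
      ring
    simp_rw [h1]
    -- The Jacobian of z = τx cancels the prefactor τ of the kernel.
    rw [integral_mul_const, Measure.integral_comp_mul_left
      (fun y => altIntegrand τ (u - r₂) (v - r₁) (-(τ : ℂ) + y * Complex.I)), altContour,
      abs_of_pos (inv_pos.2 hτ), Complex.real_smul]
    have hpi : (Real.pi : ℂ) ≠ 0 := by exact_mod_cast Real.pi_ne_zero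
    have hI := Complex.I_ne_zero
    push_cast
    field_simp
  have hcond : (r₁ < r₂ ∧ 0 < v - r₂ - (u - r₁) + (r₂ - r₁)) ↔ (r₁ < r₂ ∧ u < v) := by
    refine and_congr_right fun _ => ?_
    constructor <;> intro h <;> linarith
  rw [← hA]
  simp only [altKernel]
  rw [if_congr hcond rfl rfl]
  congr 1
  by_cases hc : r₁ < r₂ ∧ u < v
  · rw [if_pos hc, if_pos hc]
    have hρ : 0 < r₂ - r₁ := sub_pos.2 hc.1
    have hd : 0 < v - u := sub_pos.2 hc.2
    have e1 : 2 * τ * √((r₂ - r₁) * (r₂ - r₁ + (v - r₂ - (u - r₁)))) =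
        2 * √((v - u) * (τ ^ 2 * (r₂ - r₁))) := by
      have : (v - u) * (τ ^ 2 * (r₂ - r₁)) =
          τ ^ 2 * ((r₂ - r₁) * (r₂ - r₁ + (v - r₂ - (u - r₁)))) := by ring
      rw [this, Real.sqrt_mul (sq_nonneg τ), Real.sqrt_sq hτ.le]
      ring
    have e2 : √(τ ^ 2 * (r₂ - r₁) / (v - u)) =
        τ / √(1 + (v - r₂ - (u - r₁)) / (r₂ - r₁)) := by
      have : 1 + (v - r₂ - (u - r₁)) / (r₂ - r₁) = (v - u) / (r₂ - r₁) := by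
        field_simp
        ring
      rw [this, mul_div_assoc, Real.sqrt_mul (sq_nonneg τ), Real.sqrt_sq hτ.le,
        div_eq_mul_inv τ, ← Real.sqrt_inv, inv_div]
    rw [e1, e2]
    push_cast
    ring
  · rw [if_neg hc, if_neg hc]

theorem altKernel_reg' {τ : ℝ} (hτ : 0 < τ) (r₁ s₁ r₂ s₂ : ℝ) :
    (altKernel τ).reg r₁ s₁ r₂ s₂ = altContour 1 τ (s₁ + r₁ - r₂) (s₂ + r₂ - r₁) -
      if r₁ < r₂ ∧ s₁ + r₁ < s₂ + r₂ then
        (√(τ ^ 2 * (r₂ - r₁) / (s₂ + r₂ - (s₁ + r₁))) : ℂ) *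
          besselI 1 (2 * √((s₂ + r₂ - (s₁ + r₁)) * (τ ^ 2 * (r₂ - r₁))))
      else 0 := by
  have := altKernel_reg hτ one_pos r₁ r₂ (s₁ + r₁) (s₂ + r₂)
  rwa [add_sub_cancel_right, add_sub_cancel_right] at this

theorem measurable_altKernel_reg {τ : ℝ} (hτ : 0 < τ) (r₁ r₂ : ℝ) :
    Measurable fun x : ℝ × ℝ => (altKernel τ).reg r₁ x.1 r₂ x.2 := by
  simp only [altKernel_reg' hτ]
  refine Measurable.sub ?_ (Measurable.ite ?_ ?_ measurable_const)
  · exact ((continuous_altContour one_pos).comp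
      (by fun_prop : Continuous fun x : ℝ × ℝ => (τ, x.1 + r₁ - r₂, x.2 + r₂ - r₁))).measurable
  · exact (MeasurableSet.const (r₁ < r₂)).inter
      (measurableSet_lt (measurable_fst.add_const _) (measurable_snd.add_const _))
  · refine Measurable.mul ?_ ((continuous_besselI 1).measurable.comp (by fun_prop))
    exact Complex.measurable_ofReal.comp (by fun_prop)

/-! ### The kernel of X₁ -/

theorem gaussianPDFReal_le_exp (x : ℝ) : gaussianPDFReal 0 1 x ≤ Real.exp (1 / 2 - x) := by
  rw [gaussianPDFReal_zero_one]
  have h1 : 1 ≤ √(2 * Real.pi) := Real.one_le_sqrt.2 (by linarith [Real.pi_gt_three])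
  refine (div_le_self (Real.exp_pos _).le h1).trans (Real.exp_le_exp.2 ?_)
  nlinarith [sq_nonneg (x - 1)]

theorem continuous_gaussianPDFReal_zero_one : Continuous (gaussianPDFReal 0 1) := by
  rw [funext gaussianPDFReal_zero_one]
  fun_prop

theorem xOneKernel_reg (r₁ s₁ r₂ s₂ : ℝ) :
    xOneKernel.reg r₁ s₁ r₂ s₂ = (gaussianPDFReal 0 1 (s₁ + r₁ - r₂) : ℂ) := by
  rw [gaussianPDFReal_zero_one]
  rfl

theorem measurable_xOneKernel_reg (r₁ r₂ : ℝ) :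
    Measurable fun x : ℝ × ℝ => xOneKernel.reg r₁ x.1 r₂ x.2 := by
  simp only [xOneKernel_reg]
  exact Complex.measurable_ofReal.comp (continuous_gaussianPDFReal_zero_one.measurable.comp
    (by fun_prop))

/-! ### Exponential bounds and limits for the alternating kernel and for X₁ -/

namespace DeltaKernel

variable {m : ℕ}

theorem abs_le_sum_abs (r : Fin m → ℝ) (j : Fin m) : |r j| ≤ ∑ j, |r j| :=
  Finset.single_le_sum (f := fun j => |r j|) (fun _ _ => abs_nonneg _) (Finset.mem_univ j)

theorem exists_expBound_alt (r a : Fin m → ℝ) {τ₀ : ℝ} (hτ₀ : 0 < τ₀) :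
    ∃ b C κ M c, ∀ τ ∈ Set.Ioc (0 : ℝ) τ₀, (altKernel τ).ExpBound r a b C κ M c := by
  set R := ∑ j, |r j| with hR
  have hrR : ∀ j, |r j| ≤ R := abs_le_sum_abs r
  have hR0 : 0 ≤ R := Finset.sum_nonneg fun j _ => abs_nonneg _
  set b := -∑ j, |a j| - R with hb
  have hba : ∀ j, b ≤ a j + r j := fun j => by
    have h1 := abs_le_sum_abs a j
    have h2 := neg_abs_le (a j)
    have h3 := neg_abs_le (r j)
    have h4 := hrR j
    linarith
  set I := ∫ y : ℝ, Real.exp (-y ^ 2 / 2) with hI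
  have hI0 : 0 ≤ I := integral_nonneg fun y => (Real.exp_pos _).le
  set L := τ₀ + 1 with hL
  have hL0 : 0 < L := by linarith
  have hb0 := abs_nonneg b
  set γ := (τ₀ + L) / 2 with hγ
  have hγ0 : 0 < γ := by positivity
  set A := Real.exp (L ^ 2 + R * L + τ₀ * (2 * |b| + R)) * I with hA
  set B := 2 * (τ₀ ^ 2 * (2 * R)) * Real.exp (τ₀ ^ 2 * (2 * R) / γ) with hB
  have hA0 : 0 ≤ A := by positivity
  have hB0 : 0 ≤ B := by positivity
  obtain ⟨C, κ, M, c, h⟩ := exists_expBound r a b (α := τ₀) (β := L) (C₀ := A + B)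
    (by linarith) (by positivity)
  refine ⟨b, C, κ, M, c, fun τ hτ => h _ hba fun i j u v hu hv => ?_⟩
  change ‖(altKernel τ).reg (r i) (u - r i) (r j) (v - r j)‖ ≤ _
  rw [altKernel_reg hτ.1 hL0]
  have hri := abs_le.1 (hrR i)
  have hrj := abs_le.1 (hrR j)
  have hτsq : τ ^ 2 ≤ τ₀ ^ 2 := pow_le_pow_left₀ hτ.1.le hτ.2 2
  refine (norm_sub_le _ _).trans (add_le_add ?_ ?_)
  · refine (norm_altContour_le hL0 _ _ _).trans ?_
    have hv' : -|b| ≤ v := (neg_abs_le b).trans hv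
    have e1 : τ ^ 4 / (2 * L ^ 2) ≤ L ^ 2 / 2 := by
      rw [div_le_div_iff₀ (by positivity) two_pos]
      have : τ ^ 4 ≤ L ^ 4 := pow_le_pow_left₀ hτ.1.le (hτ.2.trans (by linarith)) 4
      nlinarith
    have e2 : τ ^ 2 / L ≤ τ₀ := by
      rw [div_le_iff₀ hL0]
      nlinarith [hτsq]
    have e3 : max (v - r i) 0 ≤ v + 2 * |b| + R := max_le (by linarith) (by linarith)
    have e4 : τ ^ 2 / L * max (v - r i) 0 ≤ τ₀ * (v + 2 * |b| + R) :=
      mul_le_mul e2 e3 (le_max_right _ _) hτ₀.le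
    have e5 : r j * L ≤ R * L := mul_le_mul_of_nonneg_right hrj.2 hL0.le
    calc _ ≤ Real.exp ((L ^ 2 + R * L + τ₀ * (2 * |b| + R)) + (-L * u + τ₀ * v)) * I := by
          refine mul_le_mul_of_nonneg_right (Real.exp_le_exp.2 ?_) hI0
          linarith
      _ = A * Real.exp (-L * u + τ₀ * v) := by rw [Real.exp_add, hA]; ring
      _ ≤ _ := by gcongr; linarith
  · by_cases hc : r i < r j ∧ u < v
    · rw [if_pos hc, if_pos hc]
      have hρ0 : 0 ≤ r j - r i := by linarith [hc.1]
      have hρ1 : τ ^ 2 * (r j - r i) ≤ τ₀ ^ 2 * (2 * R) :=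
        mul_le_mul hτsq (by linarith) hρ0 (sq_nonneg _)
      refine (norm_sqrt_mul_besselI_le (mul_nonneg (sq_nonneg τ) hρ0) (sub_pos.2 hc.2)
        hγ0).trans ?_
      refine mul_le_mul_of_nonneg_right ?_ (Real.exp_pos _).le
      calc 2 * (τ ^ 2 * (r j - r i)) * Real.exp (τ ^ 2 * (r j - r i) / γ)
          ≤ 2 * (τ₀ ^ 2 * (2 * R)) * Real.exp (τ₀ ^ 2 * (2 * R) / γ) := by gcongr
        _ ≤ A + B := by linarith
    · rw [if_neg hc, if_neg hc, norm_zero]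

theorem exists_expBound_xOne (r a : Fin m → ℝ) :
    ∃ b C κ M c, ∀ ε ∈ Set.Ioc (0 : ℝ) 1, (xOneKernel.rescale ε).ExpBound r a b C κ M c := by
  set R := ∑ j, |r j| with hR
  have hR0 : 0 ≤ R := Finset.sum_nonneg fun j _ => abs_nonneg _
  set b := -∑ j, |a j| - R with hb
  -- The Gaussian does not involve v and is dominated by exp(1/2 - x) in the row variable, which
  -- gives the rates 0 and 1.
  obtain ⟨C, κ, M, c, h⟩ := exists_expBound r a b (α := 0) (β := 1)
    (C₀ := Real.exp (1 / 2 + R)) one_pos (Real.exp_pos _).le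
  refine ⟨b, C, κ, M, c, fun ε hε => ?_⟩
  have hεr : ∀ l, |ε * r l| ≤ R := fun l => by
    rw [abs_mul, abs_of_pos hε.1]
    calc ε * |r l| ≤ 1 * |r l| := by gcongr; exact hε.2
      _ ≤ R := by rw [one_mul]; exact abs_le_sum_abs r l
  refine h _ (fun j => ?_) fun i j u v hu hv => ?_
  · have h1 := abs_le_sum_abs a j
    have h2 := neg_abs_le (a j)
    have h3 := neg_abs_le (ε * r j)
    have h4 := hεr j
    change b ≤ a j + ε * r j
    linarith
  change ‖xOneKernel.reg (ε * r i) (u - ε * r i) (ε * r j) (v - ε * r j)‖ ≤ _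
  rw [xOneKernel_reg, sub_add_cancel, Complex.norm_real,
    Real.norm_of_nonneg (gaussianPDFReal_nonneg _ _ _)]
  have hnn : 0 ≤ if r i < r j ∧ u < v then
      Real.exp (1 / 2 + R) * Real.exp ((0 + 1) / 2 * (v - u)) else 0 := by
    split_ifs <;> positivity
  refine le_trans ?_ (le_add_of_nonneg_right hnn)
  refine (gaussianPDFReal_le_exp _).trans ?_
  rw [← Real.exp_add]
  refine Real.exp_le_exp.2 ?_
  have := (abs_le.1 (hεr j)).2
  linarith

theorem fredholmConverges_alt (r a : Fin m → ℝ) {τ : ℝ} (hτ : 0 < τ) :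
    (altKernel τ).FredholmConverges r a := by
  obtain ⟨b, C, κ, M, c, h⟩ := exists_expBound_alt r a hτ
  exact (h τ ⟨hτ, le_rfl⟩).fredholmConverges fun i j => measurable_altKernel_reg hτ _ _

theorem fredholmConverges_xOne (r a : Fin m → ℝ) : xOneKernel.FredholmConverges r a := by
  obtain ⟨b, C, κ, M, c, h⟩ := exists_expBound_xOne r a
  have h1 := h 1 (by simp)
  rw [rescale_one] at h1
  exact h1.fredholmConverges fun i j => measurable_xOneKernel_reg _ _

theorem tendsto_fredholmDet_xOne {r : Fin m → ℝ} (hr : Function.Injective r) (a : Fin m → ℝ) :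
    Tendsto (fun ε : ℝ => xOneKernel.fredholmDet (fun j => ε * r j) a) (𝓝[>] 0)
      (𝓝 (((gaussianReal 0 1).real {z | ∀ j, z < a j} : ℝ) : ℂ)) := by
  obtain ⟨b, C, κ, M, c, h⟩ := exists_expBound_xOne r a
  have hIoc : ∀ᶠ ε : ℝ in 𝓝[>] 0, ε ∈ Set.Ioc (0 : ℝ) 1 := Ioc_mem_nhdsGT one_pos
  have hmul : ∀ x : ℝ, Tendsto (fun ε : ℝ => ε * x) (𝓝[>] 0) (𝓝 0) := fun x => by
    have hid : Tendsto (fun ε : ℝ => ε) (𝓝[>] 0) (𝓝 0) := tendsto_id.mono_left nhdsWithin_le_nhds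
    simpa using hid.mul_const x
  rw [← fredholmDet_gaussianKernel hr]
  have key : Tendsto (fun ε : ℝ => (xOneKernel.rescale ε).fredholmDet r a) (𝓝[>] 0)
      (𝓝 (gaussianKernel.fredholmDet r a)) := by
    refine tendsto_fredholmDet (hIoc.mono fun ε hε => h ε hε)
      (Eventually.of_forall fun ε i j => measurable_xOneKernel_reg _ _)
      (fun j => hmul (r j)) fun i j u v => ?_
    change Tendsto (fun ε => xOneKernel.reg (ε * r i) (u - ε * r i) (ε * r j) (v - ε * r j)) _
      (𝓝 (gaussianPDFReal 0 1 (u - 0) : ℂ))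
    simp only [xOneKernel_reg, sub_add_cancel]
    have h1 : Tendsto (fun ε : ℝ => u - ε * r j) (𝓝[>] 0) (𝓝 (u - 0)) := (hmul (r j)).const_sub u
    exact (Complex.continuous_ofReal.tendsto _).comp
      ((continuous_gaussianPDFReal_zero_one.tendsto _).comp h1)
  refine key.congr' ?_
  filter_upwards [self_mem_nhdsWithin] with ε hε
  exact fredholmDet_rescale _ hε r a

theorem tendsto_fredholmDet_alt (r a : Fin m → ℝ) :
    Tendsto (fun τ : ℝ => (altKernel τ).fredholmDet r a) (𝓝[>] 0)
      (𝓝 (xOneKernel.fredholmDet r a)) := by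
  obtain ⟨b, C, κ, M, c, h⟩ := exists_expBound_alt r a one_pos
  have hIoc : ∀ᶠ τ : ℝ in 𝓝[>] 0, τ ∈ Set.Ioc (0 : ℝ) 1 := Ioc_mem_nhdsGT one_pos
  have hid : Tendsto (fun τ : ℝ => τ) (𝓝[>] 0) (𝓝 0) := tendsto_id.mono_left nhdsWithin_le_nhds
  refine tendsto_fredholmDet (hIoc.mono fun τ hτ => h τ hτ)
    (hIoc.mono fun τ hτ i j => measurable_altKernel_reg hτ.1 _ _)
    (fun _ => tendsto_const_nhds) fun i j u v => ?_
  change Tendsto (fun τ => (altKernel τ).reg (r i) (u - r i) (r j) (v - r j)) _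
    (𝓝 (xOneKernel.reg (r i) (u - r i) (r j) (v - r j)))
  -- At τ = 0 the second parameter of the contour integral is irrelevant; it is chosen to match the
  -- integrals with τ > 0.
  rw [xOneKernel_reg, sub_add_cancel, ← altContour_zero 1 _ (v - r i), ← sub_zero (altContour _ _ _ _)]
  have key : Tendsto (fun τ : ℝ => altContour 1 τ (u - r j) (v - r i) -
      if r i < r j ∧ u < v then (√(τ ^ 2 * (r j - r i) / (v - u)) : ℂ) *
          besselI 1 (2 * √((v - u) * (τ ^ 2 * (r j - r i)))) else 0) (𝓝[>] 0)
      (𝓝 (altContour 1 0 (u - r j) (v - r i) - 0)) := by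
    refine Tendsto.sub ?_ ?_
    · have h1 : Tendsto (fun τ : ℝ => (τ, u - r j, v - r i)) (𝓝[>] 0)
          (𝓝 ((0 : ℝ), u - r j, v - r i)) :=
        hid.prodMk_nhds tendsto_const_nhds
      have h2 := ((continuous_altContour one_pos).tendsto ((0 : ℝ), u - r j, v - r i)).comp h1
      simpa only [Function.comp_def] using h2
    · by_cases hc : r i < r j ∧ u < v
      · simp only [if_pos hc]
        have h2 : Tendsto (fun τ : ℝ => 2 * (τ ^ 2 * (r j - r i)) *
            Real.exp (τ ^ 2 * (r j - r i) / 1) * Real.exp (1 * (v - u))) (𝓝[>] 0) (𝓝 0) := by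
          have h3 : Continuous fun τ : ℝ => 2 * (τ ^ 2 * (r j - r i)) *
            Real.exp (τ ^ 2 * (r j - r i) / 1) * Real.exp (1 * (v - u)) := by fun_prop
          have h4 := (h3.tendsto 0).comp hid
          simpa only [Function.comp_def, zero_mul, mul_zero, ne_eq, OfNat.ofNat_ne_zero,
            not_false_eq_true, zero_pow] using h4
        refine squeeze_zero_norm (fun τ => ?_) h2
        exact norm_sqrt_mul_besselI_le (mul_nonneg (sq_nonneg τ) (sub_pos.2 hc.1).le)
          (sub_pos.2 hc.2) one_pos
      · simp only [if_neg hc]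
        exact tendsto_const_nhds
  refine key.congr' ?_
  filter_upwards [self_mem_nhdsWithin] with τ hτ
  exact (altKernel_reg hτ one_pos _ _ _ _).symm

/-- With a single time the shift is constant and the time difference in the Gaussian vanishes, so
the formula for row-dependent kernels applies without a limit. -/
theorem fredholmDet_xOne_one_point (r a : ℝ) :
    xOneKernel.fredholmDet (fun _ : Fin 1 => r) (fun _ => a) =
      (((gaussianReal 0 1).real (Set.Iio a) : ℝ) : ℂ) := by
  rw [fredholmDet_rankOne (Function.injective_of_subsingleton _) (h := r)
    (φ := gaussianPDFReal 0 1) (fun _ => rfl)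
    (fun _ _ s s' => by rw [xOneKernel_reg, add_sub_cancel_right])
    (integral_gaussianPDFReal_eq_one 0 one_ne_zero), ← gaussianReal_real_eq_integral]
  congr 3
  ext z
  simp

end DeltaKernel

/-! ### Conclusions for the processes -/

theorem ProbabilityTheory.HasLaw.real_forall_lt {Ω : Type*} [MeasurableSpace Ω] {P : Measure Ω}
    {N : Ω → ℝ} {ν : Measure ℝ} (hN : HasLaw N ν P) {m : ℕ} (a : Fin m → ℝ) :
    P.real {ω | ∀ j, N ω < a j} = ν.real {z | ∀ j, z < a j} := by
  have hmeas : MeasurableSet {z : ℝ | ∀ j, z < a j} := by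
    rw [Set.ofPred_forall]
    exact MeasurableSet.iInter fun j => measurableSet_Iio
  rw [measureReal_def, measureReal_def, hN.measure_eq hmeas]

end

theorem mainTheorem5 :
    -- the step process at small times: joint distribution functions
    (∀ (m : ℕ) (r : Fin m → ℝ), Function.Injective r → (∀ j, 0 ≤ r j) → ∀ a : Fin m → ℝ,
      stepKernel.FredholmConverges r a ∧
      Tendsto (fun ε : ℝ => stepKernel.fredholmDet (fun j => ε * r j) a) (𝓝[>] 0)
        (𝓝 (((gaussianReal 0 1).real {z | ∀ j, z < a j} : ℝ) : ℂ))) ∧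
    -- the step process at small times: convergence to a single standard normal variable
    (∀ {Ω Ω' : Type*} [MeasurableSpace Ω] [MeasurableSpace Ω']
      (P : Measure Ω) [IsProbabilityMeasure P] (P' : Measure Ω') [IsProbabilityMeasure P']
      (X : ℝ≥0 → Ω → ℝ) (N : Ω' → ℝ),
      IsFredholmProcess stepKernel (fun t : ℝ≥0 => (t : ℝ)) X P →
      HasLaw N (gaussianReal 0 1) P' →
      TendstoFDD (fun (ε : ℝ≥0) r => X (ε * r)) (𝓝[>] 0) (fun _ => N) (fun _ => P) P') ∧
    -- the alternating process as `τ → 0`: joint distribution functions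
    (∀ (m : ℕ) (r : Fin m → ℝ), Function.Injective r → ∀ a : Fin m → ℝ,
      (∀ τ : ℝ, 0 < τ → (altKernel τ).FredholmConverges r a) ∧
      xOneKernel.FredholmConverges r a ∧
      Tendsto (fun τ : ℝ => (altKernel τ).fredholmDet r a) (𝓝[>] 0)
        (𝓝 (xOneKernel.fredholmDet r a))) ∧
    -- the alternating process as `τ → 0`: convergence to the process `X₁`
    (∀ {Ω : Set.Ioi (0 : ℝ) → Type*} {Ω' : Type*} [∀ τ, MeasurableSpace (Ω τ)] [MeasurableSpace Ω']
      (P : (τ : Set.Ioi (0 : ℝ)) → Measure (Ω τ)) [∀ τ, IsProbabilityMeasure (P τ)]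
      (P' : Measure Ω') [IsProbabilityMeasure P']
      (X : (τ : Set.Ioi (0 : ℝ)) → ℝ → Ω τ → ℝ) (X₁ : ℝ → Ω' → ℝ),
      (∀ τ : Set.Ioi (0 : ℝ), IsFredholmProcess (altKernel τ) (fun t : ℝ => t) (X τ) (P τ)) →
      IsFredholmProcess xOneKernel (fun t : ℝ => t) X₁ P' →
      TendstoFDD X (comap (fun τ : Set.Ioi (0 : ℝ) => (τ : ℝ)) (𝓝 0)) X₁ P P') ∧
    -- the one-point distributions of `X₁` are standard normal
    (∀ r a : ℝ, xOneKernel.fredholmDet (fun _ : Fin 1 => r) (fun _ => a) =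
      (((gaussianReal 0 1).real (Set.Iio a) : ℝ) : ℂ)) ∧
    (∀ {Ω : Type*} [MeasurableSpace Ω] (P : Measure Ω) [IsProbabilityMeasure P] (X₁ : ℝ → Ω → ℝ),
      IsFredholmProcess xOneKernel (fun t : ℝ => t) X₁ P →
      ∀ r, HasLaw (X₁ r) (gaussianReal 0 1) P) ∧
    -- the process `X₁` at small times: joint distribution functions
    (∀ (m : ℕ) (r : Fin m → ℝ), Function.Injective r → ∀ a : Fin m → ℝ,
      Tendsto (fun ε : ℝ => xOneKernel.fredholmDet (fun j => ε * r j) a) (𝓝[>] 0)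
        (𝓝 (((gaussianReal 0 1).real {z | ∀ j, z < a j} : ℝ) : ℂ))) ∧
    -- the process `X₁` at small times: convergence to a single standard normal variable
    (∀ {Ω Ω' : Type*} [MeasurableSpace Ω] [MeasurableSpace Ω']
      (P : Measure Ω) [IsProbabilityMeasure P] (P' : Measure Ω') [IsProbabilityMeasure P']
      (X₁ : ℝ → Ω → ℝ) (N : Ω' → ℝ),
      IsFredholmProcess xOneKernel (fun t : ℝ => t) X₁ P →
      HasLaw N (gaussianReal 0 1) P' →
      TendstoFDD (fun (ε : ℝ) r => X₁ (ε * r)) (𝓝[>] 0) (fun _ => N) (fun _ => P) P') := by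
  refine ⟨fun m r hr _ a => ⟨DeltaKernel.fredholmConverges_step r a,
      DeltaKernel.tendsto_fredholmDet_step hr a⟩, ?_,
    fun m r _ a => ⟨fun τ hτ => DeltaKernel.fredholmConverges_alt r a hτ,
      DeltaKernel.fredholmConverges_xOne r a, DeltaKernel.tendsto_fredholmDet_alt r a⟩, ?_,
    DeltaKernel.fredholmDet_xOne_one_point, ?_,
    fun m r hr a => DeltaKernel.tendsto_fredholmDet_xOne hr a, ?_⟩
  · intro Ω Ω' _ _ P _ P' _ X N hX hNlaw
    refine tendstoFDD_of_tendsto_orthant (fun ε t => hX.aemeasurable _)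
      (fun _ => hNlaw.aemeasurable) fun m r hr a => ?_
    rw [hNlaw.real_forall_lt a]
    have hr' : Function.Injective fun j => (r j : ℝ) := fun x y h => hr (NNReal.coe_injective h)
    have hcoe : Tendsto (fun ε : ℝ≥0 => (ε : ℝ)) (𝓝[>] 0) (𝓝[>] 0) := by
      refine tendsto_nhdsWithin_iff.2 ⟨?_, ?_⟩
      · exact (NNReal.continuous_coe.tendsto 0).mono_left nhdsWithin_le_nhds
      · filter_upwards [self_mem_nhdsWithin] with ε hε using NNReal.coe_pos.2 hε
    refine tendsto_ofReal_iff.1 (((DeltaKernel.tendsto_fredholmDet_step hr' a).comp hcoe).congr' ?_)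
    filter_upwards [self_mem_nhdsWithin] with ε (hε : 0 < ε)
    -- For ε > 0 the rescaled times are still distinct, so the process with these times has the
    -- determinants as joint distribution functions.
    have hinj : Function.Injective fun j => ε * r j := (mul_right_injective₀ hε.ne').comp hr
    rw [← hX.fredholmDet_eq hinj a]
    simp
  · intro Ω Ω' _ _ P _ P' _ X X₁ hX hX₁
    refine tendstoFDD_of_tendsto_orthant (fun τ t => (hX τ).aemeasurable t)
      hX₁.aemeasurable fun m r hr a => ?_
    -- The parameters are positive by their type, so the pulled-back filter at 0 is the one-sided
    -- limit.
    have hcoe : Tendsto (fun τ : Set.Ioi (0 : ℝ) => (τ : ℝ))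
        (comap (fun τ : Set.Ioi (0 : ℝ) => (τ : ℝ)) (𝓝 0)) (𝓝[>] 0) :=
      tendsto_nhdsWithin_iff.2 ⟨tendsto_comap, Eventually.of_forall fun τ => τ.2⟩
    refine tendsto_ofReal_iff.1 ?_
    rw [← hX₁.fredholmDet_eq hr a]
    exact ((DeltaKernel.tendsto_fredholmDet_alt r a).comp hcoe).congr fun τ => (hX τ).fredholmDet_eq hr a
  · intro Ω _ P _ X₁ hX₁ r
    refine hasLaw_of_real_lt_eq (hX₁.aemeasurable r) fun a => ?_
    have h1 := hX₁.fredholmDet_eq (r := fun _ : Fin 1 => r) (Function.injective_of_subsingleton _)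
      fun _ => a
    rw [DeltaKernel.fredholmDet_xOne_one_point] at h1
    simpa using (Complex.ofReal_injective h1).symm
  · intro Ω Ω' _ _ P _ P' _ X₁ N hX₁ hNlaw
    refine tendstoFDD_of_tendsto_orthant (fun ε t => hX₁.aemeasurable _)
      (fun _ => hNlaw.aemeasurable) fun m r hr a => ?_
    rw [hNlaw.real_forall_lt a]
    refine tendsto_ofReal_iff.1 ((DeltaKernel.tendsto_fredholmDet_xOne hr a).congr' ?_)
    filter_upwards [self_mem_nhdsWithin] with ε (hε : 0 < ε)
    have hinj : Function.Injective fun j => ε * r j := (mul_right_injective₀ hε.ne').comp hr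
    exact hX₁.fredholmDet_eq hinj a
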